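/- Let $p$ be a prime. For an $\mathbb F_p$-algebra $R$ let $R^\flat=\lim_{x\mapsto x^p}R$, and let $\mathbb G_a^{\mathrm{perf}}=\operatorname{Spec}\mathbb F_p[x^{1/p^\infty}]$ be the ring scheme $R\mapsto R^\flat$. A perfect ring $B$ (of characteristic $p$) is identified with $B^\flat$. **Nilpotent quasi-ideals.** A pointed $\mathbb G_a^{\mathrm{perf}}$-module is an affine $\mathbb F_p$-scheme $X$ whose functor of points is a module over $R\mapsto R^\flat$, together with a linear map $d:X\to\mathbb G_a^{\mathrm{perf}}$; morphisms are linear maps compatible with $d$. It is a quasi-ideal if $d(x)\,y=d(y)\,x$ for all $R$ and all $x,y\in X(R)$. A quasi-ideal is nilpotent if the image $t\in\Gamma(X,\mathcal O_X)$ of $x$ under the map $\mathbb F_p[x^{1/p^\infty}]\to\Gamma(X,\mathcal O_X)$ defined by $d$ is nilpotent. Let $\mathcal N\mathrm{QID}$ be the category of nilpotent quasi-ideals, a full subcategory of pointed $\mathbb G_a^{\mathrm{perf}}$-modules. **Unwinding.** Let $\mathrm{QRSP}$ be the category of $\mathbb F_p$-algebras $S$ such that $S^\flat\to S$ is surjective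 and the cotangent complex $\mathbb L_{S/\mathbb F_p}$ is a flat $S$-module placed in homological degree $1$. Let $\mathfrak G:\mathrm{QRSP}\to\mathrm{Alg}_{\mathbb F_p}$ be $S\mapsto S^\flat$. For a pointed $\mathbb G_a^{\mathrm{perf}}$-module $X$, a perfect ring $B$ and an ideal $I\subset B$, let $\mathrm{Env}_X(B,I)$ be the $B$-algebra which corepresents the functor sending a $B$-algebra $T$ to the set of $B$-linear maps $\varphi:I\to X(T)$ such that $d\circ\varphi$ is the composition $I\subset B\to T^\flat$. Put $\mathrm{Un}(X)(S)=\mathrm{Env}_X(S^\flat,\ker(S^\flat\to S))$. This is a contravariant functor $X\mapsto\mathrm{Un}(X)$ to the category $\mathrm{Fun}(\mathrm{QRSP},\mathrm{Alg}_{\mathbb F_p})_{\mathfrak G/}$ of functors under $\mathfrak G$. **Tensor conditions.** Perfect rings $B$, the algebras $B[x^{1/p^\infty}]$ and $S_B:=B[x^{1/p^\infty}]/x$, and the two- and threefold tensor powers of $S_B$ over $B$ belong to $\mathrm{QRSP}$. Let $\mathrm{Fun}(\mathrm{QRSP},\mathrm{Alg}_{\mathbb F_p})^{\otimes}_{\mathfrak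 G/}$ be the full subcategory of those $F$ under $\mathfrak G$ such that for every perfect ring $B$ the following natural maps are isomorphisms: 1. $\mathfrak G(B)\to F(B)$; 2. $F(S_B)\otimes_BF(S_B)\to F(S_B\otimes_BS_B)$; 3. $F(S_{\mathbb F_p})\otimes_{\mathbb F_p}B\to F(S_B)$. Let $\mathrm{Fun}^{\otimes,3}$ be the full subcategory of $\mathrm{Fun}(\mathrm{QRSP},\mathrm{Alg}_{\mathbb F_p})^{\otimes}_{\mathfrak G/}$ of those $F$ for which also $F(S_B\otimes_BS_B)\otimes_BF(S_B)\to F(S_B\otimes_BS_B\otimes_BS_B)$ is an isomorphism for every perfect ring $B$. **Theorem.** (a) For every nilpotent quasi-ideal $X$ the functor $\mathrm{Un}(X)$ lies in $\mathrm{Fun}^{\otimes,3}$, hence in $\mathrm{Fun}(\mathrm{QRSP},\mathrm{Alg}_{\mathbb F_p})^{\otimes}_{\mathfrak G/}$, and the functor $$\mathrm{Un}:\mathcal N\mathrm{QID}^{\mathrm{op}}\to\mathrm{Fun}(\mathrm{QRSP},\mathrm{Alg}_{\mathbb F_p})^{\otimes}_{\mathfrak G/}$$ is fully faithful. (b) There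 is a functor $r:\mathrm{Fun}^{\otimes,3}\to\mathcal N\mathrm{QID}^{\mathrm{op}}$ with $r(F)=\operatorname{Spec}F(S_{\mathbb F_p})$, naturally in $F$, where the addition of $r(F)$ is induced by $x^{1/p^n}\mapsto x^{1/p^n}\otimes1+1\otimes x^{1/p^n}$, the action of an element $b$ of a perfect ring $B$ by the endomorphism $x^{1/p^n}\mapsto b^{1/p^n}x^{1/p^n}$ of $S_B$, and the map to $\mathbb G_a^{\mathrm{perf}}$ by $\mathbb F_p[x^{1/p^\infty}]\to S_{\mathbb F_p}$. The functor $r$ is right adjoint to $\mathrm{Un}:\mathcal N\mathrm{QID}^{\mathrm{op}}\to\mathrm{Fun}^{\otimes,3}$, and the unit $X\to r\,\mathrm{Un}(X)$ of the adjunction is an isomorphism for every nilpotent quasi-ideal $X$. -/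

import Mathlib

open CategoryTheory
open scoped TensorProduct

universe u

namespace Unwinding

noncomputable section

/-! ### Tilts of `𝔽_p`-algebras -/

section Tilt

variable (p : ℕ) [Fact p.Prime]

/-- In an `𝔽_p`-algebra the `p`-th power map is a ring homomorphism. -/
def frob (R : Type*) [CommRing R] [Algebra (ZMod p) R] : R →ₐ[ZMod p] R :=
  FiniteField.frobeniusAlgHom (ZMod p) R

theorem frob_apply (R : Type*) [CommRing R] [Algebra (ZMod p) R] (x : R) :
    frob p R x = x ^ p := by
  simp [frob, FiniteField.frobeniusAlgHom, ZMod.card]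

/-- The tilt `R^♭ = lim_{x ↦ x^p} R` of an `𝔽_p`-algebra `R`: sequences `(a₀, a₁, …)` in `R` with
`a_{n+1}^p = a_n`, with termwise operations. -/
def tilt (R : Type*) [CommRing R] [Algebra (ZMod p) R] : Subalgebra (ZMod p) (ℕ → R) where
  carrier := {a | ∀ n, a (n + 1) ^ p = a n}
  mul_mem' {a b} ha hb n := by
    change (a (n + 1) * b (n + 1)) ^ p = a n * b n
    rw [mul_pow, ha n, hb n]
  add_mem' {a b} ha hb n := by
    change (a (n + 1) + b (n + 1)) ^ p = a n + b n
    rw [← frob_apply, map_add, frob_apply, frob_apply, ha n, hb n]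
  algebraMap_mem' c n := by
    change (algebraMap (ZMod p) R c) ^ p = algebraMap (ZMod p) R c
    rw [← frob_apply, AlgHom.commutes]

variable {p}

namespace tilt

variable {R S T : Type*} [CommRing R] [Algebra (ZMod p) R] [CommRing S] [Algebra (ZMod p) S]
  [CommRing T] [Algebra (ZMod p) T]

/-- The `n`-th term of an element of the tilt; `coeff 0` is the natural map `R^♭ → R`. -/
def coeff (n : ℕ) : tilt p R →ₐ[ZMod p] R :=
  (Pi.evalAlgHom (ZMod p) (fun _ : ℕ => R) n).comp (tilt p R).val

theorem coeff_apply (n : ℕ) (a : tilt p R) : coeff n a = a.1 n := rfl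

@[ext] theorem ext {a b : tilt p R} (h : ∀ n, coeff n a = coeff n b) : a = b :=
  Subtype.ext (funext h)

theorem coeff_succ_pow (n : ℕ) (a : tilt p R) : coeff (n + 1) a ^ p = coeff n a := a.2 n

/-- Functoriality of the tilt. -/
def map (f : R →ₐ[ZMod p] S) : tilt p R →ₐ[ZMod p] tilt p S :=
  AlgHom.codRestrict ((AlgHom.pi fun n => f.comp (coeff n)))
    (tilt p S) (fun a n => by
      change f (coeff (n + 1) a) ^ p = f (coeff n a)
      rw [← map_pow, coeff_succ_pow])

@[simp] theorem coeff_map (f : R →ₐ[ZMod p] S) (n : ℕ) (a : tilt p R) :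
    coeff n (map f a) = f (coeff n a) := rfl

theorem map_id (a : tilt p R) : map (AlgHom.id (ZMod p) R) a = a := rfl

theorem map_comp (g : S →ₐ[ZMod p] T) (f : R →ₐ[ZMod p] S) (a : tilt p R) :
    map (g.comp f) a = map g (map f a) := rfl

/-- A compatible system of `p`-power roots, as an element of the tilt. -/
def mk (a : ℕ → R) (ha : ∀ n, a (n + 1) ^ p = a n) : tilt p R := ⟨a, ha⟩

@[simp] theorem coeff_mk (a : ℕ → R) (ha : ∀ n, a (n + 1) ^ p = a n) (n : ℕ) :
    coeff n (mk a ha) = a n := rfl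

instance perfectRing : PerfectRing (tilt p R) p where
  bijective_frobenius := by
    constructor
    · intro a b h
      ext n
      have := congrArg (coeff (n + 1)) h
      simpa only [map_pow, coeff_succ_pow] using this
    · intro a
      refine ⟨mk (fun n => coeff (n + 1) a) fun n => coeff_succ_pow (n + 1) a, ?_⟩
      ext n
      change coeff n ((mk (fun n => coeff (n + 1) a) fun n => coeff_succ_pow (n + 1) a) ^ p) = _
      rw [map_pow, coeff_mk, coeff_succ_pow]

/-- For a perfect ring `B` the natural map `B^♭ → B` is an isomorphism. -/
theorem bijective_coeff_zero (B : Type*) [CommRing B] [Algebra (ZMod p) B] [PerfectRing B p] :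
    Function.Bijective (coeff 0 : tilt p B →ₐ[ZMod p] B) := by
  have hF : Function.Bijective fun x : B => x ^ p := PerfectRing.bijective_frobenius
  constructor
  · intro a b h
    ext n
    induction n with
    | zero => exact h
    | succ n ih =>
      apply hF.1
      change coeff (n + 1) a ^ p = coeff (n + 1) b ^ p
      rw [coeff_succ_pow, coeff_succ_pow, ih]
  · intro b
    refine ⟨mk (fun n => (powMulEquiv B p).symm^[n] b) fun n => ?_, rfl⟩
    rw [Function.iterate_succ_apply', powMulEquiv_symm_pow_p]

/-- The canonical isomorphism `B ≅ B^♭`, `b ↦ (b, b^{1/p}, b^{1/p²}, …)`, for a perfect ring `B`. -/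
def ofPerfect (B : Type*) [CommRing B] [Algebra (ZMod p) B] [PerfectRing B p] :
    B ≃ₐ[ZMod p] tilt p B :=
  (AlgEquiv.ofBijective (coeff 0) (bijective_coeff_zero B)).symm

@[simp] theorem coeff_zero_ofPerfect (B : Type*) [CommRing B] [Algebra (ZMod p) B]
    [PerfectRing B p] (b : B) : coeff 0 (ofPerfect (p := p) B b) = b :=
  (AlgEquiv.ofBijective (coeff 0) (bijective_coeff_zero (p := p) B)).apply_symm_apply b

theorem map_ofPerfect {B C : Type*} [CommRing B] [Algebra (ZMod p) B] [PerfectRing B p]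
    [CommRing C] [Algebra (ZMod p) C] [PerfectRing C p] (f : B →ₐ[ZMod p] C) (b : B) :
    map f (ofPerfect (p := p) B b) = ofPerfect C (f b) := by
  apply (bijective_coeff_zero (p := p) C).1
  simp

end tilt

end Tilt

/-! ### The cotangent complex and quasiregular semiperfect algebras -/

section Cotangent

/-- For a homomorphism `f : A → S` of commutative `k`-algebras, the `S`-module
`S ⊗_A Ω_{A/k}`. -/
def CotFiber {k A S : Type*} [CommRing k] [CommRing A] [Algebra k A] [CommRing S] [Algebra k S]
    (f : A →ₐ[k] S) : Type _ :=
  @TensorProduct A _ S (Ω[A⁄k]) _ _ f.toRingHom.toAlgebra.toModule _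

namespace CotFiber

section Aux

variable {k A S M : Type*} [CommRing k] [CommRing A] [Algebra k A] [CommRing S] [Algebra A S]

theorem aux_add (a b : A) : (1 : S) ⊗ₜ[A] KaehlerDifferential.D k A (a + b) =
    1 ⊗ₜ[A] KaehlerDifferential.D k A a + 1 ⊗ₜ[A] KaehlerDifferential.D k A b := by
  rw [map_add, TensorProduct.tmul_add]

theorem aux_mul (a b : A) : (1 : S) ⊗ₜ[A] KaehlerDifferential.D k A (a * b) =
    algebraMap A S a • ((1 : S) ⊗ₜ[A] KaehlerDifferential.D k A b) +
      algebraMap A S b • ((1 : S) ⊗ₜ[A] KaehlerDifferential.D k A a) := by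
  have h (a b : A) : (1 : S) ⊗ₜ[A] (a • KaehlerDifferential.D k A b) =
      algebraMap A S a • ((1 : S) ⊗ₜ[A] KaehlerDifferential.D k A b) := by
    rw [TensorProduct.tmul_smul, algebraMap_smul]
  rw [Derivation.leibniz, TensorProduct.tmul_add, h, h]

theorem aux_algebraMap (c : k) :
    (1 : S) ⊗ₜ[A] KaehlerDifferential.D k A (algebraMap k A c) = 0 := by
  rw [Derivation.map_algebraMap, TensorProduct.tmul_zero]

variable [AddCommGroup M] [Module S M]

theorem aux_hom_ext {φ ψ : S ⊗[A] Ω[A⁄k] →ₗ[S] M}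
    (h : ∀ a, φ (1 ⊗ₜ[A] KaehlerDifferential.D k A a) =
      ψ (1 ⊗ₜ[A] KaehlerDifferential.D k A a)) : φ = ψ := by
  let _ : Module A M := Module.compHom M (algebraMap A S)
  have : IsScalarTower A S M := ⟨fun a s m => by rw [Algebra.smul_def, mul_smul]; rfl⟩
  apply (LinearMap.liftBaseChangeEquiv (R := A) (M := Ω[A⁄k]) (N := M) S).symm.injective
  exact LinearMap.ext_on_range (v := KaehlerDifferential.D k A)
    (KaehlerDifferential.span_range_derivation k A) h

theorem aux_exists_lift (δ : A → M) (hadd : ∀ a b, δ (a + b) = δ a + δ b)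
    (hmul : ∀ a b, δ (a * b) = algebraMap A S a • δ b + algebraMap A S b • δ a)
    (halg : ∀ c, δ (algebraMap k A c) = 0) : ∃ φ : S ⊗[A] Ω[A⁄k] →ₗ[S] M,
    ∀ a, φ (1 ⊗ₜ[A] KaehlerDifferential.D k A a) = δ a := by
  let _ : Module A M := Module.compHom M (algebraMap A S)
  let _ : Module k M := Module.compHom M (algebraMap k A)
  have : IsScalarTower A S M := ⟨fun a s m => by rw [Algebra.smul_def, mul_smul]; rfl⟩
  have : IsScalarTower k A M := ⟨fun c a m => by rw [Algebra.smul_def, mul_smul]; rfl⟩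
  let D : Derivation k A M :=
    { toFun := δ
      map_add' := hadd
      map_smul' := fun c a => by
        rw [Algebra.smul_def, hmul, halg, smul_zero, add_zero]; rfl
      map_one_eq_zero' := by
        have := halg 1
        rwa [map_one] at this
      leibniz' := hmul }
  refine ⟨LinearMap.liftBaseChange S D.liftKaehlerDifferential, fun a => ?_⟩
  rw [LinearMap.liftBaseChange_one_tmul]
  exact D.liftKaehlerDifferential_comp_D a

variable (k A S) in
/-- The additive group structure of `S ⊗_A Ω_{A/k}`. -/
abbrev auxAddCommGroup : AddCommGroup (S ⊗[A] Ω[A⁄k]) := inferInstance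

variable (k A S) in
/-- The `S`-module structure of `S ⊗_A Ω_{A/k}`. -/
abbrev auxModule : Module S (S ⊗[A] Ω[A⁄k]) := inferInstance

end Aux

variable {k A A' A'' S : Type*} [CommRing k] [CommRing A] [Algebra k A] [CommRing A']
  [Algebra k A'] [CommRing A''] [Algebra k A''] [CommRing S] [Algebra k S]

instance (f : A →ₐ[k] S) : AddCommGroup (CotFiber f) :=
  @auxAddCommGroup k A S _ _ _ _ f.toRingHom.toAlgebra

instance (f : A →ₐ[k] S) : Module S (CotFiber f) :=
  @auxModule k A S _ _ _ _ f.toRingHom.toAlgebra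

/-- The element `1 ⊗ da` of `S ⊗_A Ω_{A/k}`. -/
def d (f : A →ₐ[k] S) (a : A) : CotFiber f :=
  @TensorProduct.tmul A _ S (Ω[A⁄k]) _ _ f.toRingHom.toAlgebra.toModule _ (1 : S)
    (KaehlerDifferential.D k A a)

theorem d_add (f : A →ₐ[k] S) (a b : A) : d f (a + b) = d f a + d f b :=
  @aux_add k A S _ _ _ _ f.toRingHom.toAlgebra a b

theorem d_mul (f : A →ₐ[k] S) (a b : A) : d f (a * b) = f a • d f b + f b • d f a :=
  @aux_mul k A S _ _ _ _ f.toRingHom.toAlgebra a b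

theorem d_algebraMap (f : A →ₐ[k] S) (c : k) : d f (algebraMap k A c) = 0 :=
  @aux_algebraMap k A S _ _ _ _ f.toRingHom.toAlgebra c

theorem hom_ext (f : A →ₐ[k] S) {M : Type*} [AddCommGroup M] [Module S M]
    {φ ψ : CotFiber f →ₗ[S] M} (h : ∀ a, φ (d f a) = ψ (d f a)) : φ = ψ :=
  @aux_hom_ext k A S M _ _ _ _ f.toRingHom.toAlgebra _ _ φ ψ h

theorem exists_lift (f : A →ₐ[k] S) {M : Type*} [AddCommGroup M] [Module S M] (δ : A → M)
    (hadd : ∀ a b, δ (a + b) = δ a + δ b) (hmul : ∀ a b, δ (a * b) = f a • δ b + f b • δ a)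
    (halg : ∀ c, δ (algebraMap k A c) = 0) :
    ∃ φ : CotFiber f →ₗ[S] M, ∀ a, φ (d f a) = δ a :=
  @aux_exists_lift k A S M _ _ _ _ f.toRingHom.toAlgebra _ _ δ hadd hmul halg

/-- The `S`-linear map `S ⊗_A Ω_{A/k} → M`, `s ⊗ da ↦ s δ(a)`, induced by a `k`-derivation
`δ : A → M` into an `S`-module `M`. -/
def lift (f : A →ₐ[k] S) {M : Type*} [AddCommGroup M] [Module S M] (δ : A → M)
    (hadd : ∀ a b, δ (a + b) = δ a + δ b) (hmul : ∀ a b, δ (a * b) = f a • δ b + f b • δ a)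
    (halg : ∀ c, δ (algebraMap k A c) = 0) : CotFiber f →ₗ[S] M :=
  (exists_lift f δ hadd hmul halg).choose

theorem lift_d (f : A →ₐ[k] S) {M : Type*} [AddCommGroup M] [Module S M] (δ : A → M)
    (hadd : ∀ a b, δ (a + b) = δ a + δ b) (hmul : ∀ a b, δ (a * b) = f a • δ b + f b • δ a)
    (halg : ∀ c, δ (algebraMap k A c) = 0) (a : A) :
    lift f δ hadd hmul halg (d f a) = δ a :=
  (exists_lift f δ hadd hmul halg).choose_spec a

/-- Functoriality: for `g : A → A'` over `S`, the map `s ⊗ da ↦ s ⊗ dg(a)`. -/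
def map {f : A →ₐ[k] S} {f' : A' →ₐ[k] S} (g : A →ₐ[k] A') (h : f'.comp g = f) :
    CotFiber f →ₗ[S] CotFiber f' :=
  lift f (fun a => d f' (g a)) (fun a b => by rw [map_add, d_add])
    (fun a b => by rw [map_mul, d_mul, ← h]; rfl)
    (fun c => by rw [AlgHom.commutes, d_algebraMap])

@[simp] theorem map_d {f : A →ₐ[k] S} {f' : A' →ₐ[k] S} (g : A →ₐ[k] A') (h : f'.comp g = f)
    (a : A) : map g h (d f a) = d f' (g a) := lift_d ..

end CotFiber

variable {k : Type} [CommRing k]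

/-- The functor `(A → S) ↦ S ⊗_A Ω_{A/k}` from commutative `k`-algebras over `S` to
`S`-modules. -/
def cotFunctor (S : CommAlgCat.{u} k) : Over S ⥤ ModuleCat.{u} S where
  obj A := ModuleCat.of S (CotFiber A.hom.hom)
  map {A A'} g := ModuleCat.ofHom (CotFiber.map g.left.hom (by
    rw [← CommAlgCat.hom_comp, Over.w]))
  map_id A := by
    ext : 1
    exact CotFiber.hom_ext _ fun a => by simp
  map_comp g g' := by
    ext : 1
    exact CotFiber.hom_ext _ fun a => by simp

/-- The underlying `k`-module of a commutative `k`-algebra. -/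
def toModule : CommAlgCat.{u} k ⥤ ModuleCat.{u} k :=
  forget₂ (CommAlgCat.{u} k) (AlgCat.{u} k) ⋙ forget₂ (AlgCat.{u} k) (ModuleCat.{u} k)

/-- A simplicial resolution `P → S` of a commutative `k`-algebra `S` by polynomial `k`-algebras:
a simplicial commutative `k`-algebra, termwise polynomial, with an augmentation to the constant
simplicial algebra `S` which is a quasi-isomorphism. -/
structure PolynomialResolution (S : CommAlgCat.{u} k) where
  /-- the simplicial algebra -/
  P : SimplicialObject (CommAlgCat.{u} k)
  /-- the augmentation -/
  aug : P ⟶ (SimplicialObject.const (CommAlgCat.{u} k)).obj S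
  polynomial : ∀ n, ∃ σ : Type u, Nonempty (P.obj n ≃ₐ[k] MvPolynomial σ k)
  quasiIso : QuasiIso ((AlgebraicTopology.alternatingFaceMapComplex (ModuleCat.{u} k)).map
    (((SimplicialObject.whiskering _ _).obj toModule).map aug))

/-- The cotangent complex `L_{S/k}`, computed by a simplicial polynomial resolution `P → S`: the
complex of `S`-modules attached to the simplicial `S`-module `n ↦ S ⊗_{P_n} Ω_{P_n/k}`. Up to
quasi-isomorphism it does not depend on the resolution. -/
def PolynomialResolution.cotangentComplex {S : CommAlgCat.{u} k} (P : PolynomialResolution S) :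
    ChainComplex (ModuleCat.{u} S) ℕ :=
  (AlgebraicTopology.alternatingFaceMapComplex (ModuleCat.{u} S)).obj
    (Over.lift P.P P.aug ⋙ cotFunctor S)

variable (p : ℕ) [Fact p.Prime]

/-- An `𝔽_p`-algebra `S` is quasiregular semiperfect if `S^♭ → S` is surjective and the cotangent
complex `L_{S/𝔽_p}` is a flat `S`-module placed in homological degree `1`. -/
def IsQRSP (S : CommAlgCat.{u} (ZMod p)) : Prop :=
  Function.Surjective (tilt.coeff 0 : tilt p S →ₐ[ZMod p] S) ∧
    ∃ P : PolynomialResolution S,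
      (∀ i, i ≠ 1 → Limits.IsZero (P.cotangentComplex.homology i)) ∧
      Module.Flat S (P.cotangentComplex.homology 1)

/-- The category of quasiregular semiperfect algebras and ring homomorphisms. -/
abbrev QRSP := ObjectProperty.FullSubcategory (IsQRSP.{u} p)

end Cotangent

/-! ### `𝔾_a^perf`-modules and quasi-ideals -/

section Modules

variable (p : ℕ) [Fact p.Prime]

/-- A `𝔾_a^perf`-module over `𝔽_p`: an affine scheme `X = Spec Γ` over `𝔽_p` whose functor of
points `R ↦ X(R) = Hom(Γ, R)` is equipped with the structure of a module over the ring scheme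
`R ↦ 𝔾_a^perf(R) = R^♭`. -/
structure GaPerfModule where
  /-- the algebra of global functions `Γ(X, 𝒪_X)` -/
  Γ : CommAlgCat.{u} (ZMod p)
  [addCommGroup : ∀ R : CommAlgCat.{u} (ZMod p), AddCommGroup (Γ ⟶ R)]
  [module : ∀ R : CommAlgCat.{u} (ZMod p), Module (tilt p R) (Γ ⟶ R)]
  add_comp : ∀ {R R' : CommAlgCat.{u} (ZMod p)} (x y : Γ ⟶ R) (f : R ⟶ R'),
    (x + y) ≫ f = x ≫ f + y ≫ f
  smul_comp : ∀ {R R' : CommAlgCat.{u} (ZMod p)} (a : tilt p R) (x : Γ ⟶ R) (f : R ⟶ R'),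
    (a • x) ≫ f = tilt.map f.hom a • (x ≫ f)

attribute [instance] GaPerfModule.addCommGroup GaPerfModule.module

/-- A pointed `𝔾_a^perf`-module: a `𝔾_a^perf`-module `X` with a map of `𝔾_a^perf`-modules
`d : X → 𝔾_a^perf`. -/
structure PointedModule extends GaPerfModule.{u} p where
  /-- the map `d`, on `R`-points -/
  d : ∀ R : CommAlgCat.{u} (ZMod p), (Γ ⟶ R) →ₗ[tilt p R] tilt p R
  d_comp : ∀ {R R' : CommAlgCat.{u} (ZMod p)} (x : Γ ⟶ R) (f : R ⟶ R'),
    d R' (x ≫ f) = tilt.map f.hom (d R x)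

variable {p}

namespace PointedModule

/-- A map of pointed `𝔾_a^perf`-modules `X → Y`: a map of schemes, i.e. an algebra map
`Γ(Y, 𝒪_Y) → Γ(X, 𝒪_X)`, which is linear on points and commutes with the maps to `𝔾_a^perf`. -/
@[ext]
structure Hom (X Y : PointedModule.{u} p) where
  /-- the pullback of functions -/
  pullback : Y.Γ ⟶ X.Γ
  map_add : ∀ {R : CommAlgCat.{u} (ZMod p)} (x y : X.Γ ⟶ R),
    pullback ≫ (x + y) = pullback ≫ x + pullback ≫ y
  map_smul : ∀ {R : CommAlgCat.{u} (ZMod p)} (a : tilt p R) (x : X.Γ ⟶ R),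
    pullback ≫ (a • x) = a • (pullback ≫ x)
  map_d : ∀ {R : CommAlgCat.{u} (ZMod p)} (x : X.Γ ⟶ R), Y.d R (pullback ≫ x) = X.d R x

instance : Category (PointedModule.{u} p) where
  Hom := Hom
  id X :=
    { pullback := 𝟙 X.Γ
      map_add := fun x y => by simp
      map_smul := fun a x => by simp
      map_d := fun x => by simp }
  comp {X Y Z} f g :=
    { pullback := g.pullback ≫ f.pullback
      map_add := fun x y => by simp only [Category.assoc, f.map_add, g.map_add]
      map_smul := fun a x => by simp only [Category.assoc, f.map_smul, g.map_smul]
      map_d := fun x => by rw [Category.assoc, g.map_d, f.map_d] }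
  id_comp f := Hom.ext (Category.comp_id f.pullback)
  comp_id f := Hom.ext (Category.id_comp f.pullback)
  assoc f g h := Hom.ext (Category.assoc h.pullback g.pullback f.pullback).symm

@[simp] theorem id_pullback (X : PointedModule.{u} p) : Hom.pullback (𝟙 X) = 𝟙 X.Γ := rfl

@[simp] theorem comp_pullback {X Y Z : PointedModule.{u} p} (f : X ⟶ Y) (g : Y ⟶ Z) :
    (f ≫ g).pullback = g.pullback ≫ f.pullback := rfl

/-- The pointed module `d : X → 𝔾_a^perf` is a quasi-ideal if `d(x) y = d(y) x` on points. -/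
def IsQuasiIdeal (X : PointedModule.{u} p) : Prop :=
  ∀ (R : CommAlgCat.{u} (ZMod p)) (x y : X.Γ ⟶ R), X.d R x • y = X.d R y • x

/-- The element `t ∈ Γ(X, 𝒪_X)` which is the image of `x` under the map
`𝔽_p[x^{1/p^∞}] → Γ(X, 𝒪_X)` corresponding to `d : X → 𝔾_a^perf`. -/
def t (X : PointedModule.{u} p) : X.Γ := tilt.coeff 0 (X.d X.Γ (𝟙 X.Γ))

/-- Nilpotent quasi-ideals in `𝔾_a^perf`: quasi-ideals for which `t` is nilpotent. -/
def IsNilpotentQuasiIdeal (X : PointedModule.{u} p) : Prop :=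
  X.IsQuasiIdeal ∧ IsNilpotent X.t

end PointedModule

variable (p) in
/-- The category of nilpotent quasi-ideals in `𝔾_a^perf` over `𝔽_p`. -/
abbrev NilpotentQuasiIdeal :=
  ObjectProperty.FullSubcategory
    (PointedModule.IsNilpotentQuasiIdeal : ObjectProperty (PointedModule.{u} p))

end Modules

/-! ### Enveloping algebras and the unwinding functor -/

section Envelope

variable {p : ℕ} [Fact p.Prime]

/-- Let `X` be a pointed `𝔾_a^perf`-module, `B` a perfect ring, `I` an ideal of `B` and `T` a
`B`-algebra via `f : B → T`. This is the condition on a map `φ : I → X(T)` to be `B`-linear, where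
`B ≅ B^♭` acts on `X(T)` through `B^♭ → T^♭`, and to satisfy that `d ∘ φ` is the composition
`I ⊂ B ≅ B^♭ → T^♭`. -/
structure IsPointedLinear (X : PointedModule.{u} p) {B : Type u} [CommRing B]
    [Algebra (ZMod p) B] [PerfectRing B p] (I : Ideal B) {T : CommAlgCat.{u} (ZMod p)}
    (f : B →ₐ[ZMod p] T) (φ : I → (X.Γ ⟶ T)) : Prop where
  map_add : ∀ i j, φ (i + j) = φ i + φ j
  map_smul : ∀ (b : B) (i : I), φ (b • i) = tilt.map f (tilt.ofPerfect B b) • φ i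
  map_d : ∀ i : I, X.d T (φ i) = tilt.map f (tilt.ofPerfect B (i : B))

theorem IsPointedLinear.map {X Y : PointedModule.{u} p} (u : X ⟶ Y) {B B' : Type u} [CommRing B]
    [Algebra (ZMod p) B] [PerfectRing B p] [CommRing B'] [Algebra (ZMod p) B'] [PerfectRing B' p]
    {I : Ideal B} {I' : Ideal B'} (g : B →ₐ[ZMod p] B') (hg : ∀ i : I, g i ∈ I')
    {T T' : CommAlgCat.{u} (ZMod p)} {f : B' →ₐ[ZMod p] T} {φ : I' → (X.Γ ⟶ T)}
    (hφ : IsPointedLinear X I' f φ) (h : T ⟶ T') :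
    IsPointedLinear Y I ((h.hom.comp f).comp g)
      (fun i => u.pullback ≫ φ ⟨g i, hg i⟩ ≫ h) where
  map_add i j := by
    have : (⟨g (i + j : I), hg (i + j)⟩ : I') = ⟨g i, hg i⟩ + ⟨g j, hg j⟩ :=
      Subtype.ext (_root_.map_add g _ _)
    rw [this, hφ.map_add, X.add_comp, u.map_add]
  map_smul b i := by
    have : (⟨g (b • i : I), hg (b • i)⟩ : I') = g b • ⟨g i, hg i⟩ :=
      Subtype.ext (_root_.map_mul g _ _)
    rw [this, hφ.map_smul, X.smul_comp, u.map_smul, ← tilt.map_comp, tilt.map_comp _ g,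
      tilt.map_ofPerfect g]
  map_d i := by
    rw [u.map_d, X.d_comp, hφ.map_d, ← tilt.map_comp, tilt.map_comp _ g, tilt.map_ofPerfect g]

namespace Env

variable (X : PointedModule.{u} p) {B : Type u} [CommRing B] [Algebra (ZMod p) B] (I : Ideal B)

/-- The relations which make `g ↦ x_{i,g}` an algebra map for each `i ∈ I`. -/
def coprodIdeal : Ideal (MvPolynomial (I × X.Γ) B) :=
  Ideal.span {q | (∃ i g h, q = MvPolynomial.X (i, g + h) -
      (MvPolynomial.X (i, g) + MvPolynomial.X (i, h))) ∨
    (∃ i g h, q = MvPolynomial.X (i, g * h) - MvPolynomial.X (i, g) * MvPolynomial.X (i, h)) ∨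
    ∃ i c, q = MvPolynomial.X (i, algebraMap (ZMod p) X.Γ c) -
      MvPolynomial.C (algebraMap (ZMod p) B c)}

/-- The coproduct of `B` and of copies of `Γ(X, 𝒪_X)` indexed by `I`: the `B`-algebra which
classifies arbitrary maps of sets `I → X(T)`. -/
def Coprod : CommAlgCat.{u} (ZMod p) :=
  CommAlgCat.of (ZMod p) (MvPolynomial (I × X.Γ) B ⧸ coprodIdeal X I)

/-- The structure map of the `B`-algebra `Coprod`. -/
def Coprod.incl : B →ₐ[ZMod p] Coprod X I :=
  (Ideal.Quotient.mkₐ (ZMod p) (coprodIdeal X I)).comp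
    (IsScalarTower.toAlgHom (ZMod p) B (MvPolynomial (I × X.Γ) B))

/-- The class of `x_{i,g}`. -/
def Coprod.gen (i : I) (g : X.Γ) : Coprod X I :=
  Ideal.Quotient.mk (coprodIdeal X I) (MvPolynomial.X (i, g))

theorem Coprod.gen_algebraMap (i : I) (c : ZMod p) :
    gen X I i (algebraMap (ZMod p) X.Γ c) = algebraMap (ZMod p) (Coprod X I) c :=
  Ideal.Quotient.eq.mpr (Ideal.subset_span (Or.inr (Or.inr ⟨i, c, rfl⟩)))

/-- The universal map of sets `I → X(T)`. -/
def Coprod.pt (i : I) : X.Γ ⟶ Coprod X I :=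
  CommAlgCat.ofHom
    { toFun := gen X I i
      map_one' := by
        have h := gen_algebraMap X I i 1
        rwa [map_one, map_one] at h
      map_zero' := by
        have h := gen_algebraMap X I i 0
        rwa [map_zero, map_zero] at h
      map_mul' := fun g h =>
        Ideal.Quotient.eq.mpr (Ideal.subset_span (Or.inr (Or.inl ⟨i, g, h, rfl⟩)))
      map_add' := fun g h => Ideal.Quotient.eq.mpr (Ideal.subset_span (Or.inl ⟨i, g, h, rfl⟩))
      commutes' := gen_algebraMap X I i }

variable {X I}

theorem Coprod.coprodIdeal_le {T : CommAlgCat.{u} (ZMod p)} (f : B →ₐ[ZMod p] T)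
    (φ : I → (X.Γ ⟶ T)) : coprodIdeal X I ≤ RingHom.ker
      (MvPolynomial.aevalTower f fun ig : I × X.Γ => (φ ig.1).hom ig.2) := by
  refine Ideal.span_le.mpr ?_
  rintro q (⟨i, g, h, rfl⟩ | ⟨i, g, h, rfl⟩ | ⟨i, c, rfl⟩) <;> simp [RingHom.mem_ker]

/-- The universal property of `Coprod`. -/
def Coprod.lift {T : CommAlgCat.{u} (ZMod p)} (f : B →ₐ[ZMod p] T) (φ : I → (X.Γ ⟶ T)) :
    Coprod X I ⟶ T :=
  CommAlgCat.ofHom (Ideal.Quotient.liftₐ (coprodIdeal X I)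
    (MvPolynomial.aevalTower f fun ig : I × X.Γ => (φ ig.1).hom ig.2)
    (fun _ h => coprodIdeal_le f φ h))

theorem Coprod.lift_comp_incl {T : CommAlgCat.{u} (ZMod p)} (f : B →ₐ[ZMod p] T)
    (φ : I → (X.Γ ⟶ T)) : (lift f φ).hom.comp (incl X I) = f :=
  AlgHom.ext fun b => MvPolynomial.aevalTower_C f _ b

theorem Coprod.pt_lift {T : CommAlgCat.{u} (ZMod p)} (f : B →ₐ[ZMod p] T) (φ : I → (X.Γ ⟶ T))
    (i : I) : pt X I i ≫ lift f φ = φ i := by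
  ext g
  exact MvPolynomial.aevalTower_X f _ (i, g)

theorem Coprod.hom_ext {T : Type*} [CommRing T] [Algebra (ZMod p) T]
    {α β : Coprod X I →ₐ[ZMod p] T} (h : ∀ b, α (incl X I b) = β (incl X I b))
    (h' : ∀ i g, α (gen X I i g) = β (gen X I i g)) : α = β := by
  apply Ideal.Quotient.algHom_ext
  apply AlgHom.coe_ringHom_injective
  apply MvPolynomial.ringHom_ext
  · exact h
  · exact fun ig => h' ig.1 ig.2

variable (X I) [PerfectRing B p]

/-- The relations which make the universal map `I → X(T)` linear and compatible with `d`. -/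
def ideal : Ideal (Coprod X I) :=
  Ideal.span {q | (∃ i j g, q = (Coprod.pt X I (i + j)).hom g -
      (Coprod.pt X I i + Coprod.pt X I j).hom g) ∨
    (∃ (b : B) (i : I) (g : X.Γ), q = (Coprod.pt X I (b • i)).hom g -
      (tilt.map (Coprod.incl X I) (tilt.ofPerfect B b) • Coprod.pt X I i).hom g) ∨
    ∃ (i : I) (n : ℕ), q = tilt.coeff n (X.d _ (Coprod.pt X I i)) -
      tilt.coeff n (tilt.map (Coprod.incl X I) (tilt.ofPerfect B (i : B)))}

end Env

variable (X : PointedModule.{u} p) {B : Type u} [CommRing B] [Algebra (ZMod p) B]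
  [PerfectRing B p] (I : Ideal B)

/-- The enveloping algebra `Env_X(B, I)` of an ideal `I` of a perfect ring `B`: the universal
`B`-algebra `T` with a `B`-linear map `φ : I → X(T)` such that `d ∘ φ` is the composition
`I ⊂ B ≅ B^♭ → T^♭`. -/
def Env : CommAlgCat.{u} (ZMod p) :=
  CommAlgCat.of (ZMod p) (Env.Coprod X I ⧸ Env.ideal X I)

namespace Env

/-- The quotient map from the coproduct to the enveloping algebra. -/
def proj : Coprod X I ⟶ Env X I :=
  CommAlgCat.ofHom (Ideal.Quotient.mkₐ (ZMod p) (ideal X I))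

/-- The structure map of the `B`-algebra `Env_X(B, I)`. -/
def incl : B →ₐ[ZMod p] Env X I := (proj X I).hom.comp (Coprod.incl X I)

/-- The universal linear map `I → X(Env_X(B, I))`. -/
def univ (i : I) : X.Γ ⟶ Env X I := Coprod.pt X I i ≫ proj X I

theorem isPointedLinear_univ : IsPointedLinear X I (incl X I) (univ X I) where
  map_add i j := by
    unfold univ
    rw [← X.add_comp]
    ext g
    exact Ideal.Quotient.eq.mpr (Ideal.subset_span (Or.inl ⟨i, j, g, rfl⟩))
  map_smul b i := by
    unfold univ incl
    rw [tilt.map_comp, ← X.smul_comp]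
    ext g
    exact Ideal.Quotient.eq.mpr (Ideal.subset_span (Or.inr (Or.inl ⟨b, i, g, rfl⟩)))
  map_d i := by
    unfold univ incl
    rw [tilt.map_comp, X.d_comp]
    ext n
    exact Ideal.Quotient.eq.mpr (Ideal.subset_span (Or.inr (Or.inr ⟨i, n, rfl⟩)))

variable {X I}

theorem ideal_le {T : CommAlgCat.{u} (ZMod p)} (f : B →ₐ[ZMod p] T) (φ : I → (X.Γ ⟶ T))
    (h : IsPointedLinear X I f φ) : ideal X I ≤ RingHom.ker (Coprod.lift f φ).hom := by
  have key (x : X.Γ ⟶ Coprod X I) (g : X.Γ) :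
      (Coprod.lift f φ).hom (x.hom g) = (x ≫ Coprod.lift f φ).hom g := rfl
  refine Ideal.span_le.mpr ?_
  rintro q (⟨i, j, g, rfl⟩ | ⟨b, i, g, rfl⟩ | ⟨i, n, rfl⟩)
  · rw [SetLike.mem_coe, RingHom.mem_ker, map_sub, sub_eq_zero, key, key, X.add_comp,
      Coprod.pt_lift, Coprod.pt_lift, Coprod.pt_lift, h.map_add]
  · rw [SetLike.mem_coe, RingHom.mem_ker, map_sub, sub_eq_zero, key, key, X.smul_comp,
      Coprod.pt_lift, Coprod.pt_lift, h.map_smul, ← tilt.map_comp, Coprod.lift_comp_incl]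
  · rw [SetLike.mem_coe, RingHom.mem_ker, map_sub, sub_eq_zero, ← tilt.coeff_map,
      ← tilt.coeff_map, ← tilt.map_comp, Coprod.lift_comp_incl, ← h.map_d,
      ← Coprod.pt_lift f φ i, X.d_comp]

/-- The universal property of the enveloping algebra: existence. -/
def lift {T : CommAlgCat.{u} (ZMod p)} (f : B →ₐ[ZMod p] T) (φ : I → (X.Γ ⟶ T))
    (h : IsPointedLinear X I f φ) : Env X I ⟶ T :=
  CommAlgCat.ofHom (Ideal.Quotient.liftₐ (ideal X I) (Coprod.lift f φ).hom
    (fun _ ha => ideal_le f φ h ha))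

@[simp] theorem lift_incl {T : CommAlgCat.{u} (ZMod p)} (f : B →ₐ[ZMod p] T)
    (φ : I → (X.Γ ⟶ T)) (h : IsPointedLinear X I f φ) (b : B) :
    (lift f φ h).hom (incl X I b) = f b :=
  DFunLike.congr_fun (Coprod.lift_comp_incl f φ) b

@[simp] theorem univ_lift {T : CommAlgCat.{u} (ZMod p)} (f : B →ₐ[ZMod p] T)
    (φ : I → (X.Γ ⟶ T)) (h : IsPointedLinear X I f φ) (i : I) :
    univ X I i ≫ lift f φ h = φ i :=
  Coprod.pt_lift f φ i

/-- The universal property of the enveloping algebra: uniqueness. -/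
theorem hom_ext {T : CommAlgCat.{u} (ZMod p)} {α β : Env X I ⟶ T}
    (h : ∀ b, α.hom (incl X I b) = β.hom (incl X I b))
    (h' : ∀ i, univ X I i ≫ α = univ X I i ≫ β) : α = β := by
  apply CommAlgCat.hom_ext
  apply Ideal.Quotient.algHom_ext
  refine Coprod.hom_ext h fun i g => ?_
  exact congrArg (fun x : X.Γ ⟶ T => x.hom g) (h' i)

variable {Y Z : PointedModule.{u} p} {B' B'' : Type u} [CommRing B'] [Algebra (ZMod p) B']
  [PerfectRing B' p] [CommRing B''] [Algebra (ZMod p) B''] [PerfectRing B'' p]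
  {I' : Ideal B'} {I'' : Ideal B''}

/-- Functoriality of the enveloping algebra, contravariant in the pointed module. -/
def map (u : X ⟶ Y) (g : B →ₐ[ZMod p] B') (hg : ∀ i : I, g i ∈ I') : Env Y I ⟶ Env X I' :=
  lift ((incl X I').comp g) (fun i => u.pullback ≫ univ X I' ⟨g i, hg i⟩) (by
    simpa using (isPointedLinear_univ X I').map u g hg (𝟙 (Env X I')))

@[simp] theorem map_incl (u : X ⟶ Y) (g : B →ₐ[ZMod p] B') (hg : ∀ i : I, g i ∈ I') (b : B) :
    (map u g hg).hom (incl Y I b) = incl X I' (g b) := lift_incl ..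

@[simp] theorem univ_map (u : X ⟶ Y) (g : B →ₐ[ZMod p] B') (hg : ∀ i : I, g i ∈ I') (i : I) :
    univ Y I i ≫ map u g hg = u.pullback ≫ univ X I' ⟨g i, hg i⟩ := univ_lift ..

theorem map_id (h : ∀ i : I, AlgHom.id (ZMod p) B i ∈ I) :
    map (𝟙 X) (AlgHom.id (ZMod p) B) h = 𝟙 (Env X I) :=
  hom_ext (fun b => map_incl ..) (fun i => by simp)

theorem map_comp (u : X ⟶ Y) (v : Y ⟶ Z) (g : B →ₐ[ZMod p] B') (hg : ∀ i : I, g i ∈ I')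
    (g' : B' →ₐ[ZMod p] B'') (hg' : ∀ i : I', g' i ∈ I'')
    (h : ∀ i : I, g'.comp g i ∈ I'') :
    map v g hg ≫ map u g' hg' = map (u ≫ v) (g'.comp g) h :=
  hom_ext (fun b => by
    rw [CommAlgCat.hom_comp, AlgHom.comp_apply, map_incl, map_incl, map_incl]
    rfl) (fun i => by
    rw [← Category.assoc, univ_map, Category.assoc, univ_map, univ_map]
    simp)

end Env

variable (p) in
/-- The functor `𝔊 : QRSP → Alg_{𝔽_p}`, `S ↦ S^♭`. -/
def tiltFunctor : QRSP.{u} p ⥤ CommAlgCat.{u} (ZMod p) where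
  obj S := CommAlgCat.of (ZMod p) (tilt p S.obj)
  map f := CommAlgCat.ofHom (tilt.map f.hom.hom)

variable (p) in
/-- The ideal `Ker(S^♭ → S)` of `S^♭`. -/
def tiltKer (S : CommAlgCat.{u} (ZMod p)) : Ideal (tilt p S) :=
  RingHom.ker (tilt.coeff 0 : tilt p S →ₐ[ZMod p] S)

theorem map_mem_tiltKer {S S' : CommAlgCat.{u} (ZMod p)} (f : S ⟶ S') (i : tiltKer p S) :
    tilt.map f.hom i ∈ tiltKer p S' := by
  have hi : tilt.coeff 0 (i : tilt p S) = 0 := i.2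
  change tilt.coeff 0 (tilt.map f.hom (i : tilt p S)) = 0
  rw [tilt.coeff_map, hi, map_zero]

/-- The functor `Un(X) : QRSP → Alg_{𝔽_p}`, `S ↦ Env_X(S^♭, Ker(S^♭ → S))`. -/
def unwindingObj (X : PointedModule.{u} p) : QRSP.{u} p ⥤ CommAlgCat.{u} (ZMod p) where
  obj S := Env X (tiltKer p S.obj)
  map f := Env.map (𝟙 X) (tilt.map f.hom.hom) (map_mem_tiltKer f.hom)
  map_id S := Env.map_id _
  map_comp {S S' S''} f g := by
    refine .symm ((Env.map_comp (𝟙 X) (𝟙 X) _ _ _ _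
      (map_mem_tiltKer (f.hom ≫ g.hom))).trans ?_)
    rw [Category.comp_id]
    rfl

/-- The structure map `𝔊 → Un(X)`. -/
def unwindingStr (X : PointedModule.{u} p) : tiltFunctor.{u} p ⟶ unwindingObj X where
  app S := CommAlgCat.ofHom (Env.incl X (tiltKer p S.obj))
  naturality S S' f := by
    ext b
    exact (Env.map_incl (𝟙 X) (tilt.map f.hom.hom) (map_mem_tiltKer f.hom) b).symm

/-- Functoriality of `Un(X)` in `X`. -/
def unwindingMap {X Y : PointedModule.{u} p} (u : X ⟶ Y) : unwindingObj Y ⟶ unwindingObj X where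
  app S := Env.map u (AlgHom.id (ZMod p) (tilt p S.obj)) (fun i => i.2)
  naturality S S' f := by
    refine (Env.map_comp u (𝟙 Y) _ _ _ _ (map_mem_tiltKer f.hom)).trans
      (.trans ?_ (Env.map_comp (𝟙 X) u _ _ _ _ (map_mem_tiltKer f.hom)).symm)
    congr 1

theorem unwindingMap_id (X : PointedModule.{u} p) :
    unwindingMap (𝟙 X) = 𝟙 (unwindingObj X) := by
  ext S : 2
  exact Env.map_id _

theorem unwindingMap_comp {X Y Z : PointedModule.{u} p} (u : X ⟶ Y) (v : Y ⟶ Z) :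
    unwindingMap (u ≫ v) = unwindingMap v ≫ unwindingMap u := by
  ext S : 2
  exact (Env.map_comp u v (AlgHom.id (ZMod p) (tilt p S.obj)) (fun i => i.2)
    (AlgHom.id (ZMod p) (tilt p S.obj)) (fun i => i.2) (fun i => i.2)).symm

theorem unwindingStr_map {X Y : PointedModule.{u} p} (u : X ⟶ Y) :
    unwindingStr Y ≫ unwindingMap u = unwindingStr X := by
  ext S b
  exact Env.map_incl u (AlgHom.id (ZMod p) (tilt p S.obj)) (fun i => i.2) b

variable (p) in
/-- The contravariant unwinding functor, from pointed `𝔾_a^perf`-modules to functors under `𝔊`. -/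
def unwinding : (PointedModule.{u} p)ᵒᵖ ⥤ Under (tiltFunctor.{u} p) where
  obj X := Under.mk (unwindingStr X.unop)
  map u := Under.homMk (unwindingMap u.unop) (unwindingStr_map u.unop)
  map_id X := Under.UnderMorphism.ext (unwindingMap_id X.unop)
  map_comp u v := Under.UnderMorphism.ext (unwindingMap_comp v.unop u.unop)

end Envelope

/-! ### The model algebras -/

section Models

variable {p : ℕ} [Fact p.Prime]

instance perfectRing_uLift_zmod : PerfectRing (ULift.{u} (ZMod p)) p where
  bijective_frobenius := by
    have : (fun x : ULift.{u} (ZMod p) => x ^ p) = id := by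
      ext x
      change x.down ^ p = x.down
      exact ZMod.pow_card x.down
    rw [this]
    exact Function.bijective_id

variable (p)

/-- The initial `𝔽_p`-algebra `𝔽_p`, in an arbitrary universe. -/
abbrev baseField : CommAlgCat.{u} (ZMod p) := CommAlgCat.of (ZMod p) (ULift.{u} (ZMod p))

/-- The map `𝔽_p → B`. -/
def fromBase (B : CommAlgCat.{u} (ZMod p)) : baseField p ⟶ B :=
  CommAlgCat.ofHom ((Algebra.ofId (ZMod p) B).comp
    (ULift.algEquiv : ULift.{u} (ZMod p) ≃ₐ[ZMod p] ZMod p).toAlgHom)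

/-- The ideal of relations `x_{n+1}^p = x_n`. -/
def PerfPoly.relations (B : Type u) [CommRing B] : Ideal (MvPolynomial ℕ B) :=
  Ideal.span (Set.range fun n : ℕ => MvPolynomial.X (n + 1) ^ p - MvPolynomial.X n)

/-- The algebra `B[x^{1/p^∞}]`, presented by generators `x_n = x^{1/p^n}` and relations
`x_{n+1}^p = x_n`. -/
def PerfPoly (B : Type u) [CommRing B] : Type u := MvPolynomial ℕ B ⧸ PerfPoly.relations p B

/-- The ideal of relations `x_{n+1}^p = x_n` and `x_0 = 0`. -/
def Trunc.relations (B : Type u) [CommRing B] : Ideal (MvPolynomial ℕ B) :=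
  Ideal.span (insert (MvPolynomial.X 0)
    (Set.range fun n : ℕ => MvPolynomial.X (n + 1) ^ p - MvPolynomial.X n))

/-- The algebra `B[x^{1/p^∞}]/x`, presented by generators `x_n = x^{1/p^n}` and relations
`x_{n+1}^p = x_n` and `x_0 = 0`. -/
def Trunc (B : Type u) [CommRing B] : Type u := MvPolynomial ℕ B ⧸ Trunc.relations p B

section

variable (B : Type u) [CommRing B] [Algebra (ZMod p) B]

instance : CommRing (PerfPoly p B) := Ideal.Quotient.commRing (PerfPoly.relations p B)

instance : Algebra (ZMod p) (PerfPoly p B) :=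
  Ideal.instAlgebraQuotient (ZMod p) (PerfPoly.relations p B)

instance : CommRing (Trunc p B) := Ideal.Quotient.commRing (Trunc.relations p B)

instance : Algebra B (Trunc p B) := Ideal.instAlgebraQuotient B (Trunc.relations p B)

instance : Algebra (ZMod p) (Trunc p B) :=
  Ideal.instAlgebraQuotient (ZMod p) (Trunc.relations p B)

instance : IsScalarTower (ZMod p) B (Trunc p B) :=
  inferInstanceAs (IsScalarTower (ZMod p) B (MvPolynomial ℕ B ⧸ Trunc.relations p B))

end

variable {p}

/-- The element `x`, together with its system of `p`-power roots, of `B[x^{1/p^∞}]`. -/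
def PerfPoly.x (B : Type u) [CommRing B] [Algebra (ZMod p) B] : tilt p (PerfPoly p B) :=
  tilt.mk (fun n => Ideal.Quotient.mk (PerfPoly.relations p B) (MvPolynomial.X n)) fun n =>
    Ideal.Quotient.eq.mpr (Ideal.subset_span ⟨n, rfl⟩)

namespace Trunc

section

variable (B : Type u) [CommRing B] [Algebra (ZMod p) B]

/-- The system `(x^{1/p^n})_n` of elements of `B[x^{1/p^∞}]/x`. -/
def x : tilt p (Trunc p B) :=
  tilt.mk (fun n => Ideal.Quotient.mk (relations p B) (MvPolynomial.X n)) fun n =>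
    Ideal.Quotient.eq.mpr (Ideal.subset_span (Or.inr ⟨n, rfl⟩))

theorem coeff_zero_x : tilt.coeff 0 (x (p := p) B) = 0 :=
  Ideal.Quotient.eq_zero_iff_mem.mpr (Ideal.subset_span (Or.inl rfl))

/-- The structure map `B → B[x^{1/p^∞}]/x`. -/
def incl : B →ₐ[ZMod p] Trunc p B := IsScalarTower.toAlgHom (ZMod p) B (Trunc p B)

variable {B}
variable {T : Type*} [CommRing T] [Algebra (ZMod p) T]

theorem relations_le (f : B →ₐ[ZMod p] T) (a : tilt p T) (h : tilt.coeff 0 a = 0) :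
    relations p B ≤ RingHom.ker (MvPolynomial.aevalTower f fun n => tilt.coeff n a) := by
  refine Ideal.span_le.mpr ?_
  rintro q (rfl | ⟨n, rfl⟩)
  · simp [RingHom.mem_ker, h]
  · simp [RingHom.mem_ker, tilt.coeff_succ_pow]

/-- The universal property: an algebra map `f : B → T` and a compatible system `(a_n)_n` of
`p`-power roots of `a_0 = 0` in `T` induce the map `x^{1/p^n} ↦ a_n`. -/
def lift (f : B →ₐ[ZMod p] T) (a : tilt p T) (h : tilt.coeff 0 a = 0) : Trunc p B →ₐ[ZMod p] T :=
  Ideal.Quotient.liftₐ (relations p B) (MvPolynomial.aevalTower f fun n => tilt.coeff n a)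
    (fun _ hq => relations_le f a h hq)

theorem lift_incl (f : B →ₐ[ZMod p] T) (a : tilt p T) (h : tilt.coeff 0 a = 0) (b : B) :
    lift f a h (incl B b) = f b :=
  MvPolynomial.aevalTower_C f _ b

theorem lift_x (f : B →ₐ[ZMod p] T) (a : tilt p T) (h : tilt.coeff 0 a = 0) :
    tilt.map (lift f a h) (x B) = a := by
  ext n
  exact MvPolynomial.aevalTower_X f _ n

end

section

variable (B C : CommAlgCat.{u} (ZMod p))

/-- `B[x^{1/p^∞}]/x` as an object. -/
abbrev obj : CommAlgCat.{u} (ZMod p) := CommAlgCat.of (ZMod p) (Trunc p B)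

/-- `B[x^{1/p^∞}]/x ⊗_B B[x^{1/p^∞}]/x`. -/
abbrev obj₂ : CommAlgCat.{u} (ZMod p) := CommAlgCat.of (ZMod p) (Trunc p B ⊗[B] Trunc p B)

/-- `B[x^{1/p^∞}]/x ⊗_B B[x^{1/p^∞}]/x ⊗_B B[x^{1/p^∞}]/x`. -/
abbrev obj₃ : CommAlgCat.{u} (ZMod p) :=
  CommAlgCat.of (ZMod p) ((Trunc p B ⊗[B] Trunc p B) ⊗[B] Trunc p B)

/-- The map `B → B[x^{1/p^∞}]/x`. -/
def unit : B ⟶ obj B := CommAlgCat.ofHom (incl B)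

/-- The map `s ↦ s ⊗ 1`. -/
def inl : obj B ⟶ obj₂ B := CommAlgCat.ofHom Algebra.TensorProduct.includeLeft

/-- The map `s ↦ 1 ⊗ s`. -/
def inr : obj B ⟶ obj₂ B :=
  CommAlgCat.ofHom (Algebra.TensorProduct.includeRight.restrictScalars (ZMod p))

/-- The map `s ↦ s ⊗ 1` to the threefold tensor product. -/
def inl₃ : obj₂ B ⟶ obj₃ B := CommAlgCat.ofHom Algebra.TensorProduct.includeLeft

/-- The map `s ↦ 1 ⊗ s` to the threefold tensor product. -/
def inr₃ : obj B ⟶ obj₃ B :=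
  CommAlgCat.ofHom (Algebra.TensorProduct.includeRight.restrictScalars (ZMod p))

/-- The map `B[x^{1/p^∞}]/x → C[x^{1/p^∞}]/x` induced by `B → C`. -/
def map {B C : CommAlgCat.{u} (ZMod p)} (f : B ⟶ C) : obj B ⟶ obj C :=
  CommAlgCat.ofHom (lift ((incl C).comp f.hom) (x C) (coeff_zero_x C))

/-- The `B`-algebra map `x^{1/p^n} ↦ x^{1/p^n} ⊗ 1 + 1 ⊗ x^{1/p^n}`. -/
def comul : obj B ⟶ obj₂ B :=
  CommAlgCat.ofHom (lift ((inl B).hom.comp (incl B))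
    (tilt.map (inl B).hom (x B) + tilt.map (inr B).hom (x B)) (by
      rw [map_add, tilt.coeff_map, tilt.coeff_map, coeff_zero_x, map_zero, map_zero, add_zero]))

/-- The `B`-algebra map `x^{1/p^n} ↦ b^{1/p^n} x^{1/p^n}`. -/
def mulBy [PerfectRing B p] (b : B) : obj B ⟶ obj B :=
  CommAlgCat.ofHom (lift (incl B)
    (tilt.map (incl B) (tilt.ofPerfect B b) * x B) (by
      rw [map_mul, coeff_zero_x, mul_zero]))

/-- The quotient map `B[x^{1/p^∞}] → B[x^{1/p^∞}]/x`. -/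
def fromPerfPoly : CommAlgCat.of (ZMod p) (PerfPoly p B) ⟶ obj B :=
  CommAlgCat.ofHom (Ideal.Quotient.factorₐ (ZMod p)
    (show PerfPoly.relations p B ≤ relations p B from Ideal.span_mono (Set.subset_insert _ _)))

end

end Trunc

end Models

/-! ### Functors with tensor conditions -/

section Tensor

variable (p : ℕ) [Fact p.Prime]

/-- Perfect `𝔽_p`-algebras, `B[x^{1/p^∞}]`, `B[x^{1/p^∞}]/x` and the two- and threefold tensor
powers of the latter over `B`, for perfect `B`, are quasiregular semiperfect. -/
structure ModelsQRSP : Prop where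
  perfect : ∀ (B : CommAlgCat.{u} (ZMod p)) [PerfectRing B p], IsQRSP p B
  perfPoly : ∀ (B : CommAlgCat.{u} (ZMod p)) [PerfectRing B p],
    IsQRSP p (CommAlgCat.of (ZMod p) (PerfPoly p B))
  trunc : ∀ (B : CommAlgCat.{u} (ZMod p)) [PerfectRing B p], IsQRSP p (Trunc.obj B)
  trunc₂ : ∀ (B : CommAlgCat.{u} (ZMod p)) [PerfectRing B p], IsQRSP p (Trunc.obj₂ B)
  trunc₃ : ∀ (B : CommAlgCat.{u} (ZMod p)) [PerfectRing B p], IsQRSP p (Trunc.obj₃ B)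

variable {p}

namespace ModelsQRSP

variable (hQ : ModelsQRSP.{u} p) (B : CommAlgCat.{u} (ZMod p)) [PerfectRing B p]

/-- A perfect ring `B` as an object of `QRSP`. -/
abbrev P : QRSP.{u} p := ⟨B, hQ.perfect B⟩

/-- `B[x^{1/p^∞}]` as an object of `QRSP`. -/
abbrev P₁ : QRSP.{u} p := ⟨CommAlgCat.of (ZMod p) (PerfPoly p B), hQ.perfPoly B⟩

/-- `B[x^{1/p^∞}]/x` as an object of `QRSP`. -/
abbrev S : QRSP.{u} p := ⟨Trunc.obj B, hQ.trunc B⟩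

/-- `B[x^{1/p^∞}]/x ⊗_B B[x^{1/p^∞}]/x` as an object of `QRSP`. -/
abbrev S₂ : QRSP.{u} p := ⟨Trunc.obj₂ B, hQ.trunc₂ B⟩

/-- `B[x^{1/p^∞}]/x ⊗_B B[x^{1/p^∞}]/x ⊗_B B[x^{1/p^∞}]/x` as an object of `QRSP`. -/
abbrev S₃ : QRSP.{u} p := ⟨Trunc.obj₃ B, hQ.trunc₃ B⟩

end ModelsQRSP

/-- The value `F(f)` of a functor under `𝔊` on a map `f` between quasiregular semiperfect
algebras. -/
abbrev app (F : Under (tiltFunctor.{u} p)) {S S' : QRSP.{u} p} (f : S.obj ⟶ S'.obj) :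
    F.right.obj S ⟶ F.right.obj S' :=
  F.right.map (ObjectProperty.homMk f)

/-- The structure map `𝔊(S) = S^♭ → F(S)` of a functor under `𝔊`. -/
abbrev str (F : Under (tiltFunctor.{u} p)) (S : QRSP.{u} p) :
    CommAlgCat.of (ZMod p) (tilt p S.obj) ⟶ F.right.obj S :=
  F.hom.app S

/-- The three conditions on a functor `F` under `𝔊`, for all perfect rings `B`: `𝔊(B) → F(B)` is
an isomorphism; with `S_B = B[x^{1/p^∞}]/x`, the maps `F(S_B) ⊗_B F(S_B) → F(S_B ⊗_B S_B)` and
`F(S_{𝔽_p}) ⊗_{𝔽_p} B → F(S_B)` are isomorphisms. In view of the first condition, the last two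
say that certain squares are pushouts of algebras. -/
structure IsTensor (hQ : ModelsQRSP.{u} p) (F : Under (tiltFunctor.{u} p)) : Prop where
  perfect : ∀ (B : CommAlgCat.{u} (ZMod p)) [PerfectRing B p], IsIso (str F (hQ.P B))
  tensor : ∀ (B : CommAlgCat.{u} (ZMod p)) [PerfectRing B p],
    IsPushout (app F (S := hQ.P B) (S' := hQ.S B) (Trunc.unit B))
      (app F (S := hQ.P B) (S' := hQ.S B) (Trunc.unit B))
      (app F (S := hQ.S B) (S' := hQ.S₂ B) (Trunc.inl B))
      (app F (S := hQ.S B) (S' := hQ.S₂ B) (Trunc.inr B))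
  baseChange : ∀ (B : CommAlgCat.{u} (ZMod p)) [PerfectRing B p],
    IsPushout (app F (S := hQ.P (baseField p)) (S' := hQ.S (baseField p))
        (Trunc.unit (baseField p)))
      (app F (S := hQ.P (baseField p)) (S' := hQ.P B) (fromBase p B))
      (app F (S := hQ.S (baseField p)) (S' := hQ.S B) (Trunc.map (fromBase p B)))
      (app F (S := hQ.P B) (S' := hQ.S B) (Trunc.unit B))

/-- The threefold analogue of the second condition: with `S_B = B[x^{1/p^∞}]/x`, the map
`F(S_B ⊗_B S_B) ⊗_B F(S_B) → F(S_B ⊗_B S_B ⊗_B S_B)` is an isomorphism for all perfect `B`. -/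
def IsThreefoldTensor (hQ : ModelsQRSP.{u} p) (F : Under (tiltFunctor.{u} p)) : Prop :=
  ∀ (B : CommAlgCat.{u} (ZMod p)) [PerfectRing B p],
    IsPushout (app F (S := hQ.P B) (S' := hQ.S₂ B) (Trunc.unit B ≫ Trunc.inl B))
      (app F (S := hQ.P B) (S' := hQ.S B) (Trunc.unit B))
      (app F (S := hQ.S₂ B) (S' := hQ.S₃ B) (Trunc.inl₃ B))
      (app F (S := hQ.S B) (S' := hQ.S₃ B) (Trunc.inr₃ B))

/-- The category `Fun(QRSP, Alg_{𝔽_p})^⊗_{𝔊/}`. -/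
abbrev TensorFunctor (hQ : ModelsQRSP.{u} p) := ObjectProperty.FullSubcategory
  (IsTensor hQ : ObjectProperty (Under (tiltFunctor.{u} p)))

/-- The full subcategory of `Fun(QRSP, Alg_{𝔽_p})^⊗_{𝔊/}` of functors which also satisfy the
threefold tensor condition. -/
abbrev TensorFunctor₃ (hQ : ModelsQRSP.{u} p) := ObjectProperty.FullSubcategory
  ((fun F => IsTensor hQ F ∧ IsThreefoldTensor hQ F) :
    ObjectProperty (Under (tiltFunctor.{u} p)))

/-- An identification `e` of the underlying scheme of a pointed `𝔾_a^perf`-module `X` with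
`Spec F(S)`, where `S = 𝔽_p[x^{1/p^∞}]/x`, under which the structure of `X` is the one induced by
functoriality of `F`:
the addition is induced by `S → S ⊗ S`, `x^{1/p^n} ↦ x^{1/p^n} ⊗ 1 + 1 ⊗ x^{1/p^n}`;
the action of `b` in a perfect ring `B` is induced by `S_B → S_B`, `x^{1/p^n} ↦ b^{1/p^n} x^{1/p^n}`
where `S_B = B[x^{1/p^∞}]/x`;
the map to `𝔾_a^perf` is induced by `𝔽_p[x^{1/p^∞}] → S`. -/
structure IsSpec (hQ : ModelsQRSP.{u} p) (F : Under (tiltFunctor.{u} p))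
    (X : PointedModule.{u} p) (e : X.Γ ≅ F.right.obj (hQ.S (baseField p))) : Prop where
  add : ∀ (R : CommAlgCat.{u} (ZMod p)) (χ : F.right.obj (hQ.S₂ (baseField p)) ⟶ R),
    e.hom ≫ app F (S := hQ.S _) (S' := hQ.S₂ _) (Trunc.comul (baseField p)) ≫ χ =
      e.hom ≫ app F (S := hQ.S _) (S' := hQ.S₂ _) (Trunc.inl (baseField p)) ≫ χ +
      e.hom ≫ app F (S := hQ.S _) (S' := hQ.S₂ _) (Trunc.inr (baseField p)) ≫ χ
  smul : ∀ (R B : CommAlgCat.{u} (ZMod p)) [PerfectRing B p] (b : B)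
    (χ : F.right.obj (hQ.S B) ⟶ R),
    e.hom ≫ app F (S := hQ.S _) (S' := hQ.S B) (Trunc.map (fromBase p B)) ≫
        app F (S := hQ.S B) (S' := hQ.S B) (Trunc.mulBy B b) ≫ χ =
      tilt.map ((str F (hQ.P B) ≫ app F (S := hQ.P B) (S' := hQ.S B) (Trunc.unit B) ≫ χ).hom)
          (tilt.ofPerfect (tilt p B) (tilt.ofPerfect B b)) •
        (e.hom ≫ app F (S := hQ.S _) (S' := hQ.S B) (Trunc.map (fromBase p B)) ≫ χ)
  point : ∀ (R : CommAlgCat.{u} (ZMod p)) (χ : F.right.obj (hQ.S (baseField p)) ⟶ R),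
    X.d R (e.hom ≫ χ) =
      tilt.map ((str F (hQ.P₁ (baseField p)) ≫
          app F (S := hQ.P₁ _) (S' := hQ.S _) (Trunc.fromPerfPoly (baseField p)) ≫ χ).hom)
        (tilt.ofPerfect (tilt p (PerfPoly p (baseField p))) (PerfPoly.x (baseField p)))

/-- A functor `r` from tensor functors to nilpotent quasi-ideals is the functor
`F ↦ Spec F(𝔽_p[x^{1/p^∞}]/x)`. -/
def IsRestriction (hQ : ModelsQRSP.{u} p)
    (r : TensorFunctor₃ hQ ⥤ (NilpotentQuasiIdeal.{u} p)ᵒᵖ) : Prop :=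
  ∃ e : ∀ F : TensorFunctor₃ hQ,
      (r.obj F).unop.obj.Γ ≅ F.obj.right.obj (hQ.S (baseField p)),
    (∀ F, IsSpec hQ F.obj (r.obj F).unop.obj (e F)) ∧
    ∀ (F F' : TensorFunctor₃ hQ) (τ : F ⟶ F'),
      (r.map τ).unop.hom.pullback ≫ (e F').hom =
        (e F).hom ≫ τ.hom.right.app (hQ.S (baseField p))

variable (p) in
/-- The unwinding functor on nilpotent quasi-ideals. -/
abbrev unwindingNilpotent : (NilpotentQuasiIdeal.{u} p)ᵒᵖ ⥤ Under (tiltFunctor.{u} p) :=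
  (ObjectProperty.ι _).op ⋙ unwinding p

end Tensor

end

end Unwinding

/-! The proof has three independent inputs.

Models. All test algebras have the form `S = B[x_e^{1/p^∞}]/(x_e)` with `B` perfect and finitely
many generators `e`, and are used only through the universal property `IsUniv`. A polynomial
resolution of `S` over `𝔽_p` is the tensor product of the iterated symmetric algebras of `B` with
the bar construction on the relations `x_{e,0}` and `x_{e,n+1}^p - x_{e,n}`; it is a resolution
because polynomials are free over the algebra generated by the relations, with the reduced monomials
as basis. If the relations are replaced by the variables, the differentials become acyclic: the
identity is homotopic to a map whose values on `B` are `p`-th powers, and the bar variables contract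
to `0`. The comparison of the two modules of differentials is surjective, and its kernel is free on
the elements `dx_{e,0} + dx_{e,1}`. Hence `L_S` is a free module in degree `1`
(`BarResolution.isQRSP`, `modelsQRSP`).

Unwindings. The kernel of `S^♭ → S` is generated by the `x_e`, which form a regular sequence in
every order; this is read off from a monomial model of `S`. If `X` is a nilpotent quasi-ideal, a map
from `Env_X(S^♭, Ker)` to `T` is therefore the same as a map `B → T` together with arbitrary points
`y_e` of `X(T)`: nilpotency of `t` produces the unique map `S^♭ → T` sending `x_e` to `d(y_e)`, and
the relations among the `x_e` are generated by `x_i x_j = x_j x_i`, which the quasi-ideal identity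
`d(y_i) y_j = d(y_j) y_i` respects (`IsUniv.exists_env_hom`, `IsUniv.env_hom_ext`). In other words
`Env` is `B ⊗ Γ(X)^{⊗ E}`, and all tensor conditions follow (`isPushout_envMap`).

Restriction. For a tensor functor `F`, each element `i` of `Ker(S^♭ → S)` is classified by a map
`S_{𝔽_p} → S` and gives a point of `Spec F(S_{𝔽_p})` over `F(S)`. Any three points over `R`, and all
scalars in `R^♭`, come from elements of one such kernel and one such tilt (`exists_realization`);
the threefold tensor condition is needed exactly here. Module axioms, linearity of `d` and the
quasi-ideal identity thus reduce to identities in an ideal of a commutative ring. Nilpotency of `t`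
follows from base change to the ring of eventually constant sequences: the element `∑ b_n x^n`, with
`b_n` the indicator of `n`, specializes to `t^n` at `n` and to `0` at infinity, while every element
of `F(S_{𝔽_p}) ⊗ B` has eventually constant specializations (`isNilpotent_str`).

Finally, a map `Un(X) → F` is determined by its value on the universal point attached to `x` in
`S_{𝔽_p}`, which gives the adjunction. The unit is an isomorphism by the description of `Env` with
one generator over `𝔽_p`, and full faithfulness is a formal consequence. -/

namespace CategoryTheory.SimplicialObject

/-! ### Simplicial homotopies indexed by the simplices of `Δ¹`. -/

open Opposite Simplicial

variable {C : Type*} [Category* C] {X Y : SimplicialObject C}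

/-- The cut of `{0, …, n + 1}` whose upper part is `{j | i < j}`. -/
def cut {n : ℕ} (i : Fin n) : Fin (n + 1) →o Bool where
  toFun j := decide (i.castSucc < j)
  monotone' a b h := by
    rw [Bool.le_iff_imp]
    simp only [decide_eq_true_eq]
    exact fun h' => h'.trans_le h

theorem cut_apply {n : ℕ} (i : Fin n) (j : Fin (n + 1)) :
    cut i j = decide (i.castSucc < j) := rfl

/-- A natural family of maps `X_n → Y_n`, indexed by the `n`-simplices of `Δ¹`, gives a
simplicial homotopy. -/
def homotopyOfFamily (H : ∀ n : ℕ, (Fin (n + 1) →o Bool) → (X _⦋n⦌ ⟶ Y _⦋n⦌))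
    (hH : ∀ (m n : ℕ) (f : ⦋m⦌ ⟶ ⦋n⦌) (α : Fin (n + 1) →o Bool),
      H n α ≫ Y.map f.op = X.map f.op ≫ H m (α.comp f.toOrderHom))
    {f g : X ⟶ Y} (hf : ∀ n, f.app (op ⦋n⦌) = H n (OrderHom.const _ false))
    (hg : ∀ n, g.app (op ⦋n⦌) = H n (OrderHom.const _ true)) : Homotopy f g := by
  -- Stated with any `β` that agrees pointwise with the composite, so that each homotopy identity
  -- below reduces to comparing inequalities between indices.
  have hδ (n : ℕ) (i : Fin (n + 2)) (α : Fin (n + 2) →o Bool) (β : Fin (n + 1) →o Bool)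
      (h : ∀ k, α (i.succAbove k) = β k) : H (n + 1) α ≫ Y.δ i = X.δ i ≫ H n β := by
    obtain rfl : α.comp (SimplexCategory.δ i).toOrderHom = β := OrderHom.ext _ _ (funext h)
    exact hH _ _ _ _
  have hσ (n : ℕ) (i : Fin (n + 1)) (α : Fin (n + 1) →o Bool) (β : Fin (n + 2) →o Bool)
      (h : ∀ k, α (i.predAbove k) = β k) : H n α ≫ Y.σ i = X.σ i ≫ H (n + 1) β := by
    obtain rfl : α.comp (SimplexCategory.σ i).toOrderHom = β := OrderHom.ext _ _ (funext h)
    exact hH _ _ _ _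
  -- The prism decomposition of `Δⁿ × Δ¹`: its top-dimensional simplices are the pairs consisting of
  -- `σ i` and the cut just after `i`.
  refine
  { h := fun {n} i => X.σ i ≫ H (n + 1) (cut i)
    h_zero_comp_δ_zero := fun n => ?_
    h_last_comp_δ_last := fun n => ?_
    h_succ_comp_δ_castSucc_of_lt := fun {n} i j hij => ?_
    h_succ_comp_δ_castSucc_succ := fun {n} j => ?_
    h_castSucc_comp_δ_succ_of_lt := fun {n} i j hij => ?_
    h_comp_σ_castSucc_of_le := fun {n} i j hij => ?_
    h_comp_σ_succ_of_lt := fun {n} i j hij => ?_ }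
  · rw [hg, Category.assoc, hδ n 0 _ (OrderHom.const _ true), ← Category.assoc]
    · have := X.δ_comp_σ_self (n := n) (i := 0)
      dsimp at this
      rw [this, Category.id_comp]
    · intro j
      simp [cut_apply]
  · rw [hf, Category.assoc, hδ n _ _ (OrderHom.const _ false), ← Category.assoc]
    · have := X.δ_comp_σ_succ (i := Fin.last n)
      dsimp at this
      rw [this, Category.id_comp]
    · intro j
      have := j.2
      simp only [cut_apply, Fin.lt_def, Fin.succAbove_last, OrderHom.const_coe_coe,
        Function.const_apply, decide_eq_false_iff_not, Fin.val_castSucc, Fin.val_last]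
      omega
  · rw [Category.assoc, hδ _ _ _ (cut j), ← Category.assoc, ← Category.assoc, X.δ_comp_σ_of_le hij]
    intro k
    simp only [cut_apply, Fin.lt_def, Fin.le_def, Fin.succAbove, decide_eq_decide] at hij ⊢
    split_ifs <;> (simp at *; try omega)
  · rw [Category.assoc, Category.assoc, hδ _ _ _ (cut j), hδ _ _ _ (cut j), ← Category.assoc,
      ← Category.assoc]
    · have h₁ := X.δ_comp_σ_self (i := j.succ)
      have h₂ := X.δ_comp_σ_succ (i := j.castSucc)
      dsimp at h₁ h₂
      rw [h₁, h₂]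
    · intro k
      simp only [cut_apply, Fin.lt_def, Fin.succAbove, decide_eq_decide]
      split_ifs <;> (simp at *; try omega)
    · intro k
      simp only [cut_apply, Fin.lt_def, Fin.succAbove, decide_eq_decide]
      split_ifs <;> (simp at *; try omega)
  · rw [Category.assoc, hδ _ _ _ (cut j), ← Category.assoc, ← Category.assoc, X.δ_comp_σ_of_gt hij]
    intro k
    simp only [cut_apply, Fin.lt_def, Fin.succAbove, decide_eq_decide] at hij ⊢
    split_ifs <;> (simp at *; try omega)
  · rw [Category.assoc, hσ _ _ _ (cut j.succ), ← Category.assoc, ← Category.assoc, X.σ_comp_σ hij]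
    intro k
    simp only [cut_apply, Fin.lt_def, Fin.le_def, Fin.predAbove, decide_eq_decide] at hij ⊢
    split_ifs with h <;> have h' := h <;>
      simp only [Fin.val_castSucc, Fin.val_succ, Fin.val_pred, Fin.coe_castPred] at h' ⊢ <;> omega
  · rw [Category.assoc, hσ _ _ _ (cut j.castSucc), ← Category.assoc, ← Category.assoc,
      X.σ_comp_σ hij]
    intro k
    simp only [cut_apply, Fin.lt_def, Fin.le_def, Fin.predAbove, decide_eq_decide] at hij ⊢
    split_ifs with h <;> have h' := h <;>
      simp only [Fin.val_castSucc, Fin.val_succ, Fin.val_pred, Fin.coe_castPred] at h' ⊢ <;> omega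

/-! ### Extra degeneracies and the homology of cofibers. -/

open AlgebraicTopology Limits

/-- Both `X` and the constant object `S` have an extra degeneracy, so their maps to `S` in degree
`0` are homotopy equivalences. These maps are compatible with `aug`, and two-out-of-three applies.
-/
theorem quasiIso_of_extraDegeneracy {A : Type*} [Category* A] [Abelian A]
    {X : SimplicialObject A} {S : A} (aug : X ⟶ (SimplicialObject.const A).obj S)
    (ed : Augmented.ExtraDegeneracy (⟨X, S, aug⟩ : SimplicialObject.Augmented A)) :
    QuasiIso ((alternatingFaceMapComplex A).map aug) := by
  let Z : SimplicialObject.Augmented A := ⟨X, S, aug⟩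
  let φ : Z ⟶ Augmented.const.obj S := { left := aug, right := 𝟙 S, w := by ext; rfl }
  have h := AlternatingFaceMapComplex.ε.naturality φ
  have h₁ : QuasiIso (AlternatingFaceMapComplex.ε.app Z) :=
    inferInstanceAs (QuasiIso ed.homotopyEquiv.hom)
  have h₂ : QuasiIso (AlternatingFaceMapComplex.ε.app (Augmented.const.obj S)) :=
    inferInstanceAs (QuasiIso (Augmented.ExtraDegeneracy.const S).homotopyEquiv.hom)
  have h₃ : QuasiIso ((Augmented.point ⋙ ChainComplex.single₀ A).map φ) := by
    have : IsIso (Augmented.point.map φ) := inferInstanceAs (IsIso (𝟙 S))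
    exact inferInstanceAs (QuasiIso ((ChainComplex.single₀ A).map (Augmented.point.map φ)))
  have h₄ : QuasiIso ((Augmented.drop ⋙ alternatingFaceMapComplex A).map φ ≫
      AlternatingFaceMapComplex.ε.app (Augmented.const.obj S)) := by
    rw [h]; exact quasiIso_comp _ _
  have h₅ : QuasiIso ((alternatingFaceMapComplex A).map aug ≫
      AlternatingFaceMapComplex.ε.app (Augmented.const.obj S)) := h₄
  exact quasiIso_of_comp_right (φ := (alternatingFaceMapComplex A).map aug)
    (φ' := AlternatingFaceMapComplex.ε.app (Augmented.const.obj S)) (hφ := h₂) (hφφ' := h₅)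

section Cofiber

variable {A : Type*} [Category* A] [Abelian A]

/-- The homology of a constant simplicial object. -/
noncomputable def homologyConstIso (M : A) (i : ℕ) :
    ((alternatingFaceMapComplex A).obj ((SimplicialObject.const A).obj M)).homology i ≅
      ((ChainComplex.single₀ A).obj M).homology i :=
  (Augmented.ExtraDegeneracy.const M).homotopyEquiv.toHomologyIso i

variable {M : A} {K L : SimplicialObject A} (f : (SimplicialObject.const A).obj M ⟶ K) (g : K ⟶ L)
  (w : f ≫ g = 0) (hS : ∀ n : ℕ, (ShortComplex.mk (f.app (op ⦋n⦌)) (g.app (op ⦋n⦌))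
    (by rw [← NatTrans.comp_app, w]; rfl)).ShortExact)

include hS in
theorem cofiber_shortExact : (ShortComplex.mk ((alternatingFaceMapComplex A).map f)
    ((alternatingFaceMapComplex A).map g) (by
      ext n
      simpa using congr_app w (op ⦋n⦌))).ShortExact :=
  HomologicalComplex.shortExact_of_degreewise_shortExact _ hS

variable (hK : ∀ i, IsZero (((alternatingFaceMapComplex A).obj K).homology i))

include hS hK w

/-- If `K` is acyclic and `0 → M → K → L → 0` is exact with `M` constant, then `H_1(L) = M`. -/
theorem nonempty_homology_one_iso_of_cofiber :
    Nonempty (((alternatingFaceMapComplex A).obj L).homology 1 ≅ M) :=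
  ⟨(cofiber_shortExact f g w hS).δIso 1 0 (by simp) (hK 1) (hK 0) ≪≫ homologyConstIso M 0 ≪≫
    (HomologicalComplex.homologyFunctorSingleIso A (ComplexShape.down ℕ) 0).app M⟩

/-- If `K` is acyclic and `0 → M → K → L → 0` is exact with `M` constant, then `H_i(L) = 0` for
`i ≠ 1`. -/
theorem isZero_homology_of_cofiber (i : ℕ) (hi : i ≠ 1) :
    IsZero (((alternatingFaceMapComplex A).obj L).homology i) := by
  have hE := cofiber_shortExact f g w hS
  -- In degree `0` the map from the homology of `K` is onto, since there is no lower degree. In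
  -- degree `i + 1` the connecting map identifies the homology with that of the constant object in
  -- degree `i`, and `i ≠ 0` because degree `1` is excluded.
  obtain _ | i := i
  · have := hE.epi_g
    have : Epi (HomologicalComplex.homologyMap ((alternatingFaceMapComplex A).map g) 0) :=
      HomologicalComplex.epi_homologyMap_of_epi_of_not_rel _ 0 (by simp)
    exact IsZero.of_epi (HomologicalComplex.homologyMap ((alternatingFaceMapComplex A).map g) 0)
      (hK 0)
  · refine .of_iso ?_ (hE.δIso (i + 1) i (by simp) (hK _) (hK _) ≪≫ homologyConstIso M i)
    exact HomologicalComplex.isZero_single_obj_homology _ _ _ _ (by omega)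

end Cofiber

end CategoryTheory.SimplicialObject

/-! ### Iterated symmetric algebras -/

/-- The iterated symmetric algebra `Sym(Sym(… Sym(B)))` with `m` symmetric algebras. -/
noncomputable def SymIter {k : Type} [CommRing k] (B : CommAlgCat.{u} k) : ℕ → CommAlgCat.{u} k
  | 0 => B
  | m + 1 => CommAlgCat.of k (SymmetricAlgebra k (SymIter B m))

namespace SymIter

noncomputable section

variable {k : Type} [CommRing k] {B : CommAlgCat.{u} k}

/-- The generators of a symmetric algebra. -/
def ι (B : CommAlgCat.{u} k) (m : ℕ) : SymIter B m →ₗ[k] SymIter B (m + 1) :=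
  SymmetricAlgebra.ι k (SymIter B m)

/-- The algebra map out of a symmetric algebra extending a linear map. -/
def extend {m : ℕ} {A : Type*} [CommRing A] [Algebra k A] (h : SymIter B m →ₗ[k] A) :
    SymIter B (m + 1) →ₐ[k] A :=
  SymmetricAlgebra.lift h

@[simp]
theorem extend_ι {m : ℕ} {A : Type*} [CommRing A] [Algebra k A] (h : SymIter B m →ₗ[k] A)
    (a : SymIter B m) : extend h (ι B m a) = h a :=
  SymmetricAlgebra.lift_ι_apply h a

theorem algHom_ext {m : ℕ} {A : Type*} [CommRing A] [Algebra k A]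
    {f g : SymIter B (m + 1) →ₐ[k] A} (h : ∀ a, f (ι B m a) = g (ι B m a)) : f = g :=
  SymmetricAlgebra.algHom_ext (LinearMap.ext h)

/-- The counit `Sym(A) → A`. -/
def ε (B : CommAlgCat.{u} k) (m : ℕ) : SymIter B (m + 1) →ₐ[k] SymIter B m := extend .id

@[simp]
theorem ε_ι {m : ℕ} (a : SymIter B m) : ε B m (ι B m a) = a := extend_ι _ _

/-- The coextension of an algebra map `Sym(A) → A'` to `Sym(A) → Sym(A')`. -/
def coext {m n : ℕ} (h : SymIter B (m + 1) →ₐ[k] SymIter B n) :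
    SymIter B (m + 1) →ₐ[k] SymIter B (n + 1) :=
  extend (ι B n ∘ₗ h.toLinearMap ∘ₗ ι B m)

@[simp]
theorem coext_ι {m n : ℕ} (h : SymIter B (m + 1) →ₐ[k] SymIter B n) (a : SymIter B m) :
    coext h (ι B m a) = ι B n (h (ι B m a)) := extend_ι _ _

/-- Functoriality of the symmetric algebra. -/
def map {m n : ℕ} (h : SymIter B m →ₐ[k] SymIter B n) :
    SymIter B (m + 1) →ₐ[k] SymIter B (n + 1) :=
  extend (ι B n ∘ₗ h.toLinearMap)

@[simp]
theorem map_ι {m n : ℕ} (h : SymIter B m →ₐ[k] SymIter B n) (a : SymIter B m) :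
    map h (ι B m a) = ι B n (h a) := extend_ι _ _

/-- The counit law for the comonad `Sym`. It is what cancels a face against a coextension in
`act_comp_aux`. -/
theorem ε_coext {m n : ℕ} (h : SymIter B (m + 1) →ₐ[k] SymIter B n) :
    (ε B n).comp (coext h) = h := algHom_ext fun a => by simp

/-- The lowering of a monotone map which misses the bottom element. -/
def lower {m n : ℕ} (f : Fin m →o Fin (n + 1)) (h : ∀ i, f i ≠ 0) : Fin m →o Fin n where
  toFun i := (f i).pred (h i)
  monotone' _ _ hij := Fin.pred_le_pred_iff.mpr (f.monotone hij)

/-- The restriction of a monotone map to the nonzero elements. -/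
def tail {m : ℕ} {A : Type*} [Preorder A] (f : Fin (m + 1) →o A) : Fin m →o A where
  toFun i := f i.succ
  monotone' _ _ hij := f.monotone (Fin.succ_le_succ_iff.mpr hij)

@[simp]
theorem lower_apply {m n : ℕ} (f : Fin m →o Fin (n + 1)) (h : ∀ i, f i ≠ 0) (i : Fin m) :
    lower f h i = (f i).pred (h i) := rfl

@[simp]
theorem tail_apply {m : ℕ} {A : Type*} [Preorder A] (f : Fin (m + 1) →o A) (i : Fin m) :
    tail f i = f i.succ := rfl

theorem ne_zero_of_zero_ne {m n : ℕ} {f : Fin (m + 1) →o Fin (n + 1)} (h : f 0 ≠ 0) (i) :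
    f i ≠ 0 := fun hi => h (Fin.le_zero_iff.mp (hi ▸ f.monotone (Fin.zero_le i)))

/-- The action of monotone maps on iterated symmetric algebras. -/
def act : {n m : ℕ} → (Fin m →o Fin n) → (SymIter B n →ₐ[k] SymIter B m)
  | 0, 0, _ => .id k _
  | 0, _ + 1, f => (f 0).elim0
  | n + 1, 0, f => (act (lower f fun i => i.elim0)).comp (ε B n)
  | n + 1, _ + 1, f =>
    -- Index `0` stands for the outermost symmetric algebra. If `f` hits `0`, the generators are
    -- handled by the remaining values of `f`, which may hit `0` again; otherwise the outermost
    -- layer is collapsed by the counit. Each recursive call lowers the total size `n + m`.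
    if h : f 0 = 0 then coext (act (tail f)) else
      (act (lower f (ne_zero_of_zero_ne h))).comp (ε B n)
termination_by n m => n + m

theorem act_zero (f : Fin 0 →o Fin 0) : act (B := B) f = .id k _ := by rw [act]

theorem act_lower {m n : ℕ} (f : Fin m →o Fin (n + 1)) (h : ∀ i, f i ≠ 0) :
    act (B := B) f = (act (lower f h)).comp (ε B n) := by
  cases m with
  | zero => rw [act]
  | succ m => rw [act, dif_neg (h 0)]

theorem act_tail {m n : ℕ} (f : Fin (m + 1) →o Fin (n + 1)) (h : f 0 = 0) :
    act (B := B) f = coext (act (tail f)) := by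
  rw [act, dif_pos h]

/-- Induction on the total size of the three ordinals, since a recursive step may shrink any of
them. The cases are: `f` misses `0`; `f` hits `0` and `g` misses it, where the counit law cancels;
both hit `0`, where coextensions compose. -/
theorem act_comp_aux (N : ℕ) : ∀ {l m n : ℕ} (_ : l + m + n < N) (f : Fin m →o Fin n)
    (g : Fin l →o Fin m), act (B := B) (f.comp g) = (act g).comp (act f) := by
  induction N with
  | zero => intro l m n h; omega
  | succ N ih =>
    intro l m n hN f g
    obtain _ | n := n
    · obtain _ | m := m
      · obtain _ | l := l
        · simp only [act_zero]; rfl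
        · exact (g 0).elim0
      · exact (f 0).elim0
    by_cases hf : ∀ i, f i ≠ 0
    · rw [act_lower f hf, act_lower (f.comp g) fun i => hf (g i), ← AlgHom.comp_assoc,
        ← ih (by omega)]
      rfl
    obtain _ | m := m
    · exact (hf fun i => i.elim0).elim
    have hf0 : f 0 = 0 := by
      by_contra h
      exact hf (ne_zero_of_zero_ne h)
    by_cases hg : ∀ i, g i ≠ 0
    · rw [act_lower g hg, act_tail f hf0, AlgHom.comp_assoc, ε_coext, ← ih (by omega)]
      congr 1
      ext i
      simp
    obtain _ | l := l
    · exact (hg fun i => i.elim0).elim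
    have hg0 : g 0 = 0 := by
      by_contra h
      exact hg (ne_zero_of_zero_ne h)
    have hfg : f.comp g 0 = 0 := by simp [hg0, hf0]
    rw [act_tail _ hfg]
    have : tail (f.comp g) = f.comp (tail g) := rfl
    rw [this, ih (by omega) f (tail g), act_tail g hg0, act_tail f hf0]
    exact algHom_ext fun a => by simp

theorem act_comp {l m n : ℕ} (f : Fin m →o Fin n) (g : Fin l →o Fin m) :
    act (B := B) (f.comp g) = (act g).comp (act f) :=
  act_comp_aux _ (Nat.lt_succ_self _) f g

theorem act_id (n : ℕ) : act (B := B) (OrderHom.id : Fin n →o Fin n) = .id k _ := by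
  induction n with
  | zero => exact act_zero _
  | succ n ih =>
    rw [act_tail _ rfl, act_lower _ fun i => Fin.succ_ne_zero i]
    have : lower (tail (OrderHom.id : Fin (n + 1) →o Fin (n + 1)))
        (fun i => Fin.succ_ne_zero i) = OrderHom.id := by
      ext i; rfl
    rw [this, ih]
    exact algHom_ext fun a => by simp

/-- The extension of a monotone map by `0 ↦ 0`. -/
def shift {m n : ℕ} (f : Fin m →o Fin n) : Fin (m + 1) →o Fin (n + 1) where
  toFun := Fin.cases 0 fun i => (f i).succ
  monotone' a b h := by
    cases a using Fin.cases with
    | zero => exact Fin.zero_le _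
    | succ a =>
      cases b using Fin.cases with
      | zero => exact absurd h (by simp)
      | succ b => exact Fin.succ_le_succ_iff.mpr (f.monotone (Fin.succ_le_succ_iff.mp h))

/-- Adding a new bottom element corresponds to applying `Sym`. Together with naturality of `ι` this
makes `ι` an extra degeneracy for the iterated symmetric algebras. -/
theorem act_shift {m n : ℕ} (f : Fin m →o Fin n) : act (B := B) (shift f) = map (act f) := by
  rw [act_tail _ rfl, act_lower _ fun i => Fin.succ_ne_zero (f i)]
  have : lower (tail (shift f)) (fun i => Fin.succ_ne_zero (f i)) = f := by
    ext i; rfl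
  rw [this]
  exact algHom_ext fun a => by simp

/-- The face omitting the bottom element is the counit, so it is split by `ι`. -/
theorem act_succ {m : ℕ} (f : Fin m →o Fin (m + 1)) (hf : ∀ i, f i = i.succ) :
    act (B := B) f = ε B m := by
  rw [act_lower _ fun i => hf i ▸ Fin.succ_ne_zero i]
  have : lower f (fun i => hf i ▸ Fin.succ_ne_zero i) = OrderHom.id := by
    ext i; simp [hf]
  rw [this, act_id]
  rfl

/-- The map from the empty ordinal. -/
def ofEmpty (n : ℕ) : Fin 0 →o Fin n := ⟨Fin.elim0, fun i => i.elim0⟩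

theorem comp_ofEmpty {m n : ℕ} (f : Fin m →o Fin n) : f.comp (ofEmpty m) = ofEmpty n := by
  ext i
  exact i.elim0

/-- The identification of the zeroth iterate. -/
def toBase (B : CommAlgCat.{u} k) : SymIter B 0 ≃ₐ[k] B := .refl

/-- The augmentation of the iterated symmetric algebras. -/
def aug (B : CommAlgCat.{u} k) (n : ℕ) : SymIter B n →ₐ[k] B :=
  (toBase B).toAlgHom.comp (act (ofEmpty n))

/-- The empty ordinal is initial, so restricting to it forgets every operator. -/
theorem aug_act {m n : ℕ} (f : Fin m →o Fin n) (a : SymIter B n) :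
    aug B m (act f a) = aug B n a := by
  rw [aug, aug, ← comp_ofEmpty f, act_comp]
  rfl

theorem aug_ι (n : ℕ) (a : SymIter B n) : aug B (n + 1) (ι B n a) = aug B n a := by
  have h : act (B := B) (ofEmpty (n + 1)) = (act (ofEmpty n)).comp (ε B n) := by
    rw [act_lower _ fun i => i.elim0]
    congr 2
    ext i
    exact i.elim0
  simp only [aug, h, AlgHom.comp_apply, ε_ι]

theorem aug_zero (a : SymIter B 0) : aug B 0 a = toBase B a := by
  rw [aug, act_zero]; rfl

end

end SymIter

/-! ### The Frobenius homotopy -/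

namespace SymIter

noncomputable section

open Unwinding

variable {p : ℕ} [Fact p.Prime] {B : CommAlgCat.{u} (ZMod p)}

/-- Functoriality of iterated symmetric algebras in the base. -/
def baseMap (g : B →ₐ[ZMod p] B) : (m : ℕ) → (SymIter B m →ₐ[ZMod p] SymIter B m)
  | 0 => (toBase B).symm.toAlgHom.comp (g.comp (toBase B).toAlgHom)
  | m + 1 => map (baseMap g m)

theorem frob_comm {A A' : Type*} [CommRing A] [Algebra (ZMod p) A] [CommRing A']
    [Algebra (ZMod p) A'] (f : A →ₐ[ZMod p] A') (a : A) : f (frob p A a) = frob p A' (f a) := by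
  rw [frob_apply, frob_apply, map_pow]

/-- A family of endomorphisms of the iterated symmetric algebras which interpolates between the
identity and a map with values in `p`-th powers. -/
def frobFamily (g : B →ₐ[ZMod p] B) :
    (m : ℕ) → (Fin m →o Bool) → (SymIter B m →ₐ[ZMod p] SymIter B m)
  | 0, _ => .id _ _
  -- By monotonicity, `α 0 = true` forces `α` to be constantly true. Otherwise the outermost layer
  -- is kept and the recursion passes to the next one.
  | m + 1, α => if α 0 then (frob p _).comp (baseMap g (m + 1)) else
      map (frobFamily g m (tail α))

theorem act_baseMap_aux (g : B →ₐ[ZMod p] B) (N : ℕ) : ∀ {m n : ℕ} (_ : m + n < N)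
    (f : Fin m →o Fin n), (act f).comp (baseMap g n) = (baseMap g m).comp (act (B := B) f) := by
  induction N with
  | zero => intro m n h; omega
  | succ N ih =>
    intro m n hN f
    obtain _ | n := n
    · obtain _ | m := m
      · rw [act_zero]; rfl
      · exact (f 0).elim0
    by_cases hf : ∀ i, f i ≠ 0
    · rw [act_lower f hf, ← AlgHom.comp_assoc, ← ih (by omega), AlgHom.comp_assoc,
        AlgHom.comp_assoc]
      congr 1
      exact algHom_ext fun a => by simp [baseMap]
    obtain _ | m := m
    · exact (hf fun i => i.elim0).elim
    have hf0 : f 0 = 0 := by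
      by_contra h
      exact hf (ne_zero_of_zero_ne h)
    rw [act_tail f hf0]
    refine algHom_ext fun a => ?_
    have := DFunLike.congr_fun (ih (by omega) (tail f)) (ι B n a)
    simp only [AlgHom.comp_apply, baseMap, map_ι] at this
    simp [baseMap, this]

theorem act_baseMap (g : B →ₐ[ZMod p] B) {m n : ℕ} (f : Fin m →o Fin n) :
    (act f).comp (baseMap g n) = (baseMap g m).comp (act (B := B) f) :=
  act_baseMap_aux g _ (Nat.lt_succ_self _) f

theorem frobFamily_of_false (g : B →ₐ[ZMod p] B) (m : ℕ) (α : Fin m →o Bool)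
    (hα : ∀ i, α i = false) : frobFamily g m α = .id _ _ := by
  induction m with
  | zero => rfl
  | succ m ih =>
    rw [frobFamily, if_neg (by simp [hα]), ih _ fun i => hα i.succ]
    exact algHom_ext fun a => by simp

variable {g : B →ₐ[ZMod p] B} (hg : ∀ b, g b ^ p = b)

include hg

/-- On the empty ordinal both constant cuts coincide, so the identity and the Frobenius composed
with `g` have to agree on `B`. This is what `hg` provides. -/
theorem frobFamily_of_true (m : ℕ) (α : Fin m →o Bool) (hα : ∀ i, α i = true) :
    frobFamily g m α = (frob p _).comp (baseMap g m) := by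
  obtain _ | m := m
  · ext b
    exact ((frob_apply p _ _).trans (hg b)).symm
  · rw [frobFamily, if_pos (hα 0)]

/-- If `α` is constantly true, the Frobenius commutes with every algebra map and `baseMap` commutes
with all operators. Otherwise the outermost layer is either collapsed by `f` or preserved, and
induction on the size applies. -/
theorem act_frobFamily_aux (N : ℕ) : ∀ {m n : ℕ} (_ : m + n < N)
    (f : Fin m →o Fin n) (α : Fin n →o Bool),
    (act f).comp (frobFamily g n α) = (frobFamily g m (α.comp f)).comp (act (B := B) f) := by
  induction N with
  | zero => intro m n h; omega
  | succ N ih =>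
    intro m n hN f α
    obtain _ | n := n
    · obtain _ | m := m
      · rw [act_zero]; rfl
      · exact (f 0).elim0
    by_cases hα : α 0 = true
    · have hα' (i) : α i = true := by
        have := α.monotone (Fin.zero_le i)
        rw [hα, Bool.le_iff_imp] at this
        exact this rfl
      rw [frobFamily_of_true hg _ α hα', frobFamily_of_true hg _ _ fun i => hα' (f i),
        AlgHom.comp_assoc, ← act_baseMap]
      ext a
      exact frob_comm _ _
    have hα' : frobFamily g (n + 1) α = map (frobFamily g n (tail α)) := by
      rw [frobFamily, if_neg hα]
    by_cases hf : ∀ i, f i ≠ 0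
    · have : α.comp f = (tail α).comp (lower f hf) := by
        ext i; simp
      rw [act_lower f hf, this, ← AlgHom.comp_assoc, ← ih (by omega), AlgHom.comp_assoc,
        AlgHom.comp_assoc, hα']
      congr 1
      exact algHom_ext fun a => by simp
    obtain _ | m := m
    · exact (hf fun i => i.elim0).elim
    have hf0 : f 0 = 0 := by
      by_contra h
      exact hf (ne_zero_of_zero_ne h)
    have h' : frobFamily g (m + 1) (α.comp f) =
        map (frobFamily g m ((α.comp (tail f)))) := by
      rw [frobFamily, if_neg (by simpa [hf0] using hα)]
      rfl
    rw [act_tail f hf0, h', hα']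
    refine algHom_ext fun a => ?_
    have := DFunLike.congr_fun (ih (by omega) (tail f) α) (ι B n a)
    simp only [AlgHom.comp_apply, hα', map_ι] at this
    simp [this]

theorem act_frobFamily {m n : ℕ} (f : Fin m →o Fin n) (α : Fin n →o Bool) :
    (act f).comp (frobFamily g n α) = (frobFamily g m (α.comp f)).comp (act (B := B) f) :=
  act_frobFamily_aux hg _ (Nat.lt_succ_self _) f α

/-- Naturality for the map out of the empty ordinal, where the family is the identity. -/
theorem aug_frobFamily (n : ℕ) (α : Fin n →o Bool) (a : SymIter B n) :
    aug B n (frobFamily g n α a) = aug B n a :=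
  congrArg (toBase B) (DFunLike.congr_fun (act_frobFamily hg (ofEmpty n) α) a)

end

end SymIter

/-! ### Bases of polynomial rings with prescribed leading monomials -/

namespace MonomialOrder

variable {I J k : Type*} [Field k] (m : MonomialOrder I) {e : J → MvPolynomial I k}

/-- Well-founded induction on exponents: a monomial differs from the `e j` with the same leading
exponent by a combination of smaller monomials. -/
theorem span_eq_top_of_monic (he : ∀ j, m.Monic (e j))
    (hD : Function.Surjective fun j => m.degree (e j)) : ⊤ ≤ Submodule.span k (Set.range e) := by
  have key : ∀ s : m.syn, ∀ c, m.toSyn c = s →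
      MvPolynomial.monomial c (1 : k) ∈ Submodule.span k (Set.range e) := by
    intro s
    induction s using WellFoundedLT.induction with
    | ind s ih =>
      rintro c rfl
      obtain ⟨j, hj⟩ := hD c
      dsimp only at hj
      have h₁ : MvPolynomial.monomial c (1 : k) = e j - (e j - MvPolynomial.monomial c 1) := by ring
      rw [h₁]
      refine sub_mem (Submodule.subset_span ⟨j, rfl⟩) ?_
      rw [← MvPolynomial.support_sum_monomial_coeff (e j - MvPolynomial.monomial c 1)]
      refine Submodule.sum_mem _ fun c' hc' => ?_
      rw [← mul_one (MvPolynomial.coeff _ _), ← smul_eq_mul, ← MvPolynomial.smul_monomial]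
      refine Submodule.smul_mem _ _ (ih _ ?_ c' rfl)
      classical
      have hne : c' ≠ c := by
        rintro rfl
        rw [MvPolynomial.mem_support_iff, MvPolynomial.coeff_sub, MvPolynomial.coeff_monomial,
          if_pos rfl, ← hj, (he j).coeff_degree, sub_self] at hc'
        exact hc' rfl
      rw [MvPolynomial.mem_support_iff, MvPolynomial.coeff_sub, MvPolynomial.coeff_monomial,
        if_neg hne.symm, sub_zero] at hc'
      refine lt_of_le_of_ne (hj ▸ m.le_degree (MvPolynomial.mem_support_iff.mpr hc')) fun h => ?_
      exact hne (m.toSyn.injective h)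
  intro f _
  rw [← MvPolynomial.support_sum_monomial_coeff f]
  refine Submodule.sum_mem _ fun c _ => ?_
  rw [← mul_one (MvPolynomial.coeff _ _), ← smul_eq_mul, ← MvPolynomial.smul_monomial]
  exact Submodule.smul_mem _ _ (key _ c rfl)

/-- In a relation, the term with the largest leading exponent is the only one contributing to that
coefficient. -/
theorem linearIndependent_of_monic (he : ∀ j, m.Monic (e j))
    (hD : Function.Injective fun j => m.degree (e j)) : LinearIndependent k e := by
  rw [linearIndependent_iff]
  intro l hl
  by_contra hne
  obtain ⟨j, hj, hmax⟩ := l.support.exists_max_image (fun j => m.toSyn (m.degree (e j)))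
    (Finsupp.support_nonempty_iff.mpr hne)
  have h := congrArg (MvPolynomial.coeff (m.degree (e j))) hl
  rw [Finsupp.linearCombination_apply, Finsupp.sum, MvPolynomial.coeff_sum,
    Finset.sum_eq_single_of_mem j hj, MvPolynomial.coeff_smul, (he j).coeff_degree,
    MvPolynomial.coeff_zero, smul_eq_mul, mul_one] at h
  · exact Finsupp.mem_support_iff.mp hj h
  · intro j' hj' hjj'
    rw [MvPolynomial.coeff_smul, m.coeff_eq_zero_of_lt, smul_zero]
    exact lt_of_le_of_ne (hmax j' hj') fun h => hjj' (hD (m.toSyn.injective h))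

section Division

variable {t : I → MvPolynomial I k} {d : I → ℕ}

theorem monic_aeval_monomial (ht : ∀ i, m.Monic (t i)) (b : I →₀ ℕ) :
    m.Monic (MvPolynomial.aeval t (MvPolynomial.monomial b (1 : k))) := by
  rw [MvPolynomial.aeval_monomial, map_one, one_mul]
  exact Monic.prod fun i _ => (ht i).pow

theorem degree_aeval_monomial (ht : ∀ i, m.Monic (t i))
    (hd : ∀ i, m.degree (t i) = Finsupp.single i (d i)) (b : I →₀ ℕ) (i : I) :
    m.degree (MvPolynomial.aeval t (MvPolynomial.monomial b (1 : k))) i = b i * d i := by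
  rw [MvPolynomial.aeval_monomial, map_one, one_mul, Finsupp.prod,
    m.degree_prod fun i _ => (ht i).pow.ne_zero]
  have (j : I) : m.degree (t j ^ b j) = Finsupp.single j (b j * d j) := by
    rw [m.degree_pow, hd, Finsupp.smul_single, smul_eq_mul]
  simp only [this, Finsupp.finsetSum_apply]
  by_cases hi : i ∈ b.support
  · rw [Finset.sum_eq_single_of_mem i hi fun j _ hj => by simp [hj], Finsupp.single_eq_same]
  · rw [Finset.sum_eq_zero fun j hj => by
      rw [Finsupp.single_eq_of_ne]; rintro rfl; exact hi hj]
    rw [Finsupp.notMem_support_iff.mp hi, zero_mul]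

/-- If the polynomials `t_i` are monic with leading monomials `x_i ^ d_i`, then the polynomial
ring is free over the ring generated by the `t_i`, on the monomials `x^a` with `a_i < d_i`. -/
theorem bijective_division {R : Type*} (hd0 : ∀ i, 0 < d i) (ht : ∀ i, m.Monic (t i))
    (hd : ∀ i, m.degree (t i) = Finsupp.single i (d i)) (ρ : R → I →₀ ℕ)
    (hρ : Function.Injective ρ) (hρ' : ∀ a : I →₀ ℕ, (∃ r, ρ r = a) ↔ ∀ i, a i < d i) :
    Function.Bijective (Finsupp.lsum k fun r : R =>
      LinearMap.mulLeft k (MvPolynomial.monomial (ρ r) (1 : k)) ∘ₗ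
        (MvPolynomial.aeval t : MvPolynomial I k →ₐ[k] MvPolynomial I k).toLinearMap) := by
  -- The leading exponent of this product is `ρ_i + b_i d_i` in coordinate `i`. By division with
  -- remainder each exponent occurs exactly once, so the products form a basis.
  let e (x : R × (I →₀ ℕ)) : MvPolynomial I k := MvPolynomial.monomial (ρ x.1) 1 *
    MvPolynomial.aeval t (MvPolynomial.monomial x.2 (1 : k))
  have he (x) : m.Monic (e x) := m.monic_monomial_one.mul (m.monic_aeval_monomial ht _)
  have hD (x) (i) : m.degree (e x) i = ρ x.1 i + x.2 i * d i := by
    rw [m.degree_mul m.monic_monomial_one.ne_zero (m.monic_aeval_monomial ht _).ne_zero,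
      Finsupp.add_apply, m.degree_aeval_monomial ht hd]
    classical
    rw [m.degree_monomial, if_neg one_ne_zero]
  have hlt (r) (i) : ρ r i < d i := (hρ' _).mp ⟨r, rfl⟩ i
  have hinj : Function.Injective fun x => m.degree (e x) := by
    intro x y hxy
    have h (i) : ρ x.1 i + x.2 i * d i = ρ y.1 i + y.2 i * d i := by
      rw [← hD, ← hD]
      exact DFunLike.congr_fun hxy i
    refine Prod.ext (hρ (Finsupp.ext fun i => ?_)) (Finsupp.ext fun i => ?_)
    · have := congrArg (· % d i) (h i)
      simpa [Nat.mod_eq_of_lt (hlt _ i)] using this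
    · have := congrArg (· / d i) (h i)
      simpa [Nat.add_mul_div_right _ _ (hd0 i), Nat.div_eq_of_lt (hlt _ i)] using this
  have hsurj : Function.Surjective fun x => m.degree (e x) := by
    intro c
    obtain ⟨r, hr⟩ := (hρ' (Finsupp.onFinset c.support (fun i => c i % d i) fun i hi => by
      rw [Finsupp.mem_support_iff]; rintro h; simp [h] at hi)).mpr fun i => Nat.mod_lt _ (hd0 i)
    refine ⟨(r, Finsupp.onFinset c.support (fun i => c i / d i) fun i hi => by
      rw [Finsupp.mem_support_iff]; rintro h; simp [h] at hi), Finsupp.ext fun i => ?_⟩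
    rw [hD]
    simp only [hr, Finsupp.onFinset_apply]
    exact Nat.mod_add_div' _ _
  let b := Module.Basis.mk (m.linearIndependent_of_monic he hinj) (m.span_eq_top_of_monic he hsurj)
  let E : (R →₀ MvPolynomial I k) ≃ₗ[k] MvPolynomial I k :=
    (Finsupp.mapRange.linearEquiv (MvPolynomial.basisMonomials I k).repr) ≪≫ₗ
      (Finsupp.curryLinearEquiv k).symm ≪≫ₗ b.repr.symm
  convert E.bijective using 1
  suffices h : Finsupp.lsum k (fun r : R =>
      LinearMap.mulLeft k (MvPolynomial.monomial (ρ r) (1 : k)) ∘ₗ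
        (MvPolynomial.aeval t : MvPolynomial I k →ₐ[k] MvPolynomial I k).toLinearMap) =
      E.toLinearMap from congrArg DFunLike.coe h
  refine Finsupp.lhom_ext' fun r => (MvPolynomial.basisMonomials I k).ext fun c => ?_
  have : (Finsupp.curryLinearEquiv k).symm (Finsupp.single r (Finsupp.single c (1 : k))) =
      Finsupp.single (r, c) 1 := by
    rw [LinearEquiv.symm_apply_eq]
    simp
  have hr : (MvPolynomial.basisMonomials I k).repr (MvPolynomial.monomial c 1) =
      Finsupp.single c 1 := by
    have := (MvPolynomial.basisMonomials I k).repr_self c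
    rwa [MvPolynomial.coe_basisMonomials] at this
  simp [E, b, e, hr, this]

end Division

end MonomialOrder

/-! ### Bar constructions of polynomial rings -/

namespace BarPoly

noncomputable section

/-- The simplices of `Δ¹`. -/
abbrev Cut (n : ℕ) := Fin (n + 1) →o Bool

/-- The nonconstant simplices of `Δ¹`. -/
def NonConst (n : ℕ) : Type := {α : Cut n // α 0 = false ∧ α (Fin.last n) = true}

/-- The variables of the `n`-th polynomial ring of the bar construction. -/
abbrev Idx (σ : Type*) (n : ℕ) := σ ⊕ σ × NonConst n

theorem Cut.eq_true {n : ℕ} {α : Cut n} (h : α 0 = true) : α = OrderHom.const _ true := by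
  ext i
  have := α.monotone (Fin.zero_le i)
  rw [h, Bool.le_iff_imp] at this
  simpa using this rfl

theorem Cut.eq_false {n : ℕ} {α : Cut n} (h : α (Fin.last n) = false) :
    α = OrderHom.const _ false := by
  ext i
  have := α.monotone (Fin.le_last i)
  rw [h, Bool.le_iff_imp] at this
  simpa using this

theorem Cut.cases {n : ℕ} (α : Cut n) : α = OrderHom.const _ true ∨ α = OrderHom.const _ false ∨
    ∃ β : NonConst n, α = β.1 := by
  cases h : α 0
  · cases h' : α (Fin.last n)
    · exact Or.inr (Or.inl (Cut.eq_false h'))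
    · exact Or.inr (Or.inr ⟨⟨α, h, h'⟩, rfl⟩)
  · exact Or.inl (Cut.eq_true h)

variable {k : Type} [CommRing k] {σ : Type u} (t : σ → MvPolynomial σ k)

/-- The element `[α]t_i` of the bar construction attached to a simplex `α` of `Δ¹`. -/
def val (n : ℕ) (i : σ) (α : Cut n) : MvPolynomial (Idx σ n) k :=
  if h₀ : α 0 = true then MvPolynomial.rename Sum.inl (t i) else
    if h : α (Fin.last n) = true then MvPolynomial.X (Sum.inr (i, ⟨α, by simpa using h₀, h⟩)) else 0

@[simp]
theorem val_true (n : ℕ) (i : σ) :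
    val t n i (OrderHom.const _ true) = MvPolynomial.rename Sum.inl (t i) :=
  dif_pos rfl

@[simp]
theorem val_false (n : ℕ) (i : σ) : val t n i (OrderHom.const _ false) = 0 := by
  rw [val, dif_neg (by simp), dif_neg (by simp)]

@[simp]
theorem val_coe (n : ℕ) (i : σ) (β : NonConst n) :
    val t n i β.1 = MvPolynomial.X (Sum.inr (i, β)) := by
  rw [val, dif_neg (by simp [β.2.1]), dif_pos β.2.2]
  rfl

/-- The action of a monotone map on the bar construction. -/
def map {m n : ℕ} (f : Fin (m + 1) →o Fin (n + 1)) :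
    MvPolynomial (Idx σ n) k →ₐ[k] MvPolynomial (Idx σ m) k :=
  MvPolynomial.aeval (Sum.elim (fun i => MvPolynomial.X (Sum.inl i))
    fun x => val t m x.1 (x.2.1.comp f))

@[simp]
theorem map_X_inl {m n : ℕ} (f : Fin (m + 1) →o Fin (n + 1)) (i : σ) :
    map t f (MvPolynomial.X (Sum.inl i)) = MvPolynomial.X (Sum.inl i) := by simp [map]

theorem map_rename {m n : ℕ} (f : Fin (m + 1) →o Fin (n + 1)) (q : MvPolynomial σ k) :
    map t f (MvPolynomial.rename Sum.inl q) = MvPolynomial.rename Sum.inl q := by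
  have : (map t f).comp (MvPolynomial.rename Sum.inl) =
      (MvPolynomial.rename Sum.inl : MvPolynomial σ k →ₐ[k] _) :=
    MvPolynomial.algHom_ext fun i => by simp
  exact DFunLike.congr_fun this q

@[simp]
theorem map_val {m n : ℕ} (f : Fin (m + 1) →o Fin (n + 1)) (i : σ) (α : Cut n) :
    map t f (val t n i α) = val t m i (α.comp f) := by
  obtain rfl | rfl | ⟨β, rfl⟩ := α.cases
  · rw [val_true, map_rename]
    exact (val_true t m i).symm
  · rw [val_false, map_zero]
    exact (val_false t m i).symm
  · rw [val_coe]
    simp [map]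

theorem map_id (n : ℕ) : map t (OrderHom.id : Fin (n + 1) →o Fin (n + 1)) = .id k _ := by
  refine MvPolynomial.algHom_ext fun i => ?_
  obtain i | ⟨i, β⟩ := i
  · simp
  · rw [← val_coe t n i β, map_val]
    rfl

theorem map_comp {l m n : ℕ} (f : Fin (m + 1) →o Fin (n + 1)) (g : Fin (l + 1) →o Fin (m + 1)) :
    map t (f.comp g) = (map t g).comp (map t f) := by
  refine MvPolynomial.algHom_ext fun i => ?_
  obtain i | ⟨i, β⟩ := i
  · simp
  · rw [AlgHom.comp_apply, ← val_coe t n i β, map_val, map_val, map_val]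
    rfl

/-- When the `t_i` are the variables, even `x_i` is a value of `val`, namely at the constant cut
`true`. The algebra is then freely generated by the simplices of `Δ¹` modulo the endpoint `false`.
-/
theorem algHom_ext {n : ℕ} {A : Type*} [CommRing A] [Algebra k A]
    {f g : MvPolynomial (Idx σ n) k →ₐ[k] A}
    (h : ∀ i α, f (val MvPolynomial.X n i α) = g (val MvPolynomial.X n i α)) : f = g := by
  refine MvPolynomial.algHom_ext fun i => ?_
  obtain i | ⟨i, β⟩ := i
  · simpa using h i (OrderHom.const _ true)
  · simpa using h i β.1

/-- The map between bar constructions given by an operation on the simplices of `Δ¹`. -/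
def op {m n : ℕ} (ω : Cut n → Cut m) :
    MvPolynomial (Idx σ n) k →ₐ[k] MvPolynomial (Idx σ m) k :=
  MvPolynomial.aeval (Sum.elim (fun i => val MvPolynomial.X m i (ω (OrderHom.const _ true)))
    fun x => val MvPolynomial.X m x.1 (ω x.2.1))

/-- The simplex `false` represents `0`, so an operation has to fix it; all other simplices are free
generators. -/
theorem op_val {m n : ℕ} {ω : Cut n → Cut m} (hω : ω (OrderHom.const _ false) =
    OrderHom.const _ false) (i : σ) (α : Cut n) :
    op (k := k) ω (val MvPolynomial.X n i α) = val MvPolynomial.X m i (ω α) := by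
  obtain rfl | rfl | ⟨β, rfl⟩ := α.cases
  · rw [val_true, MvPolynomial.rename_X]
    simp [op]
  · rw [hω, val_false, val_false, map_zero]
  · rw [val_coe]
    simp [op]

/-- The map from the bar construction of the variables to the bar construction of the `t_i`. -/
def incl (n : ℕ) : MvPolynomial (Idx σ n) k →ₐ[k] MvPolynomial (Idx σ n) k :=
  MvPolynomial.aeval (Sum.elim (fun i => MvPolynomial.rename Sum.inl (t i))
    fun x => MvPolynomial.X (Sum.inr x))

@[simp]
theorem incl_val (n : ℕ) (i : σ) (α : Cut n) :
    incl t n (val MvPolynomial.X n i α) = val t n i α := by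
  obtain rfl | rfl | ⟨β, rfl⟩ := α.cases <;> simp [incl]

theorem map_comp_incl {m n : ℕ} (f : Fin (m + 1) →o Fin (n + 1)) :
    (map t f).comp (incl t n) = (incl t m).comp (map MvPolynomial.X f) :=
  algHom_ext fun i α => by simp

/-- The extension of a simplex by the value `false`. -/
def consFalse {n : ℕ} (α : Cut n) : Cut (n + 1) where
  toFun := Fin.cases false α
  monotone' a b h := by
    cases a using Fin.cases with
    | zero => exact Bool.false_le _
    | succ a =>
      cases b using Fin.cases with
      | zero => exact absurd h (by simp)
      | succ b => exact α.monotone (Fin.succ_le_succ_iff.mp h)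

@[simp]
theorem consFalse_zero {n : ℕ} (α : Cut n) : consFalse α 0 = false := rfl

@[simp]
theorem consFalse_succ {n : ℕ} (α : Cut n) (i : Fin (n + 1)) : consFalse α i.succ = α i := rfl

theorem consFalse_false (n : ℕ) : consFalse (OrderHom.const (Fin (n + 1)) false) =
    OrderHom.const _ false := by
  ext i
  cases i using Fin.cases <;> rfl

/-- The extra degeneracy of the bar construction of the variables. -/
def extra (n : ℕ) : MvPolynomial (Idx σ n) k →ₐ[k] MvPolynomial (Idx σ (n + 1)) k := op consFalse

@[simp]
theorem extra_val (n : ℕ) (i : σ) (α : Cut n) :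
    extra (k := k) n (val MvPolynomial.X n i α) = val MvPolynomial.X (n + 1) i (consFalse α) :=
  op_val (consFalse_false n) i α

theorem map_shift_comp_extra {m n : ℕ} (f : Fin (m + 1) →o Fin (n + 1)) :
    (map MvPolynomial.X (SymIter.shift f)).comp (extra (k := k) (σ := σ) n) =
      (extra m).comp (map MvPolynomial.X f) :=
  algHom_ext fun i α => by
    simp only [AlgHom.comp_apply, extra_val, map_val]
    congr 1
    ext j
    cases j using Fin.cases <;> rfl

theorem map_succ_comp_extra {n : ℕ} (f : Fin (n + 1) →o Fin (n + 2)) (hf : ∀ i, f i = i.succ) :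
    (map MvPolynomial.X f).comp (extra (k := k) (σ := σ) n) = .id k _ :=
  algHom_ext fun i α => by
    simp only [AlgHom.comp_apply, extra_val, map_val]
    congr 1
    ext j
    simp [hf]

/-- The new vertex carries the value `false`, so restriction to it sends every bar generator to `0`;
what remains is evaluation at the origin. -/
theorem map_zero_comp_extra (f : Fin 1 →o Fin 2) (hf : ∀ i, f i = 0) :
    (map MvPolynomial.X f).comp (extra (k := k) (σ := σ) 0) =
      (Algebra.ofId k _).comp (MvPolynomial.aeval 0) := by
  refine algHom_ext fun i α => ?_
  have h : (consFalse α).comp f = OrderHom.const _ false := by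
    ext j
    simp [hf]
  rw [AlgHom.comp_apply, extra_val, map_val, h, val_false]
  obtain rfl | rfl | ⟨β, rfl⟩ := α.cases
  · simp
  · simp
  · exact absurd (β.2.1.symm.trans β.2.2) (by simp)

/-- The evaluation of the bar construction at a point. -/
def aug {S : Type*} [CommRing S] [Algebra k S] (x : σ → S) (n : ℕ) :
    MvPolynomial (Idx σ n) k →ₐ[k] S :=
  MvPolynomial.aeval (Sum.elim x fun _ => 0)

theorem aug_rename {S : Type*} [CommRing S] [Algebra k S] (x : σ → S) (n : ℕ)
    (q : MvPolynomial σ k) : aug x n (MvPolynomial.rename Sum.inl q) = MvPolynomial.aeval x q := by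
  rw [aug, MvPolynomial.aeval_rename]
  rfl

theorem aug_val {S : Type*} [CommRing S] [Algebra k S] {x : σ → S}
    (hx : ∀ i, MvPolynomial.aeval x (t i) = 0) (n : ℕ) (i : σ) (α : Cut n) :
    aug x n (val t n i α) = 0 := by
  obtain rfl | rfl | ⟨β, rfl⟩ := α.cases
  · rw [val_true, aug_rename, hx]
  · simp
  · simp [aug]

theorem aug_comp_map {S : Type*} [CommRing S] [Algebra k S] {x : σ → S}
    (hx : ∀ i, MvPolynomial.aeval x (t i) = 0) {m n : ℕ} (f : Fin (m + 1) →o Fin (n + 1)) :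
    (aug x m).comp (map t f) = aug x n := by
  refine MvPolynomial.algHom_ext fun i => ?_
  obtain i | ⟨i, β⟩ := i
  · simp [aug]
  · rw [AlgHom.comp_apply, ← val_coe t n i β, map_val, aug_val t hx, aug_val t hx]

theorem aug_comp_incl {S : Type*} [CommRing S] [Algebra k S] {x : σ → S}
    (hx : ∀ i, MvPolynomial.aeval x (t i) = 0) (n : ℕ) :
    (aug x n).comp (incl t n) = aug 0 n :=
  algHom_ext fun i α => by
    rw [AlgHom.comp_apply, incl_val, aug_val t hx, aug_val _ (fun i => by simp)]

end

end BarPoly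

/-! ### The relations of perfected polynomial rings -/

namespace BarPoly

noncomputable section

variable {k : Type} [Field k] {E : Type u}

/-- The relations `x_0` and `x_{n+1}^p - x_n`. -/
def rel (p : ℕ) (x : E × ℕ) : MvPolynomial (E × ℕ) k :=
  match x with
  | (e, 0) => MvPolynomial.X (e, 0)
  | (e, n + 1) => MvPolynomial.X (e, n + 1) ^ p - MvPolynomial.X (e, n)

/-- The exponents of the leading monomials of the relations. -/
def relDeg (p : ℕ) : E × ℕ → ℕ
  | (_, 0) => 1
  | (_, _ + 1) => p

theorem relDeg_pos {p : ℕ} (hp : 1 < p) (x : E × ℕ) : 0 < relDeg p x := by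
  obtain ⟨e, _ | n⟩ := x
  · exact one_pos
  · exact one_pos.trans hp

open MonomialOrder in
-- Total degree is compared first, and `p > 1`, so the leading monomial is a pure power for every
-- choice of order on the variables.
theorem rel_leading {p : ℕ} (hp : 1 < p) {I : Type*} [LinearOrder I] [WellFoundedGT I]
    (i : E × ℕ → I) (x : E × ℕ) :
    (degLex (σ := I)).Monic (MvPolynomial.rename i (rel (k := k) p x)) ∧
    (degLex (σ := I)).degree (MvPolynomial.rename i (rel (k := k) p x)) =
      Finsupp.single (i x) (relDeg p x) := by
  obtain ⟨e, _ | n⟩ := x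
  · simp only [rel, MvPolynomial.rename_X, relDeg]
    exact ⟨degLex.monic_X, degLex.degree_X⟩
  · simp only [rel, MvPolynomial.rename_X, relDeg, map_sub, map_pow]
    have hX : (degLex (σ := I)).Monic ((MvPolynomial.X (i (e, n + 1)) : MvPolynomial I k) ^ p) :=
      degLex.monic_X.pow
    have hX' : (degLex (σ := I)).degree ((MvPolynomial.X (i (e, n + 1)) : MvPolynomial I k) ^ p) =
        Finsupp.single (i (e, n + 1)) p := by
      rw [degLex.degree_pow, degLex.degree_X, Finsupp.smul_single, smul_eq_mul, mul_one]
    have hlt : degLex.degree (MvPolynomial.X (i (e, n)) : MvPolynomial I k) ≺[degLex]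
        degLex.degree ((MvPolynomial.X (i (e, n + 1)) : MvPolynomial I k) ^ p) := by
      rw [hX', degLex.degree_X, degLex_lt_iff, Finsupp.DegLex.lt_iff]
      left
      simpa using hp
    constructor
    · rw [MonomialOrder.Monic, MonomialOrder.leadingCoeff_sub_of_lt hlt]
      exact hX
    · rw [MonomialOrder.degree_sub_of_lt hlt, hX']

/-- The reduced monomials. -/
abbrev Reduced (E : Type u) (p : ℕ) : Type u := {a : E × ℕ →₀ ℕ // ∀ x, a x < relDeg p x}

variable {p : ℕ} (hp : 1 < p)

/-- A family of elements of the bar construction of the variables, indexed by reduced monomials,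
gives an element of the bar construction of the relations. -/
def expand (E : Type u) (k : Type) [Field k] (p : ℕ) (n : ℕ) :
    (Reduced E p →₀ MvPolynomial (Idx (E × ℕ) n) k) →ₗ[k] MvPolynomial (Idx (E × ℕ) n) k :=
  Finsupp.lsum k fun r => LinearMap.mulLeft k (MvPolynomial.rename Sum.inl
    (MvPolynomial.monomial r.1 (1 : k))) ∘ₗ (incl (rel p) n).toLinearMap

@[simp]
theorem expand_single (n : ℕ) (r : Reduced E p) (q : MvPolynomial (Idx (E × ℕ) n) k) :
    expand E k p n (Finsupp.single r q) =
      MvPolynomial.rename Sum.inl (MvPolynomial.monomial r.1 1) * incl (rel p) n q := by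
  simp [expand]

/-- The dual of a well-order. For infinitely many variables, the degree-lexicographic order is used
with a linear order of this kind. -/
theorem exists_wellFoundedGT (I : Type*) : ∃ _ : LinearOrder I, WellFoundedGT I := by
  obtain ⟨_, _⟩ := exists_wellFoundedLT I
  exact ⟨inferInstanceAs (LinearOrder Iᵒᵈ), inferInstanceAs (WellFoundedGT Iᵒᵈ)⟩

include hp in
-- The map `incl` sends the variables to the relations, with leading monomials `x ^ relDeg`, and
-- fixes the bar variables, whose exponent is `1`. The remainders of the division are therefore
-- exactly the reduced monomials in the original variables.
theorem bijective_expand (n : ℕ) : Function.Bijective (expand E k p n) := by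
  let I := Idx (E × ℕ) n
  obtain ⟨_, _⟩ := exists_wellFoundedGT I
  let m : MonomialOrder I := MonomialOrder.degLex
  let d : I → ℕ := Sum.elim (relDeg p) fun _ => 1
  let t : I → MvPolynomial I k := Sum.elim (fun x => MvPolynomial.rename Sum.inl (rel p x))
    fun x => MvPolynomial.X (Sum.inr x)
  have h := m.bijective_division (t := t) (d := d)
    (R := Reduced E p) (ρ := fun r => Finsupp.mapDomain Sum.inl r.1) ?_ ?_ ?_ ?_ ?_
  · convert h using 2
    simp only [expand, MvPolynomial.rename_monomial]
    rfl
  · rintro (x | x)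
    · exact relDeg_pos hp x
    · exact one_pos
  · rintro (x | x)
    · exact (rel_leading hp (I := I) Sum.inl x).1
    · exact m.monic_X
  · rintro (x | x)
    · exact (rel_leading hp (I := I) Sum.inl x).2
    · exact m.degree_X
  · intro r s hrs
    exact Subtype.ext (Finsupp.mapDomain_injective Sum.inl_injective hrs)
  · intro a
    constructor
    · rintro ⟨r, rfl⟩ (x | x)
      · change Finsupp.mapDomain Sum.inl r.1 _ < _
        rw [Finsupp.mapDomain_apply Sum.inl_injective]
        exact r.2 x
      · change Finsupp.mapDomain Sum.inl r.1 _ < _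
        rw [Finsupp.mapDomain_of_notMem_range _ _ (by simp)]
        exact one_pos
    · intro ha
      refine ⟨⟨Finsupp.comapDomain Sum.inl a Sum.inl_injective.injOn, fun x => ha (Sum.inl x)⟩, ?_⟩
      refine Finsupp.mapDomain_comapDomain _ Sum.inl_injective _ ?_
      rintro (x | x) hx
      · exact ⟨x, rfl⟩
      · have := ha (Sum.inr x)
        have h1 : a (Sum.inr x) < 1 := this
        rw [Finset.mem_coe, Finsupp.mem_support_iff] at hx
        omega

/-- Reduced monomials involve only variables fixed by all simplicial operators. As a simplicial
vector space, the bar construction of the relations is thus a direct sum of copies of the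
contractible one for the variables. -/
theorem map_comp_expand {m n : ℕ} (f : Fin (m + 1) →o Fin (n + 1)) :
    (map (rel p) f).toLinearMap ∘ₗ expand E k p n =
      expand E k p m ∘ₗ Finsupp.mapRange.linearMap (map MvPolynomial.X f).toLinearMap := by
  refine Finsupp.lhom_ext fun r q => ?_
  have := DFunLike.congr_fun (map_comp_incl (rel (k := k) (E := E) p) f) q
  simp only [AlgHom.comp_apply] at this
  simp [map_rename, this]

end

end BarPoly

/-! ### Polynomial resolutions -/

namespace BarPoly

noncomputable section

variable {k : Type} [Field k] {E : Type u} {p : ℕ} (hp : 1 < p)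

/-- The decomposition of the bar construction of the relations indexed by reduced monomials. -/
def expandEquiv (n : ℕ) : (Reduced E p →₀ MvPolynomial (Idx (E × ℕ) n) k) ≃ₗ[k]
    MvPolynomial (Idx (E × ℕ) n) k :=
  LinearEquiv.ofBijective (expand E k p n) (bijective_expand hp n)

/-- The action of linear maps of the coefficients of reduced monomials. -/
def coeffMap {m n : ℕ} (h : MvPolynomial (Idx (E × ℕ) m) k →ₗ[k] MvPolynomial (Idx (E × ℕ) n) k) :
    MvPolynomial (Idx (E × ℕ) m) k →ₗ[k] MvPolynomial (Idx (E × ℕ) n) k :=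
  expand E k p n ∘ₗ Finsupp.mapRange.linearMap h ∘ₗ (expandEquiv hp m).symm.toLinearMap

theorem coeffMap_expand {m n : ℕ}
    (h : MvPolynomial (Idx (E × ℕ) m) k →ₗ[k] MvPolynomial (Idx (E × ℕ) n) k)
    (F : Reduced E p →₀ MvPolynomial (Idx (E × ℕ) m) k) :
    coeffMap hp h (expand E k p m F) = expand E k p n (Finsupp.mapRange.linearMap h F) := by
  have : (expandEquiv hp m).symm (expand E k p m F) = F := (expandEquiv hp m).symm_apply_apply F
  simp [coeffMap, this]

theorem map_coeffMap {l m n : ℕ} (f : Fin (m + 1) →o Fin (n + 1))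
    (h : MvPolynomial (Idx (E × ℕ) l) k →ₗ[k] MvPolynomial (Idx (E × ℕ) n) k)
    (q : MvPolynomial (Idx (E × ℕ) l) k) :
    map (rel p) f (coeffMap hp h q) =
      coeffMap hp ((map MvPolynomial.X f).toLinearMap ∘ₗ h) q := by
  obtain ⟨F, rfl⟩ := (bijective_expand hp l).2 q
  rw [coeffMap_expand, coeffMap_expand, Finsupp.mapRange.linearMap_comp]
  exact DFunLike.congr_fun (map_comp_expand f) _

theorem coeffMap_map {l m n : ℕ} (f : Fin (m + 1) →o Fin (n + 1))
    (h : MvPolynomial (Idx (E × ℕ) m) k →ₗ[k] MvPolynomial (Idx (E × ℕ) l) k)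
    (q : MvPolynomial (Idx (E × ℕ) n) k) :
    coeffMap hp h (map (rel p) f q) =
      coeffMap hp (h ∘ₗ (map MvPolynomial.X f).toLinearMap) q := by
  obtain ⟨F, rfl⟩ := (bijective_expand hp n).2 q
  have := DFunLike.congr_fun (map_comp_expand (k := k) (E := E) (p := p) f) F
  simp only [LinearMap.comp_apply, AlgHom.toLinearMap_apply] at this
  rw [this, coeffMap_expand, coeffMap_expand, Finsupp.mapRange.linearMap_comp]
  rfl

theorem coeffMap_id {n : ℕ} (q : MvPolynomial (Idx (E × ℕ) n) k) :
    coeffMap hp .id q = q := by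
  obtain ⟨F, rfl⟩ := (bijective_expand hp n).2 q
  rw [coeffMap_expand, Finsupp.mapRange.linearMap_id]
  rfl

/-- The extra degeneracy of the bar construction of the relations. -/
def extraRel (n : ℕ) : MvPolynomial (Idx (E × ℕ) n) k →ₗ[k] MvPolynomial (Idx (E × ℕ) (n + 1)) k :=
  coeffMap hp (extra n).toLinearMap

theorem map_shift_extraRel {m n : ℕ} (f : Fin (m + 1) →o Fin (n + 1))
    (q : MvPolynomial (Idx (E × ℕ) n) k) :
    map (rel p) (SymIter.shift f) (extraRel hp n q) = extraRel hp m (map (rel p) f q) := by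
  rw [extraRel, extraRel, map_coeffMap, coeffMap_map, ← AlgHom.comp_toLinearMap,
    ← AlgHom.comp_toLinearMap, map_shift_comp_extra]

theorem map_succ_extraRel {n : ℕ} (f : Fin (n + 1) →o Fin (n + 2)) (hf : ∀ i, f i = i.succ)
    (q : MvPolynomial (Idx (E × ℕ) n) k) :
    map (rel p) f (extraRel hp n q) = q := by
  rw [extraRel, map_coeffMap, ← AlgHom.comp_toLinearMap, map_succ_comp_extra f hf]
  exact coeffMap_id hp q

/-- A factor `t_i` is absorbed into the coefficients of the reduced monomials as a factor `X_i`, and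
the coefficients are evaluated at the origin. -/
theorem map_zero_extraRel_mul (f : Fin 1 →o Fin 2) (hf : ∀ i, f i = 0) (i : E × ℕ)
    (q : MvPolynomial (Idx (E × ℕ) 0) k) :
    map (rel p) f (extraRel hp 0 (q * val (rel p) 0 i (OrderHom.const _ true))) = 0 := by
  rw [extraRel, map_coeffMap, ← AlgHom.comp_toLinearMap, map_zero_comp_extra f hf]
  obtain ⟨F, rfl⟩ := (bijective_expand hp 0).2 q
  induction F using Finsupp.induction_linear with
  | zero => simp
  | add F G hF hG => rw [map_add, add_mul, map_add, hF, hG, add_zero]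
  | single r g =>
    rw [expand_single, mul_assoc, ← incl_val, ← map_mul, ← expand_single, coeffMap_expand,
      Finsupp.mapRange.linearMap_apply, Finsupp.mapRange_single, AlgHom.toLinearMap_apply,
      AlgHom.comp_apply, map_mul (MvPolynomial.aeval _), val_true, MvPolynomial.rename_X,
      MvPolynomial.aeval_X, Pi.zero_apply, mul_zero, map_zero, Finsupp.single_zero, map_zero]

end

end BarPoly

/-! ### The simplicial algebra resolving `S` and its augmentation. -/

namespace BarResolution

noncomputable section

variable {k : Type} [CommRing k] (B : CommAlgCat.{u} k) {σ : Type u}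
  (t : σ → MvPolynomial σ k)

/-- The terms of the resolution. -/
abbrev Term (σ : Type u) (n : ℕ) : Type u :=
  SymIter B (n + 1) ⊗[k] MvPolynomial (BarPoly.Idx σ n) k

/-- The action of monotone maps. -/
def map {m n : ℕ} (f : Fin (m + 1) →o Fin (n + 1)) : Term B σ n →ₐ[k] Term B σ m :=
  Algebra.TensorProduct.map (SymIter.act f) (BarPoly.map t f)

@[simp]
theorem map_tmul {m n : ℕ} (f : Fin (m + 1) →o Fin (n + 1)) (b) (q) :
    map B t f (b ⊗ₜ q) = SymIter.act f b ⊗ₜ BarPoly.map t f q := rfl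

/-- The tensor product of the iterated symmetric algebras of `B` and a bar construction. -/
def simplicial : SimplicialObject (CommAlgCat.{u} k) where
  obj n := CommAlgCat.of k (Term B σ n.unop.len)
  map f := CommAlgCat.ofHom (map B t f.unop.toOrderHom)
  map_id n := by
    ext : 1
    change map B t OrderHom.id = .id k _
    rw [map, SymIter.act_id, BarPoly.map_id, Algebra.TensorProduct.map_id]
  map_comp f g := by
    ext : 1
    change map B t (f.unop.toOrderHom.comp g.unop.toOrderHom) = (map B t _).comp (map B t _)
    rw [map, SymIter.act_comp, BarPoly.map_comp, Algebra.TensorProduct.map_comp]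
    rfl

variable {B} {S : CommAlgCat.{u} k} (φ : B →ₐ[k] S) {x : σ → S}

/-- The components of the augmentation. -/
def augHom (x : σ → S) (n : ℕ) : Term B σ n →ₐ[k] S :=
  Algebra.TensorProduct.lift (φ.comp (SymIter.aug B (n + 1))) (BarPoly.aug x n)
    fun _ _ => Commute.all _ _

@[simp]
theorem augHom_tmul (n : ℕ) (b) (q) :
    augHom φ x n (b ⊗ₜ q) = φ (SymIter.aug B (n + 1) b) * BarPoly.aug x n q := rfl

/-- The presentation of `S` by the bar construction in degree `0`. -/
def pres (x : σ → S) : B ⊗[k] MvPolynomial (BarPoly.Idx σ 0) k →ₐ[k] S :=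
  Algebra.TensorProduct.lift φ (BarPoly.aug x 0) fun _ _ => Commute.all _ _

theorem augHom_zero_eq (z : Term B σ 0) : augHom φ x 0 z =
    pres φ x (Algebra.TensorProduct.map (SymIter.aug B 1) (.id k _) z) := by
  induction z using TensorProduct.induction_on with
  | zero => simp
  | add z z' h h' => simp only [map_add, h, h']
  | tmul b q => rfl

/-- The generators `ι` give a linear section of the counit `Sym(B) → B`, so every element of the
presentation lifts. -/
theorem surjective_augHom_zero (hs : Function.Surjective (pres φ x)) :
    Function.Surjective (augHom φ x 0) := by
  intro s
  obtain ⟨z, rfl⟩ := hs s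
  refine ⟨TensorProduct.map (SymIter.ι B 0 ∘ₗ (SymIter.toBase B).symm.toLinearMap) .id z, ?_⟩
  rw [augHom_zero_eq]
  congr 1
  induction z using TensorProduct.induction_on with
  | zero => simp
  | add z z' h h' => simp only [map_add, h, h']
  | tmul b q => simp [SymIter.aug_ι, SymIter.aug_zero]

variable (hx : ∀ i, MvPolynomial.aeval x (t i) = 0)

include hx in
theorem augHom_comp_map {m n : ℕ} (f : Fin (m + 1) →o Fin (n + 1)) :
    (augHom φ x m).comp (map B t f) = augHom φ x n := by
  refine Algebra.TensorProduct.ext' fun b q => ?_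
  have := DFunLike.congr_fun (BarPoly.aug_comp_map t hx f) q
  rw [AlgHom.comp_apply] at this
  simp [SymIter.aug_act, this]

/-- The augmentation. -/
def augmentation : simplicial B t ⟶ (SimplicialObject.const (CommAlgCat.{u} k)).obj S where
  app n := CommAlgCat.ofHom (augHom φ x n.unop.len)
  naturality m n f := by
    ext : 1
    exact augHom_comp_map t φ hx f.unop.toOrderHom

end

/-- Over a field, a symmetric algebra is a polynomial ring on a basis. -/
theorem polynomial {k : Type} [Field k] (B : CommAlgCat.{u} k) (σ : Type u) (n : ℕ) :
    ∃ τ : Type u, Nonempty (Term B σ n ≃ₐ[k] MvPolynomial τ k) := by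
  let b := Module.Basis.ofVectorSpace k (SymIter B n)
  let e : SymIter B (n + 1) ≃ₐ[k] MvPolynomial (Module.Basis.ofVectorSpaceIndex k (SymIter B n)) k :=
    SymmetricAlgebra.equivMvPolynomial b
  exact ⟨_, ⟨(Algebra.TensorProduct.congr e AlgEquiv.refl).trans
    (MvPolynomial.tensorEquivSum _ _ _ _)⟩⟩

end BarResolution

/-! ### The extra degeneracy and the polynomial resolution. -/

namespace BarResolution

noncomputable section

variable {k : Type} [Field k] {B S : CommAlgCat.{u} k} {E : Type u} {p : ℕ} (hp : 1 < p)
  {φ : B →ₐ[k] S} {x : E × ℕ → S} (hx : ∀ i, MvPolynomial.aeval x (BarPoly.rel (k := k) p i) = 0)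

/-- The linear extra degeneracy of the resolution. -/
def extra (B : CommAlgCat.{u} k) (n : ℕ) : Term B (E × ℕ) n →ₗ[k] Term B (E × ℕ) (n + 1) :=
  TensorProduct.map (SymIter.ι B (n + 1)) (BarPoly.extraRel hp n)

theorem extra_tmul (n : ℕ) (b) (q : MvPolynomial (BarPoly.Idx (E × ℕ) n) k) :
    extra hp B n (b ⊗ₜ q) = SymIter.ι B (n + 1) b ⊗ₜ BarPoly.extraRel hp n q := rfl

theorem map_shift_extra {m n : ℕ} (f : Fin (m + 1) →o Fin (n + 1)) (z : Term B (E × ℕ) n) :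
    map B (BarPoly.rel p) (SymIter.shift f) (extra hp B n z) =
      extra hp B m (map B (BarPoly.rel p) f z) := by
  induction z using TensorProduct.induction_on with
  | zero => simp
  | add z z' h h' => simp only [map_add, h, h']
  | tmul b q =>
    rw [extra_tmul, map_tmul, map_tmul, extra_tmul, SymIter.act_shift, SymIter.map_ι,
      BarPoly.map_shift_extraRel]

theorem map_succ_extra {n : ℕ} (f : Fin (n + 1) →o Fin (n + 2)) (hf : ∀ i, f i = i.succ)
    (z : Term B (E × ℕ) n) : map B (BarPoly.rel p) f (extra hp B n z) = z := by
  induction z using TensorProduct.induction_on with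
  | zero => simp
  | add z z' h h' => simp only [map_add, h, h']
  | tmul b q =>
    rw [extra_tmul, map_tmul, SymIter.act_succ f hf, SymIter.ε_ι, BarPoly.map_succ_extraRel hp f hf]

variable (hs : Function.Surjective (pres φ x))
  (hker : ∀ z, pres φ x z = 0 → z ∈ Ideal.span (Set.range fun i => (1 : B) ⊗ₜ[k]
    BarPoly.val (BarPoly.rel p) 0 i (OrderHom.const _ true)))

include hker in
-- The composite of the extra degeneracy with the face `d_1` factors through `B ⊗ k[x]`, where it
-- annihilates all multiples of the relations, and these span the kernel of the presentation.
theorem map_zero_extra_eq_zero (f : Fin 1 →o Fin 2) (hf : ∀ i, f i = 0) {z : Term B (E × ℕ) 0}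
    (hz : augHom φ x 0 z = 0) : map B (BarPoly.rel p) f (extra hp B 0 z) = 0 := by
  let Q : B ⊗[k] MvPolynomial (BarPoly.Idx (E × ℕ) 0) k →ₗ[k] Term B (E × ℕ) 0 :=
    TensorProduct.map (SymIter.ι B 0 ∘ₗ (SymIter.toBase B).symm.toLinearMap)
      ((BarPoly.map (BarPoly.rel p) f).toLinearMap ∘ₗ BarPoly.extraRel hp 0)
  have hQ (z : Term B (E × ℕ) 0) : map B (BarPoly.rel p) f (extra hp B 0 z) =
      Q (Algebra.TensorProduct.map (SymIter.aug B 1) (.id k _) z) := by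
    induction z using TensorProduct.induction_on with
    | zero => simp
    | add z z' h h' => simp only [map_add, h, h']
    | tmul b q =>
      have : f = SymIter.shift (SymIter.ofEmpty 1) := by
        ext i
        rw [hf, Subsingleton.elim i 0]
        rfl
      have h : SymIter.act f (SymIter.ι B 1 b) = SymIter.ι B 0
          ((SymIter.toBase B).symm (SymIter.aug B 1 b)) := by
        rw [this, SymIter.act_shift, SymIter.map_ι]
        rfl
      rw [extra_tmul, map_tmul, h]
      rfl
  rw [hQ]
  have hz' := hker _ ((augHom_zero_eq φ z).symm.trans hz)
  generalize Algebra.TensorProduct.map (SymIter.aug B 1) (.id k _) z = w at hz'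
  -- The map `Q` is only linear, so an arbitrary multiplier is carried along in the induction over
  -- the ideal.
  suffices h : ∀ c, Q (c * w) = 0 by simpa using h 1
  induction hz' using Submodule.span_induction with
  | zero => simp
  | add w w' _ _ h h' =>
    intro c
    rw [mul_add, map_add, h, h', add_zero]
  | smul a w _ h =>
    intro c
    rw [smul_eq_mul, ← mul_assoc, h]
  | mem w hw =>
    obtain ⟨i, rfl⟩ := hw
    intro c
    induction c with
    | zero => simp
    | add c c' h h' => rw [add_mul, map_add, h, h', add_zero]
    | tmul b q =>
      rw [Algebra.TensorProduct.tmul_mul_tmul]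
      simp only [Q, TensorProduct.map_tmul, LinearMap.comp_apply, AlgHom.toLinearMap_apply]
      rw [BarPoly.map_zero_extraRel_mul hp f hf, TensorProduct.tmul_zero]

include hs hker in
-- This is the degree `-1` part of the extra degeneracy, obtained by factoring through the
-- surjective augmentation.
theorem exists_section (f : Fin 1 →o Fin 2) (hf : ∀ i, f i = 0) :
    ∃ g : S →ₗ[k] Term B (E × ℕ) 0, ∀ z, g (augHom φ x 0 z) =
      map B (BarPoly.rel p) f (extra hp B 0 z) := by
  let a := (augHom φ x 0).toLinearMap
  have ha : Function.Surjective a := surjective_augHom_zero φ hs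
  let h : LinearMap.ker a ≤ LinearMap.ker ((map B (BarPoly.rel p) f).toLinearMap ∘ₗ extra hp B 0) :=
    fun z hz => map_zero_extra_eq_zero hp hker f hf hz
  refine ⟨(LinearMap.ker a).liftQ _ h ∘ₗ (a.quotKerEquivOfSurjective ha).symm.toLinearMap,
    fun z => ?_⟩
  have : (a.quotKerEquivOfSurjective ha).symm (augHom φ x 0 z) = Submodule.Quotient.mk z := by
    rw [LinearEquiv.symm_apply_eq]
    rfl
  rw [LinearMap.comp_apply, LinearEquiv.coe_coe, this, Submodule.liftQ_apply]
  rfl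

open Unwinding

/-- The augmentation of the underlying simplicial module. -/
def moduleAug {t : E × ℕ → MvPolynomial (E × ℕ) k} (φ : B →ₐ[k] S)
    (hx : ∀ i, MvPolynomial.aeval x (t i) = 0) :
    ((SimplicialObject.whiskering _ _).obj toModule).obj (simplicial B t) ⟶
      (SimplicialObject.const (ModuleCat.{u} k)).obj (toModule.obj S) :=
  ((SimplicialObject.whiskering _ _).obj toModule).map (augmentation t φ hx)

/-- The extra degeneracy of the underlying simplicial module of the resolution. -/
def extraDegeneracy : SimplicialObject.Augmented.ExtraDegeneracy
    (⟨_, _, moduleAug φ hx⟩ : SimplicialObject.Augmented (ModuleCat.{u} k)) where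
  s' := ModuleCat.ofHom (exists_section hp hs hker
    (SimplexCategory.δ (1 : Fin 2)).toOrderHom (fun i => by rw [Subsingleton.elim i 0]; rfl)).choose
  s n := ModuleCat.ofHom (extra hp B n)
  s'_comp_ε := by
    have h := (exists_section hp hs hker (SimplexCategory.δ (1 : Fin 2)).toOrderHom
      (fun i => by rw [Subsingleton.elim i 0]; rfl)).choose_spec
    ext s
    obtain ⟨z, rfl⟩ := surjective_augHom_zero φ hs s
    refine (congrArg (augHom φ x 0) (h z)).trans ?_
    -- The two faces have the same augmentation; one of them undoes the extra degeneracy, the other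
    -- is the section.
    have h₀ := DFunLike.congr_fun (augHom_comp_map _ φ hx
      (SimplexCategory.δ (0 : Fin 2)).toOrderHom) (extra hp B 0 z)
    have h₁ := DFunLike.congr_fun (augHom_comp_map _ φ hx
      (SimplexCategory.δ (1 : Fin 2)).toOrderHom) (extra hp B 0 z)
    rw [AlgHom.comp_apply] at h₀ h₁
    rw [h₁, ← h₀, map_succ_extra hp _ (fun i => rfl)]
    rfl
  s₀_comp_δ₁ := by
    have h := (exists_section hp hs hker (SimplexCategory.δ (1 : Fin 2)).toOrderHom
      (fun i => by rw [Subsingleton.elim i 0]; rfl)).choose_spec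
    ext z
    exact (h z).symm
  s_comp_δ₀ n := by
    ext z
    exact map_succ_extra hp (SimplexCategory.δ (0 : Fin (n + 2))).toOrderHom (fun i => rfl) z
  s_comp_δ n i := by
    ext z
    have : (SimplexCategory.δ i.succ).toOrderHom =
        SymIter.shift (SimplexCategory.δ i).toOrderHom := by
      ext j : 2
      cases j using Fin.cases with
      | zero => exact Fin.succ_succAbove_zero i
      | succ j => exact Fin.succ_succAbove_succ i j
    have h := map_shift_extra hp (SimplexCategory.δ i).toOrderHom z
    rw [← this] at h
    exact h
  s_comp_σ n i := by
    ext z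
    have : (SimplexCategory.σ i.succ).toOrderHom =
        SymIter.shift (SimplexCategory.σ i).toOrderHom := by
      ext j : 2
      cases j using Fin.cases with
      | zero => exact Fin.predAbove_right_zero (i := i.succ)
      | succ j => exact Fin.succ_predAbove_succ i j
    have h := map_shift_extra hp (SimplexCategory.σ i).toOrderHom z
    rw [← this] at h
    exact h

/-- The polynomial resolution. -/
def resolution : PolynomialResolution S where
  P := simplicial B (BarPoly.rel p)
  aug := augmentation (BarPoly.rel p) φ hx
  polynomial n := polynomial B (E × ℕ) n.unop.len
  quasiIso := SimplicialObject.quasiIso_of_extraDegeneracy _ (extraDegeneracy hp hx hs hker)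

end

end BarResolution

/-! ### The cotangent complex -/

namespace Unwinding.CotFiber

variable {k B S M τ : Type*} [CommRing k] [CommRing B] [Algebra k B] [CommRing S] [Algebra k S]
  [AddCommGroup M] [Module S M] (f : B ⊗[k] MvPolynomial τ k →ₐ[k] S)

theorem d_one {A : Type*} [CommRing A] [Algebra k A] (f : A →ₐ[k] S) : d f 1 = 0 := by
  rw [← map_one (algebraMap k A), d_algebraMap]

theorem tensor_hom_ext {φ ψ : CotFiber f →ₗ[S] M} (h₁ : ∀ b, φ (d f (b ⊗ₜ 1)) = ψ (d f (b ⊗ₜ 1)))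
    (h₂ : ∀ i, φ (d f (1 ⊗ₜ MvPolynomial.X i)) = ψ (d f (1 ⊗ₜ MvPolynomial.X i))) : φ = ψ := by
  refine hom_ext f fun a => ?_
  have hmul {a b} (ha : φ (d f a) = ψ (d f a)) (hb : φ (d f b) = ψ (d f b)) :
      φ (d f (a * b)) = ψ (d f (a * b)) := by simp only [d_mul, map_add, map_smul, ha, hb]
  have hadd {a b} (ha : φ (d f a) = ψ (d f a)) (hb : φ (d f b) = ψ (d f b)) :
      φ (d f (a + b)) = ψ (d f (a + b)) := by simp only [d_add, map_add, ha, hb]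
  induction a using TensorProduct.induction_on with
  | zero => simpa using h₁ 0
  | add a b ha hb => exact hadd ha hb
  | tmul b q =>
    rw [← mul_one b, ← one_mul q, ← Algebra.TensorProduct.tmul_mul_tmul]
    refine hmul (h₁ b) ?_
    induction q using MvPolynomial.induction_on with
    | C c =>
      have : (1 : B) ⊗ₜ[k] (MvPolynomial.C c : MvPolynomial τ k) = algebraMap k _ c := by
        rw [Algebra.TensorProduct.algebraMap_apply', MvPolynomial.algebraMap_eq]
      rw [this, d_algebraMap, map_zero, map_zero]
    | add q r hq hr =>
      rw [TensorProduct.tmul_add]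
      exact hadd hq hr
    | mul_X q i hq =>
      rw [← mul_one (1 : B), ← Algebra.TensorProduct.tmul_mul_tmul]
      exact hmul hq (h₂ i)

/-- A derivation is the second component of an algebra map to the trivial square-zero extension.
Such maps can be prescribed separately on `B` and on the variables, so the differentials split off a
free part on the `dX_i`. -/
theorem exists_tensor_lift (φ : CotFiber (f.comp Algebra.TensorProduct.includeLeft) →ₗ[S] M)
    (m : τ → M) : ∃ ψ : CotFiber f →ₗ[S] M, (∀ b, ψ (d f (b ⊗ₜ 1)) = φ (d _ b)) ∧
      ∀ i, ψ (d f (1 ⊗ₜ MvPolynomial.X i)) = m i := by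
  let _ : Module k M := Module.compHom M (algebraMap k S)
  have : IsScalarTower k S M := ⟨fun c a m => by rw [Algebra.smul_def, mul_smul]; rfl⟩
  let _ : Module Sᵐᵒᵖ M := Module.compHom M ((RingHom.id S).fromOpposite fun _ _ => Commute.all _ _)
  have : IsCentralScalar S M := ⟨fun _ _ => rfl⟩
  let F₁ : B →ₐ[k] TrivSqZeroExt S M :=
    { toFun b := TrivSqZeroExt.inl (f (b ⊗ₜ 1)) + TrivSqZeroExt.inr (φ (d _ b))
      map_one' := by
        ext
        · simp [← Algebra.TensorProduct.one_def]
        · simp [d_one]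
      map_mul' a b := by
        ext
        · simp [← map_mul]
        · simp [d_mul]
      map_zero' := by
        have := d_algebraMap (f.comp (Algebra.TensorProduct.includeLeft : B →ₐ[k] _)) (0 : k)
        rw [map_zero] at this
        ext <;> simp [this]
      map_add' a b := by
        ext
        · simp [TensorProduct.add_tmul]
        · simp [d_add]
      commutes' c := by
        have : (algebraMap k B c) ⊗ₜ[k] (1 : MvPolynomial τ k) = algebraMap k _ c := rfl
        rw [this, d_algebraMap, AlgHom.commutes, map_zero, TrivSqZeroExt.inr_zero, add_zero]
        rfl }
  let F : B ⊗[k] MvPolynomial τ k →ₐ[k] TrivSqZeroExt S M := Algebra.TensorProduct.lift F₁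
    (MvPolynomial.aeval fun i => TrivSqZeroExt.inl (f (1 ⊗ₜ MvPolynomial.X i)) +
      TrivSqZeroExt.inr (m i)) fun _ _ => Commute.all _ _
  have hF : (TrivSqZeroExt.fstHom k S M).comp F = f := by
    apply Algebra.TensorProduct.ext
    · ext b
      simp [F, F₁]
    · ext i
      simp [F]
  have hF' (a) : (F a).fst = f a := DFunLike.congr_fun hF a
  obtain ⟨ψ, hψ⟩ := exists_lift f (fun a => (F a).snd) (by simp) (fun a b => by
    rw [map_mul, TrivSqZeroExt.snd_mul, hF', hF']
    rfl) (fun c => by rw [AlgHom.commutes]; rfl)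
  refine ⟨ψ, fun b => (hψ _).trans ?_, fun i => (hψ _).trans ?_⟩
  · simp [F, F₁]
  · simp [F]

end Unwinding.CotFiber

namespace BarPoly

variable {k : Type} [CommRing k] {σ : Type u}

theorem aug_comp_op {S : Type*} [CommRing S] [Algebra k S] {m n : ℕ} (ω : Cut n → Cut m) :
    (aug (0 : σ → S) m).comp (op (k := k) ω) = aug 0 n := by
  refine MvPolynomial.algHom_ext fun i => ?_
  have h (i) (α : Cut m) : aug (0 : σ → S) m (val (k := k) MvPolynomial.X m i α) = 0 :=
    aug_val _ (fun i => by simp) _ _ _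
  obtain i | ⟨i, β⟩ := i
  · rw [AlgHom.comp_apply, op, MvPolynomial.aeval_X, Sum.elim_inl, h]
    simp [aug]
  · rw [AlgHom.comp_apply, op, MvPolynomial.aeval_X, Sum.elim_inr, h]
    simp [aug]

theorem op_id (n : ℕ) : op (k := k) (σ := σ) (id : Cut n → Cut n) = .id k _ :=
  algHom_ext fun i α => op_val rfl i α

theorem map_comp_op {m n : ℕ} (f : Fin (m + 1) →o Fin (n + 1)) {ω : Cut n → Cut n}
    {ω' : Cut m → Cut m} (hω : ω (OrderHom.const _ false) = OrderHom.const _ false)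
    (hω' : ω' (OrderHom.const _ false) = OrderHom.const _ false)
    (h : ∀ α, (ω α).comp f = ω' (α.comp f)) :
    (map (k := k) (σ := σ) MvPolynomial.X f).comp (op ω) =
      (op ω').comp (map MvPolynomial.X f) :=
  algHom_ext fun i α => by
    simp only [AlgHom.comp_apply, op_val hω, map_val, op_val hω', h]

end BarPoly

namespace Unwinding.CotFiber

variable {k A S : Type*} [CommRing k] [CommRing A] [Algebra k A] [CommRing S] [Algebra k S]

theorem d_pow (f : A →ₐ[k] S) (a : A) (n : ℕ) :
    d f (a ^ (n + 1)) = ((n + 1 : S) * f a ^ n) • d f a := by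
  induction n with
  | zero => simp
  | succ n ih =>
    rw [pow_succ, d_mul, ih, smul_smul, ← add_smul]
    congr 1
    push_cast
    rw [map_pow]
    ring

theorem d_zero (f : A →ₐ[k] S) : d f 0 = 0 := by
  rw [← map_zero (algebraMap k A), d_algebraMap]

theorem d_pow_char {p : ℕ} [Fact p.Prime] {A S : Type*} [CommRing A] [Algebra (ZMod p) A]
    [CommRing S] [Algebra (ZMod p) S] (f : A →ₐ[ZMod p] S) (a : A) : d f (a ^ p) = 0 := by
  obtain ⟨n, hn⟩ : ∃ n, p = n + 1 := ⟨p - 1, (Nat.succ_pred_prime Fact.out).symm⟩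
  have h : ((n : S) + 1) = 0 := by
    have := congrArg (algebraMap (ZMod p) S) (CharP.cast_eq_zero (ZMod p) p)
    rw [map_natCast, map_zero] at this
    rw [← this]
    conv_rhs => rw [hn]
    push_cast
    rfl
  have := d_pow f a n
  rwa [h, zero_mul, zero_smul, ← hn] at this

end Unwinding.CotFiber

/-! ### Simplicial modules of differentials. -/

namespace BarResolution

noncomputable section

open Unwinding

variable {k : Type} [CommRing k] {B S : CommAlgCat.{u} k} {σ : Type u} (φ : B →ₐ[k] S)

/-- The terms of the simplicial module of differentials. -/
abbrev CotTerm (x : σ → S) (n : ℕ) : Type u := CotFiber (augHom φ x n)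

/-- The action of monotone maps on differentials. -/
def cotMap (t : σ → MvPolynomial σ k) {x : σ → S} (hx : ∀ i, MvPolynomial.aeval x (t i) = 0)
    {m n : ℕ} (f : Fin (m + 1) →o Fin (n + 1)) : CotTerm φ x n →ₗ[S] CotTerm φ x m :=
  CotFiber.map (map B t f) (augHom_comp_map t φ hx f)

/-- The simplicial module of differentials. -/
def cot (t : σ → MvPolynomial σ k) {x : σ → S} (hx : ∀ i, MvPolynomial.aeval x (t i) = 0) :
    SimplicialObject (ModuleCat.{u} S) where
  obj n := ModuleCat.of S (CotTerm φ x n.unop.len)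
  map f := ModuleCat.ofHom (cotMap φ t hx f.unop.toOrderHom)
  map_id n := (Over.lift (simplicial B t) (augmentation t φ hx) ⋙ cotFunctor S).map_id n
  map_comp f g := (Over.lift (simplicial B t) (augmentation t φ hx) ⋙ cotFunctor S).map_comp f g

/-- The differentials of the iterated symmetric algebras of `B` tensored with the bar construction
of the variables. -/
abbrev cotFree (σ : Type u) : SimplicialObject (ModuleCat.{u} S) :=
  cot φ MvPolynomial.X (x := (0 : σ → S)) (MvPolynomial.aeval_X 0)

/-- A pair of endomorphisms of the two factors gives an endomorphism of the differentials. -/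
def cotTensorMap (σ : Type u) {n : ℕ} (f : SymIter B (n + 1) →ₐ[k] SymIter B (n + 1))
    (hf : ∀ b, SymIter.aug B (n + 1) (f b) = SymIter.aug B (n + 1) b)
    (ω : BarPoly.Cut n → BarPoly.Cut n) : CotTerm φ (0 : σ → S) n →ₗ[S]
      CotTerm φ (0 : σ → S) n :=
  CotFiber.map (Algebra.TensorProduct.map f (BarPoly.op ω)) (by
    apply Algebra.TensorProduct.ext
    · ext b
      simp [hf]
    · refine MvPolynomial.algHom_ext fun i => ?_
      have := DFunLike.congr_fun (BarPoly.aug_comp_op (k := k) (σ := σ) (S := S) ω)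
        (MvPolynomial.X i)
      rw [AlgHom.comp_apply] at this
      simp [this])

theorem cotTensorMap_naturality {m n : ℕ} {f : SymIter B (n + 1) →ₐ[k] SymIter B (n + 1)}
    (hf : ∀ b, SymIter.aug B (n + 1) (f b) = SymIter.aug B (n + 1) b)
    {f' : SymIter B (m + 1) →ₐ[k] SymIter B (m + 1)}
    (hf' : ∀ b, SymIter.aug B (m + 1) (f' b) = SymIter.aug B (m + 1) b)
    {ω : BarPoly.Cut n → BarPoly.Cut n} {ω' : BarPoly.Cut m → BarPoly.Cut m}
    (g : Fin (m + 1) →o Fin (n + 1)) (h : (SymIter.act g).comp f = f'.comp (SymIter.act g))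
    (hω : ω (OrderHom.const _ false) = OrderHom.const _ false)
    (hω' : ω' (OrderHom.const _ false) = OrderHom.const _ false)
    (h' : ∀ α, (ω α).comp g = ω' (α.comp g)) :
    cotMap φ MvPolynomial.X (MvPolynomial.aeval_X 0) g ∘ₗ cotTensorMap φ σ f hf ω =
      cotTensorMap φ σ f' hf' ω' ∘ₗ cotMap φ MvPolynomial.X (MvPolynomial.aeval_X 0) g := by
  refine CotFiber.hom_ext _ fun a => ?_
  have H : (map B MvPolynomial.X g).comp (Algebra.TensorProduct.map f (BarPoly.op (σ := σ) ω)) =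
      (Algebra.TensorProduct.map f' (BarPoly.op ω')).comp (map B MvPolynomial.X g) := by
    rw [map, ← Algebra.TensorProduct.map_comp, ← Algebra.TensorProduct.map_comp, h,
      BarPoly.map_comp_op g hω hω' h']
  simp only [LinearMap.comp_apply, cotMap, cotTensorMap, CotFiber.map_d]
  exact congrArg (CotFiber.d _) (DFunLike.congr_fun H a)

end

/-! ### Acyclicity of the differentials of the bar construction of the variables. -/

noncomputable section

open Unwinding

variable {p : ℕ} [Fact p.Prime] {B S : CommAlgCat.{u} (ZMod p)} {σ : Type u} (φ : B →ₐ[ZMod p] S)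
  {g : B →ₐ[ZMod p] B} (hg : ∀ b, g b ^ p = b)

include hg in
-- Elements coming from `B` go to `p`-th powers, whose differentials vanish, and every bar variable
-- goes to the simplex `false`, that is, to `0`.
theorem cotTensorMap_eq_zero (n : ℕ) (α : Fin (n + 1) →o Bool) (hα : ∀ i, α i = true) :
    cotTensorMap φ σ (SymIter.frobFamily g (n + 1) α) (SymIter.aug_frobFamily hg _ _)
      (· ⊓ OrderHom.const _ false) = 0 := by
  refine CotFiber.tensor_hom_ext _ (fun b => ?_) fun i => ?_
  · rw [cotTensorMap, CotFiber.map_d, Algebra.TensorProduct.map_tmul, map_one,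
      SymIter.frobFamily_of_true hg _ _ hα, AlgHom.comp_apply, frob_apply]
    have (a : SymIter B (n + 1)) : (a ^ p) ⊗ₜ[ZMod p]
        (1 : MvPolynomial (BarPoly.Idx σ n) (ZMod p)) = (a ⊗ₜ 1) ^ p := by
      rw [Algebra.TensorProduct.tmul_pow, one_pow]
    rw [this, CotFiber.d_pow_char, LinearMap.zero_apply]
  · have : BarPoly.op (k := ZMod p) (σ := σ) (fun α : BarPoly.Cut n => α ⊓ OrderHom.const _ false)
        (MvPolynomial.X i) = 0 := by
      have h (α : BarPoly.Cut n) : α ⊓ OrderHom.const _ false = OrderHom.const _ false :=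
        OrderHom.ext _ _ (by ext j; simp)
      obtain i | ⟨i, β⟩ := i <;> simp [BarPoly.op, h]
    rw [cotTensorMap, CotFiber.map_d, Algebra.TensorProduct.map_tmul, this, TensorProduct.tmul_zero,
      CotFiber.d_zero, LinearMap.zero_apply]

theorem inf_const_false {n : ℕ} (α : BarPoly.Cut n) :
    OrderHom.const _ false ⊓ α = OrderHom.const _ false :=
  OrderHom.ext _ _ (by ext j; simp)

/-- The first homotopy, at a simplex of `Δ¹`. -/
def homotopyFamily (σ : Type u) (n : ℕ) (α : Fin (n + 1) →o Bool) :
    (cotFree φ σ).obj (Opposite.op (.mk n)) ⟶ (cotFree φ σ).obj (Opposite.op (.mk n)) :=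
  ModuleCat.ofHom (cotTensorMap φ σ (SymIter.frobFamily g (n + 1) α)
    (SymIter.aug_frobFamily hg _ _) id)

/-- The second homotopy, at a simplex of `Δ¹`. -/
def homotopyFamily' (σ : Type u) (n : ℕ) (α : Fin (n + 1) →o Bool) :
    (cotFree φ σ).obj (Opposite.op (.mk n)) ⟶ (cotFree φ σ).obj (Opposite.op (.mk n)) :=
  ModuleCat.ofHom (cotTensorMap φ σ (SymIter.frobFamily g (n + 1) (OrderHom.const _ true))
    (SymIter.aug_frobFamily hg _ _) (· ⊓ α))

theorem homotopyFamily_naturality (m n : ℕ) (f : SimplexCategory.mk m ⟶ .mk n)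
    (α : Fin (n + 1) →o Bool) : homotopyFamily φ hg σ n α ≫ (cotFree φ σ).map f.op =
      (cotFree φ σ).map f.op ≫ homotopyFamily φ hg σ m (α.comp f.toOrderHom) := by
  have h := cotTensorMap_naturality (σ := σ) φ (SymIter.aug_frobFamily hg (n + 1) α)
    (SymIter.aug_frobFamily hg (m + 1) (α.comp f.toOrderHom)) (ω := id)
    (ω' := id) f.toOrderHom (SymIter.act_frobFamily hg f.toOrderHom α)
    rfl rfl fun _ => rfl
  exact congrArg ModuleCat.ofHom h

theorem homotopyFamily'_naturality (m n : ℕ) (f : SimplexCategory.mk m ⟶ .mk n)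
    (α : Fin (n + 1) →o Bool) : homotopyFamily' φ hg σ n α ≫ (cotFree φ σ).map f.op =
      (cotFree φ σ).map f.op ≫ homotopyFamily' φ hg σ m (α.comp f.toOrderHom) := by
  have h := cotTensorMap_naturality (σ := σ) φ (SymIter.aug_frobFamily hg (n + 1) (OrderHom.const _ true))
    (SymIter.aug_frobFamily hg (m + 1) (OrderHom.const _ true)) (ω := (· ⊓ α))
    (ω' := (· ⊓ α.comp f.toOrderHom)) f.toOrderHom (SymIter.act_frobFamily hg f.toOrderHom (OrderHom.const _ true))
    (inf_const_false _) (inf_const_false _) fun _ => rfl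
  exact congrArg ModuleCat.ofHom h

/-- The endomorphism of the differentials induced by the Frobenius. -/
def frobEnd (σ : Type u) : cotFree φ σ ⟶ cotFree φ σ where
  app n := homotopyFamily φ hg σ n.unop.len (OrderHom.const _ true)
  naturality := by
    rintro ⟨⟨m⟩⟩ ⟨⟨n⟩⟩ ⟨f⟩
    have h := homotopyFamily_naturality φ hg (σ := σ) n m f (OrderHom.const _ true)
    have e : (OrderHom.const (Fin (m + 1)) true).comp f.toOrderHom = OrderHom.const _ true := rfl
    rw [e] at h
    exact h.symm

include hg in
-- Two homotopies: from the identity to the Frobenius on the first factor, and from `0` to that same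
-- map by contracting `Δ¹` on the second factor. So the identity induces zero on homology.
theorem isZero_homology_cotFree (i : ℕ) : Limits.IsZero
    (((AlgebraicTopology.alternatingFaceMapComplex _).obj (cotFree φ σ)).homology i) := by
  have h₁ := (SimplicialObject.homotopyOfFamily _ (homotopyFamily_naturality φ hg (σ := σ))
    (f := 𝟙 _) (g := frobEnd φ hg σ) (fun n => by
      refine congrArg ModuleCat.ofHom (?_ : LinearMap.id = cotTensorMap φ σ _ _ id)
      refine CotFiber.hom_ext _ fun a => ?_
      rw [cotTensorMap, CotFiber.map_d, SymIter.frobFamily_of_false _ _ _ fun _ => rfl,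
        BarPoly.op_id, Algebra.TensorProduct.map_id]
      rfl) fun n => rfl).map_homology_eq i
  have h₂ := (SimplicialObject.homotopyOfFamily _ (homotopyFamily'_naturality φ hg (σ := σ))
    (f := 0) (g := frobEnd φ hg σ) (fun n => by
      refine congrArg ModuleCat.ofHom (?_ : 0 = cotTensorMap φ σ _ _ fun α => α ⊓ _)
      exact (cotTensorMap_eq_zero φ hg n _ fun _ => rfl).symm) fun n => by
      have : (fun α : BarPoly.Cut n => α ⊓ OrderHom.const _ true) = id := by
        ext α i
        simp
      change ModuleCat.ofHom (cotTensorMap _ _ _ _ id) =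
        ModuleCat.ofHom (cotTensorMap _ _ _ _ fun α : BarPoly.Cut n => α ⊓ _)
      rw [this]).map_homology_eq i
  rw [← h₂] at h₁
  rw [CategoryTheory.Functor.map_id, CategoryTheory.Functor.map_id, Functor.map_zero, Functor.map_zero] at h₁
  exact (Limits.IsZero.iff_id_eq_zero _).mpr h₁

end

end BarResolution

namespace Unwinding.CotFiber

variable {k A S : Type*} [CommRing k] [CommRing A] [Algebra k A] [CommRing S] [Algebra k S]

theorem d_sub (f : A →ₐ[k] S) (a b : A) : d f (a - b) = d f a - d f b := by
  rw [eq_sub_iff_add_eq, ← d_add, sub_add_cancel]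

end Unwinding.CotFiber

/-! ### Comparison of the two modules of differentials and quasiregularity. -/

namespace BarResolution

noncomputable section

open Unwinding

variable {p : ℕ} [Fact p.Prime] {B S : CommAlgCat.{u} (ZMod p)} {E : Type u} (φ : B →ₐ[ZMod p] S)
  {x : E × ℕ → S} (hx : ∀ i, MvPolynomial.aeval x (BarPoly.rel (k := ZMod p) p i) = 0)

include hx in
theorem augHom_comp_incl (n : ℕ) : (augHom φ x n).comp
    (Algebra.TensorProduct.map (.id _ _) (BarPoly.incl (BarPoly.rel p) n)) = augHom φ 0 n := by
  refine Algebra.TensorProduct.ext' fun b q => ?_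
  have := DFunLike.congr_fun (BarPoly.aug_comp_incl (BarPoly.rel p) hx n) q
  rw [AlgHom.comp_apply] at this
  simp [this]

/-- The comparison map on differentials. -/
def cotIncl (n : ℕ) : CotTerm φ (0 : E × ℕ → S) n →ₗ[S] CotTerm φ x n :=
  CotFiber.map (Algebra.TensorProduct.map (.id _ _) (BarPoly.incl (BarPoly.rel p) n))
    (augHom_comp_incl φ hx n)

/-- The differential of a variable. -/
abbrev dX (x : E × ℕ → S) (n : ℕ) (i : BarPoly.Idx (E × ℕ) n) : CotTerm φ x n :=
  CotFiber.d _ ((1 : SymIter B (n + 1)) ⊗ₜ[ZMod p] MvPolynomial.X i)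

/-- The differential of an element of the iterated symmetric algebra. -/
abbrev dB (x : E × ℕ → S) (n : ℕ) (b : SymIter B (n + 1)) : CotTerm φ x n :=
  CotFiber.d _ (b ⊗ₜ[ZMod p] (1 : MvPolynomial (BarPoly.Idx (E × ℕ) n) (ZMod p)))

theorem cotIncl_dB (n : ℕ) (b) : cotIncl φ hx n (dB φ 0 n b) = dB φ x n b := by
  simp [cotIncl]

theorem cotIncl_zero (n : ℕ) (e : E) :
    cotIncl φ hx n (dX φ 0 n (Sum.inl (e, 0))) = dX φ x n (Sum.inl (e, 0)) := by
  simp [cotIncl, BarPoly.incl, BarPoly.rel]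

/-- The differential of `x_{m+1}^p` vanishes, so only the linear term of the relation survives and
the index drops by one. -/
theorem cotIncl_succ (n : ℕ) (e : E) (m : ℕ) :
    cotIncl φ hx n (dX φ 0 n (Sum.inl (e, m + 1))) = -dX φ x n (Sum.inl (e, m)) := by
  have : (1 : SymIter B (n + 1)) ⊗ₜ[ZMod p]
      ((MvPolynomial.X (Sum.inl (e, m + 1)) : MvPolynomial (BarPoly.Idx (E × ℕ) n) (ZMod p)) ^ p) =
      (1 ⊗ₜ MvPolynomial.X (Sum.inl (e, m + 1))) ^ p := by
    rw [Algebra.TensorProduct.tmul_pow, one_pow]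
  have h : BarPoly.incl (BarPoly.rel p) n (MvPolynomial.X (Sum.inl (e, m + 1))) =
      MvPolynomial.X (Sum.inl (e, m + 1)) ^ p - MvPolynomial.X (R := ZMod p) (Sum.inl (e, m)) := by
    simp [BarPoly.incl, BarPoly.rel]
  rw [cotIncl, CotFiber.map_d, Algebra.TensorProduct.map_tmul, map_one, h, TensorProduct.tmul_sub,
    CotFiber.d_sub, this, CotFiber.d_pow_char, zero_sub]

theorem cotIncl_inr (n : ℕ) (i) :
    cotIncl φ hx n (dX φ 0 n (Sum.inr i)) = dX φ x n (Sum.inr i) := by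
  simp [cotIncl, BarPoly.incl]

/-- The inclusion of the kernel. -/
def cotKer (E : Type u) (n : ℕ) : (E →₀ S) →ₗ[S] CotTerm φ (0 : E × ℕ → S) n :=
  Finsupp.linearCombination S fun e => dX φ 0 n (Sum.inl (e, 0)) + dX φ 0 n (Sum.inl (e, 1))

theorem cotKer_single (n : ℕ) (e : E) (s : S) : cotKer φ E n (Finsupp.single e s) =
    s • (dX φ 0 n (Sum.inl (e, 0)) + dX φ 0 n (Sum.inl (e, 1))) := by
  simp [cotKer]

theorem exists_retraction (n : ℕ) : ∃ r : CotTerm φ (0 : E × ℕ → S) n →ₗ[S] (E →₀ S),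
    (∀ b, r (dB φ 0 n b) = 0) ∧ (∀ e, r (dX φ 0 n (Sum.inl (e, 0))) = Finsupp.single e 1) ∧
    (∀ e m, r (dX φ 0 n (Sum.inl (e, m + 1))) = 0) ∧ ∀ i, r (dX φ 0 n (Sum.inr i)) = 0 := by
  obtain ⟨r, h₁, h₂⟩ := CotFiber.exists_tensor_lift (augHom φ (0 : E × ℕ → S) n) (M := E →₀ S) 0
    (Sum.elim (fun i => if i.2 = 0 then Finsupp.single i.1 1 else 0) fun _ => 0)
  exact ⟨r, h₁, fun e => h₂ _, fun e m => h₂ _, fun i => h₂ _⟩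

theorem exists_cotSection (x : E × ℕ → S) (n : ℕ) :
    ∃ s : CotTerm φ x n →ₗ[S] CotTerm φ (0 : E × ℕ → S) n,
    (∀ b, s (dB φ x n b) = dB φ 0 n b) ∧
    (∀ e m, s (dX φ x n (Sum.inl (e, m))) = -dX φ 0 n (Sum.inl (e, m + 1))) ∧
    ∀ i, s (dX φ x n (Sum.inr i)) = dX φ 0 n (Sum.inr i) := by
  obtain ⟨s, h₁, h₂⟩ := CotFiber.exists_tensor_lift (augHom φ x n)
    (CotFiber.map (f' := augHom φ (0 : E × ℕ → S) n)
      Algebra.TensorProduct.includeLeft (by ext b; simp))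
    (Sum.elim (fun i => -dX φ 0 n (Sum.inl (i.1, i.2 + 1))) fun i => dX φ 0 n (Sum.inr i))
  exact ⟨s, fun b => (h₁ b).trans (by simp), fun e m => h₂ _, fun i => h₂ _⟩

/-- The comparison map of simplicial modules. -/
def cotInclHom : cotFree φ (E × ℕ) ⟶ cot φ (BarPoly.rel p) hx where
  app n := ModuleCat.ofHom (cotIncl φ hx n.unop.len)
  naturality := by
    rintro ⟨⟨n⟩⟩ ⟨⟨m⟩⟩ ⟨f⟩
    refine congrArg ModuleCat.ofHom
      (?_ : cotIncl φ hx m ∘ₗ cotMap φ MvPolynomial.X (MvPolynomial.aeval_X 0) f.toOrderHom =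
        cotMap φ (BarPoly.rel p) hx f.toOrderHom ∘ₗ cotIncl φ hx n)
    refine CotFiber.hom_ext _ fun a => ?_
    have H := BarPoly.map_comp_incl (BarPoly.rel (k := ZMod p) (E := E) p) f.toOrderHom
    have H' : (Algebra.TensorProduct.map (.id _ _) (BarPoly.incl (BarPoly.rel p) m)).comp
        (map B (MvPolynomial.X (σ := E × ℕ)) f.toOrderHom) =
        (map B (BarPoly.rel p) f.toOrderHom).comp
          (Algebra.TensorProduct.map (.id _ _) (BarPoly.incl (BarPoly.rel p) n)) := by
      rw [map, map, ← Algebra.TensorProduct.map_comp, ← Algebra.TensorProduct.map_comp, H]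
      rfl
    simp only [LinearMap.comp_apply, cotMap, cotIncl, CotFiber.map_d]
    exact congrArg (CotFiber.d _) (DFunLike.congr_fun H' a)

/-- The inclusion of the kernel, as a map of simplicial modules. -/
def cotKerHom (E : Type u) : (SimplicialObject.const _).obj (ModuleCat.of S (E →₀ S)) ⟶
    cotFree φ (E × ℕ) where
  app n := ModuleCat.ofHom (cotKer φ E n.unop.len)
  naturality := by
    rintro ⟨⟨n⟩⟩ ⟨⟨m⟩⟩ ⟨f⟩
    refine congrArg ModuleCat.ofHom (?_ : cotKer φ E m ∘ₗ .id =
      cotMap φ MvPolynomial.X (MvPolynomial.aeval_X 0) f.toOrderHom ∘ₗ cotKer φ E n)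
    refine Finsupp.lhom_ext fun e s => ?_
    simp [cotKer_single, cotMap]

theorem cotKerHom_comp : cotKerHom φ E ≫ cotInclHom φ hx = 0 := by
  ext ⟨⟨n⟩⟩ : 2
  refine (?_ : cotIncl φ hx n ∘ₗ cotKer φ E n = 0)
  refine Finsupp.lhom_ext fun e s => ?_
  rw [LinearMap.comp_apply, cotKer_single, map_smul, map_add, cotIncl_zero, cotIncl_succ,
    add_neg_cancel, smul_zero, LinearMap.zero_apply]

/-- On generators, the map identifies `dX_{e,0}` with the negative of `dX_{e,1}` and otherwise
shifts indices up to sign. Shifting back is a section, and the coefficient of `dX_{e,0}` retracts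
onto the kernel. -/
theorem cot_shortExact (n : ℕ) : (ShortComplex.mk ((cotKerHom φ E).app (.op (.mk n)))
    ((cotInclHom φ hx).app (.op (.mk n))) (by
      rw [← NatTrans.comp_app, cotKerHom_comp]; rfl)).ShortExact := by
  obtain ⟨r, hr₁, hr₂, hr₃, hr₄⟩ := exists_retraction φ (E := E) n
  obtain ⟨s, hs₁, hs₂, hs₃⟩ := exists_cotSection φ x n
  refine ShortComplex.Splitting.shortExact
    { r := ModuleCat.ofHom r
      s := ModuleCat.ofHom s
      f_r := congrArg ModuleCat.ofHom (?_ : r ∘ₗ cotKer φ E n = .id)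
      s_g := congrArg ModuleCat.ofHom (?_ : cotIncl φ hx n ∘ₗ s = .id)
      id := ModuleCat.hom_ext (?_ : cotKer φ E n ∘ₗ r + s ∘ₗ cotIncl φ hx n = .id) }
  · refine Finsupp.lhom_ext fun e a => ?_
    rw [LinearMap.comp_apply, cotKer_single, map_smul, map_add, hr₂, hr₃]
    simp
  · refine CotFiber.tensor_hom_ext _ (fun b => ?_) ?_
    · rw [LinearMap.comp_apply, hs₁, cotIncl_dB]; rfl
    · rintro (⟨e, m⟩ | i)
      · rw [LinearMap.comp_apply, hs₂, map_neg, cotIncl_succ, neg_neg]; rfl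
      · rw [LinearMap.comp_apply, hs₃, cotIncl_inr]; rfl
  · refine CotFiber.tensor_hom_ext _ (fun b => ?_) ?_
    · rw [LinearMap.add_apply, LinearMap.comp_apply, LinearMap.comp_apply, hr₁, cotIncl_dB, hs₁,
        map_zero, zero_add]; rfl
    · rintro (⟨e, _ | m⟩ | i)
      · rw [LinearMap.add_apply, LinearMap.comp_apply, LinearMap.comp_apply, hr₂, cotIncl_zero, hs₂,
          cotKer_single, one_smul, add_neg_cancel_right]; rfl
      · rw [LinearMap.add_apply, LinearMap.comp_apply, LinearMap.comp_apply, hr₃, cotIncl_succ,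
          map_neg, hs₂, map_zero, neg_neg, zero_add]; rfl
      · rw [LinearMap.add_apply, LinearMap.comp_apply, LinearMap.comp_apply, hr₄, cotIncl_inr, hs₃,
          map_zero, zero_add]; rfl

variable (hs : Function.Surjective (pres φ x))
  (hker : ∀ z, pres φ x z = 0 → z ∈ Ideal.span (Set.range fun i => (1 : B) ⊗ₜ[ZMod p]
    BarPoly.val (BarPoly.rel p) 0 i (OrderHom.const _ true)))

include hx hs hker in
/-- An algebra with such a presentation over a perfect ring is quasiregular semiperfect. -/
theorem isQRSP [PerfectRing B p] : IsQRSP p S := by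
  have hp : 1 < p := (Fact.out : p.Prime).one_lt
  have hF : Function.Bijective (frob p B) := by
    have : (frob p B : B → B) = fun b => b ^ p := funext fun b => frob_apply p B b
    rw [this]
    exact PerfectRing.bijective_frobenius
  -- The inverse of the Frobenius of `B`, which drives the homotopy.
  let g : B →ₐ[ZMod p] B := (AlgEquiv.ofBijective (frob p B) hF).symm.toAlgHom
  have hg (b : B) : g b ^ p = b :=
    (frob_apply p B _).symm.trans ((AlgEquiv.ofBijective (frob p B) hF).apply_symm_apply b)
  refine ⟨?_, resolution hp hx hs hker, fun i hi => ?_, ?_⟩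
  -- The image of the tilt is a subalgebra. It contains the image of the perfect ring `B`, and it
  -- contains `x (e, n)` because the later terms of the system are its `p`-power roots.
  · have hB (b : B) : φ b ∈ (tilt.coeff 0 : tilt p S →ₐ[ZMod p] S).range :=
      ⟨tilt.map φ (tilt.ofPerfect B b), by simp⟩
    have hX (e : E) (n : ℕ) : x (e, n) ∈ (tilt.coeff 0 : tilt p S →ₐ[ZMod p] S).range := by
      refine ⟨tilt.mk (fun m => x (e, n + m)) fun m => ?_, rfl⟩
      simpa [BarPoly.rel, sub_eq_zero, add_assoc] using hx (e, n + m + 1)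
    intro s
    obtain ⟨z, rfl⟩ := hs s
    have hq (q : MvPolynomial (BarPoly.Idx (E × ℕ) 0) (ZMod p)) :
        BarPoly.aug x 0 q ∈ (tilt.coeff 0 : tilt p S →ₐ[ZMod p] S).range := by
      induction q using MvPolynomial.induction_on with
      | C c =>
        rw [← MvPolynomial.algebraMap_eq, AlgHom.commutes]
        exact Subalgebra.algebraMap_mem _ c
      | add q r hq hr => rw [map_add]; exact add_mem hq hr
      | mul_X q i hq =>
        rw [map_mul]
        refine mul_mem hq ?_
        obtain ⟨e, n⟩ | i := i
        · simpa [BarPoly.aug] using hX e n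
        · simp [BarPoly.aug, zero_mem]
    suffices h : ∀ z, pres φ x z ∈ (tilt.coeff 0 : tilt p S →ₐ[ZMod p] S).range from h z
    intro z
    induction z using TensorProduct.induction_on with
    | zero => rw [map_zero]; exact zero_mem _
    | add z w hz hw => rw [map_add]; exact add_mem hz hw
    | tmul b q => exact mul_mem (hB b) (hq q)
  · exact SimplicialObject.isZero_homology_of_cofiber _ _ (cotKerHom_comp φ hx)
      (cot_shortExact φ hx) (isZero_homology_cotFree φ hg) i hi
  -- The first homology is the free module on `E`.
  · obtain ⟨e⟩ := SimplicialObject.nonempty_homology_one_iso_of_cofiber _ _ (cotKerHom_comp φ hx)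
      (cot_shortExact φ hx) (isZero_homology_cotFree φ hg)
    exact Module.Flat.of_linearEquiv (e.toLinearEquiv :)

end

end BarResolution

/-! ### Universal quasiregular semiperfect algebras -/

namespace Unwinding

noncomputable section

variable {p : ℕ} [Fact p.Prime]

/-- The algebra `S` is `B[x_e^{1/p^∞}]/(x_e)`, expressed by its universal property. -/
structure IsUniv {B S E : Type u} [CommRing B] [Algebra (ZMod p) B] [CommRing S]
    [Algebra (ZMod p) S] (φ : B →ₐ[ZMod p] S) (x : E → tilt p S) : Prop where
  coeff_zero : ∀ e, tilt.coeff 0 (x e) = 0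
  exists_lift : ∀ {T : Type u} [CommRing T] [Algebra (ZMod p) T] (f : B →ₐ[ZMod p] T)
    (a : E → tilt p T), (∀ e, tilt.coeff 0 (a e) = 0) →
    ∃ g : S →ₐ[ZMod p] T, g.comp φ = f ∧ ∀ e, tilt.map g (x e) = a e
  hom_ext : ∀ {T : Type u} [CommRing T] [Algebra (ZMod p) T] {g h : S →ₐ[ZMod p] T},
    g.comp φ = h.comp φ → (∀ e, tilt.map g (x e) = tilt.map h (x e)) → g = h

namespace IsUniv

section

variable {B S : CommAlgCat.{u} (ZMod p)} {E : Type u} {φ : B →ₐ[ZMod p] S} {x : E → tilt p S}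
  (hU : IsUniv φ x)

include hU

theorem aeval_rel (i : E × ℕ) :
    MvPolynomial.aeval (fun i : E × ℕ => tilt.coeff i.2 (x i.1)) (BarPoly.rel (k := ZMod p) p i) =
      0 := by
  obtain ⟨e, _ | n⟩ := i
  · simpa [BarPoly.rel] using hU.coeff_zero e
  · simp [BarPoly.rel, tilt.coeff_succ_pow]

/-- A subalgebra containing the base and the generators is everything. -/
theorem eq_top (R : Subalgebra (ZMod p) S) (h₁ : ∀ b, φ b ∈ R)
    (h₂ : ∀ e n, tilt.coeff n (x e) ∈ R) : R = ⊤ := by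
  obtain ⟨g, hg, hg'⟩ := hU.exists_lift (T := R) (φ.codRestrict R h₁)
    (fun e => tilt.mk (fun n => ⟨_, h₂ e n⟩) fun n => Subtype.ext (tilt.coeff_succ_pow n (x e)))
    fun e => Subtype.ext (hU.coeff_zero e)
  have h : R.val.comp g = .id _ _ := hU.hom_ext (by rw [AlgHom.comp_assoc, hg]; rfl) fun e => by
    rw [tilt.map_comp, hg']; rfl
  refine eq_top_iff.mpr fun s _ => ?_
  rw [← AlgHom.id_apply (R := ZMod p) s, ← h]
  exact (g s).2

/-- The kernel of the presentation is found from the universal property: `S` maps back to the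
quotient by the relations, compatibly with the presentation, so everything in the kernel already
vanishes in that quotient. -/
theorem isQRSP [PerfectRing B p] : IsQRSP p S := by
  refine BarResolution.isQRSP φ hU.aeval_rel ?_ fun z hz => ?_
  · rw [← AlgHom.range_eq_top]
    refine hU.eq_top _ (fun b => ⟨b ⊗ₜ 1, by simp [BarResolution.pres]⟩) fun e n =>
      ⟨1 ⊗ₜ MvPolynomial.X (Sum.inl (e, n)), by simp [BarResolution.pres, BarPoly.aug]⟩
  · set I := Ideal.span (Set.range fun i => (1 : B) ⊗ₜ[ZMod p]
      BarPoly.val (BarPoly.rel (k := ZMod p) (E := E) p) 0 i (OrderHom.const _ true))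
    have hI (i : E × ℕ) : Ideal.Quotient.mkₐ (ZMod p) I
        ((1 : B) ⊗ₜ MvPolynomial.rename Sum.inl (BarPoly.rel (k := ZMod p) p i)) = 0 :=
      Ideal.Quotient.eq_zero_iff_mem.mpr (Ideal.subset_span ⟨i, by simp⟩)
    obtain ⟨g, hg, hg'⟩ := hU.exists_lift
      (T := (B ⊗[ZMod p] MvPolynomial (BarPoly.Idx (E × ℕ) 0) (ZMod p)) ⧸ I)
      ((Ideal.Quotient.mkₐ (ZMod p) I).comp Algebra.TensorProduct.includeLeft)
      (fun e => tilt.mk (fun n => Ideal.Quotient.mkₐ (ZMod p) I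
        (1 ⊗ₜ MvPolynomial.X (Sum.inl (e, n)))) fun n => by
          have := hI (e, n + 1)
          rw [BarPoly.rel, map_sub, map_pow, MvPolynomial.rename_X, MvPolynomial.rename_X,
            TensorProduct.tmul_sub, map_sub, sub_eq_zero] at this
          rw [← this, ← map_pow, Algebra.TensorProduct.tmul_pow, one_pow]) (fun e => by
          have := hI (e, 0)
          rw [BarPoly.rel, MvPolynomial.rename_X] at this
          exact this)
    have h : g.comp (BarResolution.pres φ fun i : E × ℕ => tilt.coeff i.2 (x i.1)) =
        Ideal.Quotient.mkₐ (ZMod p) I := by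
      apply Algebra.TensorProduct.ext
      · ext b
        simpa [BarResolution.pres] using DFunLike.congr_fun hg b
      · refine MvPolynomial.algHom_ext fun i => ?_
        obtain ⟨e, n⟩ | ⟨_, β⟩ := i
        · simpa [BarResolution.pres, BarPoly.aug] using congrArg (tilt.coeff n) (hg' e)
        · exact absurd (β.2.1.symm.trans β.2.2) (by simp)
    have := DFunLike.congr_fun h z
    rw [AlgHom.comp_apply, hz, map_zero] at this
    exact Ideal.Quotient.eq_zero_iff_mem.mp this.symm

end

section

theorem of_id (B : Type u) [CommRing B] [Algebra (ZMod p) B] :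
    IsUniv (AlgHom.id (ZMod p) B) (PEmpty.elim : PEmpty.{u + 1} → tilt p B) where
  coeff_zero e := e.elim
  exists_lift f _ _ := ⟨f, rfl, fun e => e.elim⟩
  hom_ext h _ := h

theorem of_trunc (B : Type u) [CommRing B] [Algebra (ZMod p) B] :
    IsUniv (Trunc.incl B) (fun _ : PUnit.{u + 1} => Trunc.x (p := p) B) where
  coeff_zero _ := Trunc.coeff_zero_x B
  exists_lift f a ha := ⟨Trunc.lift f (a ⟨⟩) (ha ⟨⟩), AlgHom.ext (Trunc.lift_incl f _ (ha ⟨⟩)),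
    fun _ => Trunc.lift_x f _ (ha ⟨⟩)⟩
  hom_ext {T _ _ g h} h₁ h₂ := by
    refine Ideal.Quotient.algHom_ext (ZMod p) (I := Trunc.relations p B) ?_
    refine AlgHom.coe_ringHom_injective (MvPolynomial.ringHom_ext (fun b => ?_) fun n => ?_)
    · exact DFunLike.congr_fun h₁ b
    · exact congrArg (tilt.coeff n) (h₂ ⟨⟩)

variable {B S S' E E' : Type u} [CommRing B] [Algebra (ZMod p) B] [CommRing S]
  [Algebra (ZMod p) S] [CommRing S'] [Algebra (ZMod p) S'] [Algebra B S] [Algebra B S']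
  [IsScalarTower (ZMod p) B S] [IsScalarTower (ZMod p) B S'] {x : E → tilt p S} {x' : E' → tilt p S'}

theorem tensor (hU : IsUniv (IsScalarTower.toAlgHom (ZMod p) B S) x)
    (hU' : IsUniv (IsScalarTower.toAlgHom (ZMod p) B S') x') :
    IsUniv (IsScalarTower.toAlgHom (ZMod p) B (S ⊗[B] S')) (Sum.elim
      (fun e => tilt.map (Algebra.TensorProduct.includeLeft : S →ₐ[ZMod p] S ⊗[B] S') (x e))
      (fun e => tilt.map ((Algebra.TensorProduct.includeRight : S' →ₐ[B] S ⊗[B] S').restrictScalars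
        (ZMod p)) (x' e))) where
  coeff_zero e := by
    obtain e | e := e
    · simp [hU.coeff_zero]
    · simp [hU'.coeff_zero]
  exists_lift {T _ _} f a ha := by
    obtain ⟨g, hg, hg'⟩ := hU.exists_lift f (fun e => a (Sum.inl e)) fun e => ha _
    obtain ⟨h, hh, hh'⟩ := hU'.exists_lift f (fun e => a (Sum.inr e)) fun e => ha _
    let _ : Algebra B T := f.toRingHom.toAlgebra
    have : IsScalarTower (ZMod p) B T := .of_algebraMap_eq fun c => (f.commutes c).symm
    let g₁ : S →ₐ[B] T := { g with commutes' := DFunLike.congr_fun hg }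
    let h₁ : S' →ₐ[B] T := { h with commutes' := DFunLike.congr_fun hh }
    let L := Algebra.TensorProduct.lift g₁ h₁ fun _ _ => Commute.all _ _
    refine ⟨L.restrictScalars (ZMod p), AlgHom.ext fun b => L.commutes b, ?_⟩
    rintro (e | e)
    · rw [← hg']
      ext n
      simp [L, g₁]
    · rw [← hh']
      ext n
      simp [L, h₁]
  hom_ext {T _ _ g h} h₁ h₂ := by
    have hl : g.comp (Algebra.TensorProduct.includeLeft : S →ₐ[ZMod p] S ⊗[B] S') =
        h.comp Algebra.TensorProduct.includeLeft :=
      hU.hom_ext h₁ fun e => h₂ (Sum.inl e)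
    have hr : g.comp ((Algebra.TensorProduct.includeRight : S' →ₐ[B] S ⊗[B] S').restrictScalars
        (ZMod p)) = h.comp
        ((Algebra.TensorProduct.includeRight : S' →ₐ[B] S ⊗[B] S').restrictScalars (ZMod p)) := by
      refine hU'.hom_ext (AlgHom.ext fun b => ?_) fun e => h₂ (Sum.inr e)
      have : (1 : S) ⊗ₜ[B] algebraMap B S' b = algebraMap B (S ⊗[B] S') b := by
        rw [Algebra.TensorProduct.algebraMap_apply, Algebra.algebraMap_eq_smul_one,
          Algebra.algebraMap_eq_smul_one, TensorProduct.smul_tmul]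
      simpa [this] using DFunLike.congr_fun h₁ b
    ext z
    induction z using TensorProduct.induction_on with
    | zero => simp
    | add z w hz hw => rw [map_add, map_add, hz, hw]
    | tmul s t =>
      rw [← mul_one s, ← one_mul t, ← Algebra.TensorProduct.tmul_mul_tmul, map_mul, map_mul]
      exact congrArg₂ (· * ·) (DFunLike.congr_fun hl s) (DFunLike.congr_fun hr t)

end

end IsUniv

/-- The structure map of `B[x^{1/p^∞}]`. -/
def PerfPoly.incl (B : Type u) [CommRing B] [Algebra (ZMod p) B] : B →ₐ[ZMod p] PerfPoly p B :=
  (Ideal.Quotient.mkₐ (ZMod p) (PerfPoly.relations p B)).comp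
    (IsScalarTower.toAlgHom (ZMod p) B (MvPolynomial ℕ B))

theorem PerfPoly.exists_lift {B T : Type*} [CommRing B] [Algebra (ZMod p) B] [CommRing T]
    [Algebra (ZMod p) T] (f : B →ₐ[ZMod p] T) (a : tilt p T) :
    ∃ g : PerfPoly p B →ₐ[ZMod p] T, (∀ b, g (incl B b) = f b) ∧ tilt.map g (x B) = a := by
  refine ⟨Ideal.Quotient.liftₐ (relations p B) (MvPolynomial.aevalTower f fun n => tilt.coeff n a)
    fun q hq => ?_, fun b => MvPolynomial.aevalTower_C f _ b,
    tilt.ext fun n => MvPolynomial.aevalTower_X f _ n⟩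
  have : relations p B ≤
      RingHom.ker (MvPolynomial.aevalTower f fun n => tilt.coeff n a) := by
    refine Ideal.span_le.mpr ?_
    rintro q ⟨n, rfl⟩
    simp [RingHom.mem_ker, tilt.coeff_succ_pow]
  exact this hq

theorem PerfPoly.hom_ext {B T : Type*} [CommRing B] [Algebra (ZMod p) B] [CommRing T]
    [Algebra (ZMod p) T] {g h : PerfPoly p B →ₐ[ZMod p] T} (h₁ : ∀ b, g (incl B b) = h (incl B b))
    (h₂ : tilt.map g (x B) = tilt.map h (x B)) : g = h := by
  refine Ideal.Quotient.algHom_ext (ZMod p) (I := relations p B) ?_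
  refine AlgHom.coe_ringHom_injective (MvPolynomial.ringHom_ext (fun b => h₁ b) fun n => ?_)
  exact congrArg (tilt.coeff n) h₂

theorem bijective_frob_of_perfect (B : Type*) [CommRing B] [Algebra (ZMod p) B] [PerfectRing B p] :
    Function.Bijective (frob p B) := by
  have : (frob p B : B → B) = fun b => b ^ p := funext fun b => frob_apply p B b
  rw [this]
  exact PerfectRing.bijective_frobenius

instance PerfPoly.perfectRing (B : Type*) [CommRing B] [Algebra (ZMod p) B] [PerfectRing B p] :
    PerfectRing (PerfPoly p B) p where
  bijective_frobenius := by
    let r : B ≃ₐ[ZMod p] B := (AlgEquiv.ofBijective _ (bijective_frob_of_perfect (p := p) B)).symm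
    have hr (b : B) : r b ^ p = b := (frob_apply p B _).symm.trans
      ((AlgEquiv.ofBijective _ (bijective_frob_of_perfect (p := p) B)).apply_symm_apply b)
    -- The inverse Frobenius sends `x^{1/p^n}` to `x^{1/p^{n+1}}`.
    obtain ⟨g, hg, hg'⟩ := PerfPoly.exists_lift ((incl B).comp r.toAlgHom)
      (tilt.mk (fun n => tilt.coeff (n + 1) (x (p := p) B)) fun n => tilt.coeff_succ_pow (n + 1) _)
    have h : (frob p _).comp g = .id _ _ := hom_ext (fun b => by
      rw [AlgHom.comp_apply, hg, frob_apply, ← map_pow]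
      exact congrArg (incl B) ((map_pow r b p).trans (hr b))) (by
      ext n
      rw [tilt.map_comp, hg']
      change frob p _ (tilt.coeff (n + 1) (x B)) = tilt.coeff n (x B)
      rw [frob_apply, tilt.coeff_succ_pow])
    have h' (y : PerfPoly p B) : g y ^ p = y :=
      (frob_apply p _ _).symm.trans (DFunLike.congr_fun h y)
    refine Function.bijective_iff_has_inverse.mpr ⟨g, fun y => ?_, h'⟩
    exact (map_pow g y p).trans (h' y)

variable (p) in
theorem modelsQRSP : ModelsQRSP.{u} p where
  perfect B _ := (IsUniv.of_id B).isQRSP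
  -- This ring is itself perfect, so it is taken as the base, with no generators.
  perfPoly B _ := (IsUniv.of_id (PerfPoly p B)).isQRSP
    (B := .of (ZMod p) (PerfPoly p B)) (S := .of (ZMod p) (PerfPoly p B))
  trunc B _ := (IsUniv.of_trunc B).isQRSP (S := .of _ _)
  trunc₂ B _ := ((IsUniv.of_trunc B).tensor (IsUniv.of_trunc B)).isQRSP (S := .of _ _)
  trunc₃ B _ := (((IsUniv.of_trunc B).tensor (IsUniv.of_trunc B)).tensor
    (IsUniv.of_trunc B)).isQRSP (S := .of _ _)

end

end Unwinding

/-! ### A model with monomial basis -/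

namespace Unwinding

open scoped NNRat

noncomputable section

/-- The monoid `ℕ[1/p]` of exponents. -/
def Expo (p : ℕ) : AddSubmonoid ℚ≥0 where
  carrier := {q | ∃ n m : ℕ, q * p ^ n = m}
  zero_mem' := ⟨0, 0, by simp⟩
  add_mem' := by
    rintro a b ⟨n, m, h⟩ ⟨n', m', h'⟩
    refine ⟨n + n', m * p ^ n' + m' * p ^ n, ?_⟩
    push_cast
    rw [← h, ← h']
    ring

namespace Expo

variable {p : ℕ} [hp : Fact p.Prime]

theorem p_ne_zero : (p : ℚ≥0) ≠ 0 := Nat.cast_ne_zero.mpr hp.out.ne_zero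

/-- The exponent `1 / p^n`. -/
def unit (p : ℕ) [hp : Fact p.Prime] (n : ℕ) : Expo p :=
  ⟨1 / p ^ n, n, 1, by rw [div_mul_cancel₀ _ (pow_ne_zero _ p_ne_zero), Nat.cast_one]⟩

theorem coe_unit (n : ℕ) : (unit p n : ℚ≥0) = 1 / p ^ n := rfl

theorem unit_zero : (unit p 0 : ℚ≥0) = 1 := by simp [coe_unit]

theorem nsmul_unit (n : ℕ) : p • unit p (n + 1) = unit p n := by
  ext1
  have := p_ne_zero (p := p)
  rw [AddSubmonoidClass.coe_nsmul, coe_unit, coe_unit, nsmul_eq_mul]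
  field_simp
  exact (pow_succ' _ _).symm

/-- Division by `p`. -/
def divP (q : Expo p) : Expo p := ⟨q / p, by
  obtain ⟨n, m, h⟩ := q.2
  refine ⟨n + 1, m, ?_⟩
  rw [← h]
  have := p_ne_zero (p := p)
  field_simp
  ring⟩

theorem coe_divP (q : Expo p) : (divP q : ℚ≥0) = q / p := rfl

theorem nsmul_divP (q : Expo p) : p • divP q = q := by
  ext1
  have := p_ne_zero (p := p)
  rw [AddSubmonoidClass.coe_nsmul, coe_divP, nsmul_eq_mul]
  field_simp

theorem divP_nsmul (q : Expo p) : divP (p • q) = q := by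
  ext1
  have := p_ne_zero (p := p)
  rw [coe_divP, AddSubmonoidClass.coe_nsmul, nsmul_eq_mul]
  field_simp

theorem divP_add (q r : Expo p) : divP (q + r) = divP q + divP r :=
  Subtype.ext (add_div _ _ _)

theorem divP_unit (n : ℕ) : divP (unit p n) = unit p (n + 1) := by
  ext1
  rw [coe_divP, coe_unit, coe_unit, pow_succ, div_div]

theorem nsmul_injective : Function.Injective fun q : Expo p => p • q := by
  intro q r h
  have := congrArg Subtype.val h
  simp only [AddSubmonoidClass.coe_nsmul, nsmul_eq_mul] at this
  exact Subtype.ext (mul_left_cancel₀ p_ne_zero this)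

/-- The content is that the difference again has a power of `p` as denominator; clearing
denominators makes it a subtraction of natural numbers. -/
theorem exists_eq_add_unit {q : Expo p} {n : ℕ} (h : unit p n ≤ q) : ∃ r, q = r + unit p n := by
  obtain ⟨a, m, hm⟩ := q.2
  have h' : (unit p n : ℚ≥0) ≤ q := h
  obtain ⟨r, hr⟩ := exists_add_of_le h'
  have hp := p_ne_zero (p := p)
  have key : (p : ℚ≥0) ^ a + r * p ^ (a + n) = m * p ^ n := by
    rw [← hm, hr, coe_unit]
    field_simp
    ring
  have hle : p ^ a ≤ m * p ^ n := by
    have : ((p ^ a : ℕ) : ℚ≥0) ≤ ((m * p ^ n : ℕ) : ℚ≥0) := by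
      push_cast
      rw [← key]
      exact le_self_add
    exact_mod_cast this
  refine ⟨⟨r, a + n, m * p ^ n - p ^ a, ?_⟩, Subtype.ext (hr.trans (add_comm _ _))⟩
  obtain ⟨c, hc⟩ := Nat.exists_eq_add_of_le hle
  rw [hc, Nat.add_sub_cancel_left]
  have : ((m * p ^ n : ℕ) : ℚ≥0) = ((p ^ a + c : ℕ) : ℚ≥0) := by rw [hc]
  push_cast at this
  rw [← key] at this
  exact add_left_cancel this

theorem exists_eq_nsmul_unit (q : Expo p) : ∃ n m : ℕ, q = m • unit p n := by
  obtain ⟨n, m, h⟩ := q.2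
  refine ⟨n, m, Subtype.ext ?_⟩
  have hp := p_ne_zero (p := p)
  rw [AddSubmonoidClass.coe_nsmul, coe_unit, nsmul_eq_mul, ← h]
  field_simp

end Expo

/-- The multi-indices in the unit box. -/
def InBox {p : ℕ} {E : Type*} (q : E → Expo p) : Prop := ∀ e, (q e : ℚ≥0) < 1

variable (p : ℕ) [hp : Fact p.Prime] (B E : Type u) [CommRing B] [Algebra (ZMod p) B]

/-- The elements of the monoid algebra which are supported outside the unit box. -/
def boxIdeal : Ideal (AddMonoidAlgebra B (E → Expo p)) where
  carrier := {c | ∀ q, InBox q → c.coeff q = 0}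
  zero_mem' _ _ := rfl
  add_mem' {c c'} hc hc' q hq := by
    rw [AddMonoidAlgebra.coeff_add, Finsupp.add_apply, hc q hq, hc' q hq, add_zero]
  smul_mem' a c hc q hq := by
    induction a using AddMonoidAlgebra.induction_linear with
    | zero => simp
    | add a a' h h' =>
      rw [smul_eq_mul, add_mul, AddMonoidAlgebra.coeff_add, Finsupp.add_apply, ← smul_eq_mul, h,
        ← smul_eq_mul, h', add_zero]
    | single r b =>
      rw [smul_eq_mul]
      by_cases h : ∃ y, q = r + y
      · obtain ⟨y, rfl⟩ := h
        rw [AddMonoidAlgebra.coeff_single_mul_eq_mul_coeff y, hc y, mul_zero]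
        · exact fun e => lt_of_le_of_lt le_add_self (hq e)
        · exact fun _ _ => add_right_inj r
      · exact AddMonoidAlgebra.coeff_single_mul_of_forall_add_ne _ _ fun y hy => h ⟨y, hy.symm⟩

/-- The algebra `B[x_e^{1/p^∞}]/(x_e)`, as a quotient of a monoid algebra. -/
def BoxAlg : Type u := AddMonoidAlgebra B (E → Expo p) ⧸ boxIdeal p B E

instance : CommRing (BoxAlg p B E) := Ideal.Quotient.commRing (boxIdeal p B E)

instance : Algebra (ZMod p) (BoxAlg p B E) := Ideal.instAlgebraQuotient (ZMod p) (boxIdeal p B E)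

/-- The quotient map. -/
def BoxAlg.mk : AddMonoidAlgebra B (E → Expo p) →ₐ[ZMod p] BoxAlg p B E :=
  Ideal.Quotient.mkₐ (ZMod p) (boxIdeal p B E)

variable {p B E}

theorem InBox.divP {q : E → Expo p} (h : InBox q) : InBox fun e => Expo.divP (q e) := fun e => by
  rw [Expo.coe_divP]
  refine lt_of_le_of_lt (div_le_self zero_le ?_) (h e)
  exact_mod_cast hp.out.one_le

open Classical in
-- In coordinate `j` the value is at most `(q + 1)/p < 2/p ≤ 1`. This room is what makes division
-- possible one level higher up in the tilt.
theorem InBox.divP_add {q : E → Expo p} (h : InBox q) (j : E) (n : ℕ) :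
    InBox ((fun e => Expo.divP (q e)) + Pi.single j (Expo.unit p (n + 1))) := fun e => by
  by_cases he : e = j
  · subst he
    have h2 : (2 : ℚ≥0) ≤ p := by exact_mod_cast hp.out.two_le
    have h1 : (1 : ℚ≥0) ≤ p := by exact_mod_cast hp.out.one_le
    have h0 : (0 : ℚ≥0) < p := lt_of_lt_of_le one_pos h1
    rw [Pi.add_apply, Pi.single_eq_same, AddSubmonoid.coe_add, Expo.coe_divP, Expo.coe_unit]
    have : (1 : ℚ≥0) / p ^ (n + 1) ≤ 1 / p := by
      apply one_div_le_one_div_of_le h0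
      exact le_self_pow₀ h1 (Nat.succ_ne_zero n)
    refine lt_of_le_of_lt (add_le_add_right this _) ?_
    rw [← add_div, div_lt_one h0]
    refine lt_of_lt_of_le (add_lt_add_left (h e) 1) ?_
    rwa [one_add_one_eq_two]
  · rw [Pi.add_apply, Pi.single_eq_of_ne he, add_zero]
    exact h.divP e

namespace BoxAlg

theorem mk_surjective : Function.Surjective (mk p B E) := Ideal.Quotient.mk_surjective

theorem mk_eq_mk {c c' : AddMonoidAlgebra B (E → Expo p)} :
    mk p B E c = mk p B E c' ↔ c - c' ∈ boxIdeal p B E := Ideal.Quotient.eq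

/-- The coefficients of an element. -/
def coef (q : E → Expo p) (s : BoxAlg p B E) : B := (mk_surjective s).choose.coeff q

theorem coef_mk {q : E → Expo p} (hq : InBox q) (c : AddMonoidAlgebra B (E → Expo p)) :
    coef q (mk p B E c) = c.coeff q := by
  have := mk_eq_mk.mp (mk_surjective (mk p B E c)).choose_spec q hq
  rwa [AddMonoidAlgebra.coeff_sub, Finsupp.sub_apply, sub_eq_zero] at this

theorem ext_coef {s t : BoxAlg p B E} (h : ∀ q, InBox q → coef q s = coef q t) : s = t := by
  obtain ⟨s, rfl⟩ := mk_surjective s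
  obtain ⟨t, rfl⟩ := mk_surjective t
  refine mk_eq_mk.mpr fun q hq => ?_
  rw [AddMonoidAlgebra.coeff_sub, Finsupp.sub_apply, sub_eq_zero, ← coef_mk hq, h q hq, coef_mk hq]

theorem coef_zero {q : E → Expo p} (hq : InBox q) : coef q (0 : BoxAlg p B E) = 0 := by
  rw [← map_zero (mk p B E), coef_mk hq]; rfl

theorem coef_add {q : E → Expo p} (hq : InBox q) (s t : BoxAlg p B E) :
    coef q (s + t) = coef q s + coef q t := by
  obtain ⟨s, rfl⟩ := mk_surjective s
  obtain ⟨t, rfl⟩ := mk_surjective t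
  rw [← map_add, coef_mk hq, coef_mk hq, coef_mk hq]; rfl

theorem coef_sub {q : E → Expo p} (hq : InBox q) (s t : BoxAlg p B E) :
    coef q (s - t) = coef q s - coef q t := by
  rw [eq_sub_iff_add_eq, ← coef_add hq, sub_add_cancel]

/-- The `p`-th power is additive, so monomials suffice; multiplication of exponents by `p` is
injective. -/
theorem coeff_pow (q : E → Expo p) (c : AddMonoidAlgebra B (E → Expo p)) :
    (c ^ p).coeff (p • q) = c.coeff q ^ p := by
  induction c using AddMonoidAlgebra.induction_linear with
  | zero => simp [hp.out.ne_zero]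
  | add a b ha hb =>
    rw [← frob_apply, map_add, frob_apply, frob_apply, AddMonoidAlgebra.coeff_add,
      Finsupp.add_apply, ha, hb, AddMonoidAlgebra.coeff_add, Finsupp.add_apply, ← frob_apply,
      ← frob_apply, ← frob_apply, map_add]
  | single r b =>
    classical
    rw [AddMonoidAlgebra.single_pow, AddMonoidAlgebra.coeff_single,
      AddMonoidAlgebra.coeff_single, Finsupp.single_apply, Finsupp.single_apply]
    have : p • r = p • q ↔ r = q :=
      ⟨fun h => funext fun e => Expo.nsmul_injective (congrFun h e), fun h => h ▸ rfl⟩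
    simp only [this]
    split_ifs
    · rfl
    · rw [zero_pow hp.out.ne_zero]

theorem coef_pow {q : E → Expo p} (hq : InBox q) (s : BoxAlg p B E) :
    coef q (s ^ p) = coef (fun e => Expo.divP (q e)) s ^ p := by
  obtain ⟨s, rfl⟩ := mk_surjective s
  rw [← map_pow, coef_mk hq, coef_mk hq.divP, ← coeff_pow]
  congr 1
  exact funext fun e => (Expo.nsmul_divP (q e)).symm

theorem coef_tilt {q : E → Expo p} (hq : InBox q) (a : tilt p (BoxAlg p B E)) (n : ℕ) :
    coef q (tilt.coeff n a) = coef (fun e => Expo.divP (q e)) (tilt.coeff (n + 1) a) ^ p := by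
  rw [← coef_pow hq, tilt.coeff_succ_pow]

variable (p B) in
open Classical in
/-- The generators, with their system of `p`-power roots. -/
def x (e : E) : tilt p (BoxAlg p B E) :=
  tilt.mk (fun n => mk p B E
    (AddMonoidAlgebra.single (Pi.single e (Expo.unit p n)) 1)) fun n => by
      rw [← map_pow, AddMonoidAlgebra.single_pow, one_pow, ← Pi.single_smul, Expo.nsmul_unit]

open Classical in
theorem coef_x_mul_add (j : E) (n : ℕ) (q : E → Expo p)
    (hq : InBox (q + Pi.single j (Expo.unit p n))) (s : BoxAlg p B E) :
    coef (q + Pi.single j (Expo.unit p n)) (tilt.coeff n (x p B j) * s) = coef q s := by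
  obtain ⟨s, rfl⟩ := mk_surjective s
  rw [x, tilt.coeff_mk, ← map_mul, coef_mk hq, coef_mk fun e => lt_of_le_of_lt le_self_add (hq e),
    AddMonoidAlgebra.coeff_single_mul_eq_mul_coeff q, one_mul]
  exact fun r _ => by rw [add_comm, add_left_inj]

theorem coef_x_mul_of_lt (j : E) (n : ℕ) {q : E → Expo p} (hq : InBox q)
    (h : q j < Expo.unit p n) (s : BoxAlg p B E) :
    coef q (tilt.coeff n (x p B j) * s) = 0 := by
  classical
  obtain ⟨s, rfl⟩ := mk_surjective s
  rw [x, tilt.coeff_mk, ← map_mul, coef_mk hq]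
  refine AddMonoidAlgebra.coeff_single_mul_of_forall_add_ne _ _ fun y hy => h.not_ge ?_
  rw [← hy, Pi.add_apply, Pi.single_eq_same]
  exact Subtype.coe_le_coe.mp le_self_add

theorem coeff_zero_x (e : E) : tilt.coeff 0 (x p B e) = 0 := by
  refine ext_coef fun q hq => ?_
  rw [← mul_one (tilt.coeff 0 _), coef_zero hq, coef_x_mul_of_lt e 0 hq]
  rw [← Subtype.coe_lt_coe, Expo.unit_zero]
  exact hq e

open Classical in
/-- Division by `x_j^{1/p^n}`, discarding remainders. -/
def shift (j : E) (n : ℕ) (s : BoxAlg p B E) : BoxAlg p B E :=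
  mk p B E (.ofCoeff ((mk_surjective s).choose.coeff.comapDomain
    (· + Pi.single j (Expo.unit p n)) (add_left_injective _).injOn))

open Classical in
theorem coef_shift (j : E) (n : ℕ) (q : E → Expo p) (hq : InBox q) (s : BoxAlg p B E) :
    coef q (shift j n s) = coef (q + Pi.single j (Expo.unit p n)) s := by
  rw [shift, coef_mk hq]; rfl

open Classical in
theorem coef_shift_pow (j : E) (n : ℕ) {q : E → Expo p} (hq : InBox q)
    (a : tilt p (BoxAlg p B E)) :
    coef q (shift j (n + 1) (tilt.coeff (n + 1) a) ^ p) =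
      coef ((fun e => Expo.divP (q e)) + Pi.single j (Expo.unit p (n + 1))) (tilt.coeff (n + 1) a)
        ^ p := by
  rw [coef_pow hq, coef_shift _ _ _ hq.divP]

/-- Division by `x_j`, discarding remainders. -/
def tiltShift (j : E) (a : tilt p (BoxAlg p B E)) : tilt p (BoxAlg p B E) :=
  -- Dividing the `n`-th term by `x_j^{1/p^n}` directly would lose the exponents that leave the unit
  -- box. Dividing the `(n+1)`-st term and taking the `p`-th power determines all coefficients in
  -- the box, by `InBox.divP_add`.
  tilt.mk (fun n => shift j (n + 1) (tilt.coeff (n + 1) a) ^ p) fun n => by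
    classical
    refine ext_coef fun q hq => ?_
    rw [coef_pow hq, coef_shift_pow _ _ hq.divP, coef_shift_pow _ _ hq,
      coef_tilt (hq.divP_add j n)]
    congr 3
    funext e
    by_cases he : e = j
    · subst he
      simp [Expo.divP_add, Expo.divP_unit]
    · simp [he]

/-- The remainder of the division by `x_j`: it keeps the monomials whose `j`-th exponent is too
small and discards the others. -/
theorem coef_sub_x_mul_tiltShift (j : E) (n : ℕ) {q : E → Expo p} (hq : InBox q)
    (a : tilt p (BoxAlg p B E)) : coef q (tilt.coeff n (a - x p B j * tiltShift j a)) =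
      if q j < Expo.unit p n then coef q (tilt.coeff n a) else 0 := by
  classical
  rw [map_sub, map_mul, coef_sub hq]
  split_ifs with h
  · rw [coef_x_mul_of_lt j n hq h, sub_zero]
  · obtain ⟨r, hr⟩ := Expo.exists_eq_add_unit (not_lt.mp h)
    obtain ⟨r', rfl⟩ : ∃ r' : E → Expo p, q = r' + Pi.single j (Expo.unit p n) := by
      refine ⟨Function.update q j r, funext fun e => ?_⟩
      by_cases he : e = j
      · subst he; simp [hr]
      · simp [he]
    rw [coef_x_mul_add _ _ _ hq, tiltShift, tilt.coeff_mk,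
      coef_shift_pow _ _ fun e => lt_of_le_of_lt le_self_add (hq e), coef_tilt hq, sub_eq_zero]
    congr 2
    funext e
    by_cases he : e = j
    · subst he
      simp [Expo.divP_add, Expo.divP_unit]
    · simp [he]

/-- At level `n` the generator `x_e` is `x_e^{1/p^n}`, so membership in the ideal generated by the
`x_e` with `e ∈ J` is a condition on monomials. Conversely, successive division by these generators
leaves remainder zero. -/
theorem exists_eq_sum_iff (J : Finset E) (a : tilt p (BoxAlg p B E)) :
    (∃ c : E → tilt p (BoxAlg p B E), a = ∑ e ∈ J, c e * x p B e) ↔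
      ∀ n (q : E → Expo p), InBox q → (∀ e ∈ J, q e < Expo.unit p n) →
        coef q (tilt.coeff n a) = 0 := by
  constructor
  · rintro ⟨c, rfl⟩ n q hq h
    induction J using Finset.cons_induction with
    | empty => rw [Finset.sum_empty, map_zero, coef_zero hq]
    | cons j J hj ih =>
      rw [Finset.sum_cons, map_add, coef_add hq, ih fun e he => h e (Finset.mem_cons_of_mem he),
        map_mul, mul_comm, coef_x_mul_of_lt j n hq (h j (Finset.mem_cons_self j J)), zero_add]
  · classical
    induction J using Finset.induction_on generalizing a with
    | empty =>
      intro h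
      refine ⟨0, ?_⟩
      rw [Finset.sum_empty]
      ext n
      refine ext_coef fun q hq => ?_
      rw [h n q hq (by simp), map_zero, coef_zero hq]
    | insert j J hj ih =>
      intro h
      obtain ⟨c, hc⟩ := ih (a - x p B j * tiltShift j a) fun n q hq hJ => by
        rw [coef_sub_x_mul_tiltShift j n hq]
        split_ifs with hj
        · exact h n q hq (by simpa using ⟨hj, hJ⟩)
        · rfl
      refine ⟨Function.update c j (tiltShift j a), ?_⟩
      rw [Finset.sum_insert hj, Function.update_self, ← sub_eq_iff_eq_add', mul_comm, hc]
      refine Finset.sum_congr rfl fun e he => ?_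
      rw [Function.update_of_ne (ne_of_mem_of_not_mem he hj)]

variable (E) in
-- By `exists_eq_sum_iff`, the coefficients at level `n` with all exponents below `1/p^n` have to
-- vanish. Their `p`-th powers are coefficients of the same kind at level `n - 1`, and at level `0`
-- the element is zero; injectivity of the Frobenius of `B` concludes.
theorem exists_eq_sum_x [PerfectRing B p] [Fintype E] (a : tilt p (BoxAlg p B E))
    (ha : tilt.coeff 0 a = 0) : ∃ c : E → tilt p (BoxAlg p B E), a = ∑ e, c e * x p B e := by
  have key (n : ℕ) : ∀ q : E → Expo p, InBox q → (∀ e, q e < Expo.unit p n) →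
      coef q (tilt.coeff n a) = 0 := by
    induction n with
    | zero => intro q hq _; rw [ha, coef_zero hq]
    | succ n ih =>
      intro q _ h
      have h' (e : E) : p • q e < Expo.unit p n := by
        rw [← Expo.nsmul_unit]
        have := h e
        rw [← Subtype.coe_lt_coe] at this ⊢
        rw [AddSubmonoidClass.coe_nsmul, AddSubmonoidClass.coe_nsmul]
        exact nsmul_lt_nsmul_right hp.out.ne_zero this
      have hq' : InBox (fun e => p • q e) := fun e => by
        refine lt_of_lt_of_le (Subtype.coe_lt_coe.mpr (h' e)) ?_
        rw [Expo.coe_unit]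
        refine div_le_one_of_le₀ ?_ zero_le
        exact one_le_pow₀ (by exact_mod_cast hp.out.one_le)
      have := ih _ hq' h'
      rw [coef_tilt hq'] at this
      simp only [Expo.divP_nsmul] at this
      have hF : Function.Bijective fun x : B => x ^ p := PerfectRing.bijective_frobenius
      exact hF.1 (this.trans (zero_pow hp.out.ne_zero).symm)
  exact (exists_eq_sum_iff Finset.univ a).mpr fun n q hq h => key n q hq fun e => h e (by simp)

/-- Multiplication by `x_j` shifts only the exponent in the coordinate `j`, which the criterion for
`J` ignores. One level is traded for room in the box. -/
theorem exists_eq_sum_of_mul_x {J : Finset E} {j : E} (hj : j ∉ J) {a : tilt p (BoxAlg p B E)}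
    {c : E → tilt p (BoxAlg p B E)} (h : a * x p B j = ∑ e ∈ J, c e * x p B e) :
    ∃ c' : E → tilt p (BoxAlg p B E), a = ∑ e ∈ J, c' e * x p B e := by
  classical
  refine (exists_eq_sum_iff J a).mpr fun n q hq hJ => ?_
  have := (exists_eq_sum_iff J _).mp ⟨c, h⟩ (n + 1) _ (hq.divP_add j n) fun e he => by
    rw [Pi.add_apply, Pi.single_eq_of_ne (ne_of_mem_of_not_mem he hj), add_zero,
      ← Expo.divP_unit]
    have := hJ e he
    rw [← Subtype.coe_lt_coe] at this ⊢
    rw [Expo.coe_divP, Expo.coe_divP]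
    exact div_lt_div_of_pos_right this (by exact_mod_cast hp.out.pos)
  rw [map_mul, mul_comm, coef_x_mul_add _ _ _ (hq.divP_add j n)] at this
  rw [coef_tilt hq, this, zero_pow hp.out.ne_zero]

section Lift

variable {T : Type u} [CommRing T] [Algebra (ZMod p) T]

/-- The power `a^q` with exponent `q` in `ℕ[1/p]`. -/
def rpow (a : tilt p T) (q : Expo p) : T :=
  tilt.coeff (Expo.exists_eq_nsmul_unit q).choose a ^ (Expo.exists_eq_nsmul_unit q).choose_spec.choose

theorem coeff_add_pow (a : tilt p T) (n k : ℕ) :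
    tilt.coeff (n + k) a ^ p ^ k = tilt.coeff n a := by
  induction k with
  | zero => simp
  | succ k ih => rw [pow_succ', pow_mul, ← add_assoc, tilt.coeff_succ_pow, ih]

/-- The value does not depend on how the exponent is written as a fraction: both expressions are
compared at the common level `n + n'`. -/
theorem rpow_nsmul_unit (a : tilt p T) (m n : ℕ) :
    rpow a (m • Expo.unit p n) = tilt.coeff n a ^ m := by
  set q := m • Expo.unit p n with hq
  have h := (Expo.exists_eq_nsmul_unit q).choose_spec.choose_spec
  rw [rpow]
  set n' := (Expo.exists_eq_nsmul_unit q).choose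
  set m' := (Expo.exists_eq_nsmul_unit q).choose_spec.choose
  have key : m * p ^ n' = m' * p ^ n := by
    have := congrArg (fun q : Expo p => (q : ℚ≥0)) (hq.symm.trans h)
    simp only [AddSubmonoidClass.coe_nsmul, Expo.coe_unit, nsmul_eq_mul] at this
    have hp0 := Expo.p_ne_zero (p := p)
    field_simp at this
    rw [mul_comm m']
    exact_mod_cast this
  rw [← coeff_add_pow a n n', ← coeff_add_pow a n' n, ← pow_mul, ← pow_mul, add_comm n' n,
    mul_comm, ← key, mul_comm]

theorem rpow_zero (a : tilt p T) : rpow a 0 = 1 := by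
  rw [← zero_nsmul (Expo.unit p 0), rpow_nsmul_unit, pow_zero]

theorem rpow_add (a : tilt p T) (q r : Expo p) : rpow a (q + r) = rpow a q * rpow a r := by
  obtain ⟨n, m, rfl⟩ := (Expo.exists_eq_nsmul_unit q)
  obtain ⟨n', m', rfl⟩ := (Expo.exists_eq_nsmul_unit r)
  have key (m n k : ℕ) : m • Expo.unit p n = (m * p ^ k) • Expo.unit p (n + k) := by
    induction k with
    | zero => simp
    | succ k ih => rw [pow_succ, ← mul_assoc, mul_nsmul', ← add_assoc, Expo.nsmul_unit, ← ih]
  rw [key m n n', key m' n' n, add_comm n' n, ← add_nsmul, rpow_nsmul_unit, rpow_nsmul_unit,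
    rpow_nsmul_unit, pow_add]

variable [Fintype E] (f : B →ₐ[ZMod p] T) (a : E → tilt p T)

/-- The map `x^q ↦ a^q` on the monoid algebra. -/
def liftAux : AddMonoidAlgebra B (E → Expo p) →ₐ[ZMod p] T :=
  letI := f.toRingHom.toAlgebra
  haveI : IsScalarTower (ZMod p) B T := .of_algebraMap_eq fun c => (f.commutes c).symm
  (AddMonoidAlgebra.lift B T (E → Expo p)
    { toFun := fun q => ∏ e, rpow (a e) (q.toAdd e)
      map_one' := Finset.prod_eq_one fun e _ => rpow_zero (a e)
      map_mul' := fun q r => by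
        rw [← Finset.prod_mul_distrib]
        exact Finset.prod_congr rfl fun e _ => rpow_add _ _ _ }).restrictScalars (ZMod p)

theorem liftAux_single (q : E → Expo p) (b : B) :
    liftAux f a (.single q b) = f b * ∏ e, rpow (a e) (q e) := by
  let _ := f.toRingHom.toAlgebra
  have : IsScalarTower (ZMod p) B T := .of_algebraMap_eq fun c => (f.commutes c).symm
  exact (AddMonoidAlgebra.lift_single _ _ _).trans (Algebra.smul_def _ _)

/-- A monomial outside the box has an exponent at least `1`, hence contains a full factor `a_e = 0`.
-/
theorem liftAux_eq_zero (ha : ∀ e, tilt.coeff 0 (a e) = 0) {c : AddMonoidAlgebra B (E → Expo p)}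
    (hc : c ∈ boxIdeal p B E) : liftAux f a c = 0 := by
  rw [← c.sum_coeff_single, Finsupp.sum, map_sum]
  refine Finset.sum_eq_zero fun q hq => ?_
  rw [liftAux_single]
  have : ¬ InBox q := fun h => Finsupp.mem_support_iff.mp hq (hc q h)
  simp only [InBox, not_forall, not_lt] at this
  obtain ⟨e, he⟩ := this
  rw [← Expo.unit_zero (p := p)] at he
  obtain ⟨r, hr⟩ := Expo.exists_eq_add_unit he
  rw [Finset.prod_eq_zero (Finset.mem_univ e), mul_zero]
  rw [hr, rpow_add, ← one_nsmul (Expo.unit p 0), rpow_nsmul_unit, ha, zero_pow one_ne_zero,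
    mul_zero]

variable (p B) in
/-- The structure map. -/
def incl : B →ₐ[ZMod p] BoxAlg p B E :=
  (mk p B E).comp ((AddMonoidAlgebra.singleZeroAlgHom (R := B) (A := B)).restrictScalars (ZMod p))

variable (p B E) in
theorem isUniv : IsUniv (incl p B : B →ₐ[ZMod p] BoxAlg p B E) (x p B) where
  coeff_zero := coeff_zero_x
  exists_lift f a ha := by
    classical
    refine ⟨Ideal.Quotient.liftₐ (boxIdeal p B E) (liftAux f a) fun c => liftAux_eq_zero f a ha,
      AlgHom.ext fun b => ?_, fun e => ?_⟩
    · refine (liftAux_single f a 0 b).trans ?_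
      simp [rpow_zero]
    · ext n
      refine (liftAux_single f a _ 1).trans ?_
      rw [map_one, one_mul, Finset.prod_eq_single e]
      · rw [Pi.single_eq_same, ← one_nsmul (Expo.unit p n), rpow_nsmul_unit, pow_one]
      · intro e' _ he'
        rw [Pi.single_eq_of_ne he', rpow_zero]
      · simp
  hom_ext {T _ _ g h} h₁ h₂ := by
    classical
    refine AlgHom.ext fun s => ?_
    obtain ⟨c, rfl⟩ := mk_surjective s
    induction c using AddMonoidAlgebra.induction_linear with
    | zero => simp
    | add a b ha hb => rw [map_add, map_add, map_add, ha, hb]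
    | single q b =>
      have h₃ : (AddMonoidAlgebra.single q b : AddMonoidAlgebra B (E → Expo p)) =
          .single 0 b * ∏ e, .single (Pi.single e (q e)) 1 := by
        rw [AddMonoidAlgebra.prod_single, AddMonoidAlgebra.single_mul_single, zero_add,
          Finset.univ_sum_single, Finset.prod_const_one, mul_one]
      rw [h₃, map_mul, map_mul, map_mul, map_prod, map_prod, map_prod]
      congr 1
      · exact DFunLike.congr_fun h₁ b
      · refine Finset.prod_congr rfl fun e _ => ?_
        obtain ⟨n, m, hq⟩ := (Expo.exists_eq_nsmul_unit (q e))
        have : (AddMonoidAlgebra.single (Pi.single e (q e)) 1 : AddMonoidAlgebra B (E → Expo p)) =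
            .single (Pi.single e (Expo.unit p n)) 1 ^ m := by
          rw [AddMonoidAlgebra.single_pow, one_pow, ← Pi.single_smul, hq]
        rw [this, map_pow, map_pow, map_pow]
        exact congrArg (· ^ m) (congrArg (tilt.coeff n) (h₂ e))

end Lift

end BoxAlg

namespace IsUniv

variable {S : Type u} [CommRing S] [Algebra (ZMod p) S] {φ : B →ₐ[ZMod p] S} {x : E → tilt p S}

/-- The comparison with the model. -/
theorem exists_equiv [Fintype E] (hU : IsUniv φ x) : ∃ g : BoxAlg p B E ≃ₐ[ZMod p] S,
    ∀ e, tilt.map (g : BoxAlg p B E →ₐ[ZMod p] S) (BoxAlg.x p B e) = x e := by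
  have hU' := BoxAlg.isUniv p B E
  obtain ⟨g, hg, hg'⟩ := hU'.exists_lift φ x hU.coeff_zero
  obtain ⟨h, hh, hh'⟩ := hU.exists_lift _ _ hU'.coeff_zero
  refine ⟨.ofAlgHom g h ?_ ?_, hg'⟩
  · refine hU.hom_ext ?_ fun e => ?_
    · rw [AlgHom.comp_assoc, hh, hg]; rfl
    · rw [tilt.map_comp, hh', hg']; rfl
  · refine hU'.hom_ext ?_ fun e => ?_
    · rw [AlgHom.comp_assoc, hg, hh]; rfl
    · rw [tilt.map_comp, hg', hh']; rfl

theorem exists_eq_sum [PerfectRing B p] [Fintype E] (hU : IsUniv φ x) (a : tilt p S)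
    (ha : tilt.coeff 0 a = 0) : ∃ c : E → tilt p S, a = ∑ e, c e * x e := by
  obtain ⟨g, hg⟩ := hU.exists_equiv
  obtain ⟨c, hc⟩ := BoxAlg.exists_eq_sum_x E
    (tilt.map (g.symm : S →ₐ[ZMod p] BoxAlg p B E) a) (by simp [ha])
  refine ⟨fun e => tilt.map (g : BoxAlg p B E →ₐ[ZMod p] S) (c e), ?_⟩
  simp only [← hg, ← map_mul]
  rw [← map_sum, ← hc]
  ext n
  simp

/-- The generators form a regular sequence in the tilt, in every order; finiteness of `E` enters
through the comparison with the model. -/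
theorem regular [Fintype E] (hU : IsUniv φ x) {J : Finset E} {j : E} (hj : j ∉ J)
    {a : tilt p S} {c : E → tilt p S} (h : a * x j = ∑ e ∈ J, c e * x e) :
    ∃ c' : E → tilt p S, a = ∑ e ∈ J, c' e * x e := by
  obtain ⟨g, hg⟩ := hU.exists_equiv
  let g' := tilt.map (p := p) (g.symm : S →ₐ[ZMod p] BoxAlg p B E)
  have hg' (e : E) : g' (x e) = BoxAlg.x p B e := by
    rw [← hg]; ext n; simp [g']
  obtain ⟨c', hc'⟩ := BoxAlg.exists_eq_sum_of_mul_x hj (a := g' a) (c := fun e => g' (c e)) (by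
    rw [← hg', ← map_mul, h, map_sum]
    exact Finset.sum_congr rfl fun e _ => by rw [map_mul, hg'])
  refine ⟨fun e => tilt.map (g : BoxAlg p B E →ₐ[ZMod p] S) (c' e), ?_⟩
  simp only [← hg, ← map_mul]
  rw [← map_sum, ← hc']
  ext n
  simp [g']

end IsUniv

end

end Unwinding

/-! ### Points of enveloping algebras -/

namespace Unwinding

noncomputable section

variable {p : ℕ} [hp : Fact p.Prime]

theorem tilt.coeff_coeff_ofPerfect {R : Type*} [CommRing R] [Algebra (ZMod p) R] (a : tilt p R)
    (m n : ℕ) : tilt.coeff m (tilt.coeff n (tilt.ofPerfect (p := p) (tilt p R) a)) =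
      tilt.coeff (m + n) a := by
  induction n generalizing m with
  | zero => simp
  | succ n ih =>
    rw [← tilt.coeff_succ_pow m, ← map_pow, tilt.coeff_succ_pow, ih, Nat.add_right_comm, add_assoc]

theorem tilt.coeff_pow_pow {R : Type*} [CommRing R] [Algebra (ZMod p) R] (a : tilt p R)
    (n k : ℕ) : tilt.coeff (n + k) a ^ p ^ k = tilt.coeff n a := by
  induction k with
  | zero => simp
  | succ k ih => rw [pow_succ', pow_mul, ← add_assoc, tilt.coeff_succ_pow, ih]

theorem exists_eq_pow_pow {B : Type*} [CommRing B] [Algebra (ZMod p) B] [PerfectRing B p] (b : B)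
    (n : ℕ) : ∃ c, b = c ^ p ^ n := by
  refine ⟨tilt.coeff n (tilt.ofPerfect (p := p) B b), ?_⟩
  have := tilt.coeff_pow_pow (tilt.ofPerfect (p := p) B b) 0 n
  rw [zero_add] at this
  rw [this, tilt.coeff_zero_ofPerfect]

theorem sum_pow_pow {R ι : Type*} [CommRing R] [Algebra (ZMod p) R] (s : Finset ι) (f : ι → R)
    (n : ℕ) : (∑ i ∈ s, f i) ^ p ^ n = ∑ i ∈ s, f i ^ p ^ n := by
  induction n with
  | zero => simp
  | succ n ih =>
    rw [pow_succ, pow_mul, ih, ← frob_apply, map_sum]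
    exact Finset.sum_congr rfl fun i _ => by rw [frob_apply, pow_mul]

section

variable {X : PointedModule.{u} p} {B : Type u} [CommRing B] [Algebra (ZMod p) B]
  [PerfectRing B p] {I : Ideal B} {T T' : CommAlgCat.{u} (ZMod p)} {f : B →ₐ[ZMod p] T}
  {φ : I → (X.Γ ⟶ T)}

theorem IsPointedLinear.comp (hφ : IsPointedLinear X I f φ) (h : T ⟶ T') :
    IsPointedLinear X I (h.hom.comp f) (fun i => φ i ≫ h) where
  map_add i j := by rw [hφ.map_add, X.add_comp]
  map_smul b i := by rw [hφ.map_smul, X.smul_comp, tilt.map_comp]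
  map_d i := by rw [X.d_comp, hφ.map_d, tilt.map_comp]

theorem IsPointedLinear.map_sum {E : Type*} [Fintype E] (hφ : IsPointedLinear X I f φ) (i : I)
    (c : E → B) (x : E → I) (hi : (i : B) = ∑ e, c e * x e) :
    φ i = ∑ e, tilt.map f (tilt.ofPerfect B (c e)) • φ (x e) := by
  have hi : i = ∑ e, c e • x e := by
    ext1
    rw [hi, AddSubmonoidClass.coe_finsetSum]
    rfl
  change AddMonoidHom.mk' φ hφ.map_add i = _
  rw [hi, _root_.map_sum]
  exact Finset.sum_congr rfl fun e _ => hφ.map_smul _ _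

end

namespace IsUniv

variable {B S : CommAlgCat.{u} (ZMod p)} {E : Type u} [Fintype E] [PerfectRing B p]
  {φ : B ⟶ S} {x : E → tilt p S} (hU : IsUniv φ.hom x)

include hU

/-- The `M`-th coordinate of an element is the zeroth coordinate of its `p^M`-th root, so the kernel
is that of `coeff 0` with all generators raised to the power `p^M`. -/
theorem exists_eq_sum_pow {M : ℕ} {a : tilt p S} (ha : tilt.coeff M a = 0) :
    ∃ c : E → tilt p S, a = ∑ e, c e * x e ^ p ^ M := by
  obtain ⟨b, rfl⟩ := exists_eq_pow_pow (p := p) a M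
  have := tilt.coeff_pow_pow b 0 M
  rw [zero_add, ← map_pow, ha] at this
  obtain ⟨c, rfl⟩ := hU.exists_eq_sum b this.symm
  exact ⟨fun e => c e ^ p ^ M, by simp only [sum_pow_pow, mul_pow]⟩

/-- Homomorphisms out of the tilt for which the images of the generators are nilpotent are
determined by their values on the base and on the roots of the generators. -/
theorem tilt_hom_ext {T : CommAlgCat.{u} (ZMod p)} {f g : tilt p S →ₐ[ZMod p] T}
    (hx : ∀ e, IsNilpotent (f (x e)))
    (h₁ : ∀ b, f (tilt.map φ.hom (tilt.ofPerfect B b)) = g (tilt.map φ.hom (tilt.ofPerfect B b)))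
    (h₂ : ∀ e, tilt.map f (tilt.ofPerfect (tilt p S) (x e)) =
      tilt.map g (tilt.ofPerfect (tilt p S) (x e))) : f = g := by
  have h₂' (e : E) (n : ℕ) := congrArg (tilt.coeff n) (h₂ e)
  simp only [tilt.coeff_map] at h₂'
  have hxg (e : E) : f (x e) = g (x e) := by simpa using h₂' e 0
  obtain ⟨M, hM⟩ : ∃ M, ∀ e, f (x e) ^ p ^ M = 0 := by
    choose N hN using hx
    refine ⟨∑ e, N e, fun e => ?_⟩
    refine pow_eq_zero_of_le ?_ (hN e)
    exact (Finset.single_le_sum (fun _ _ => Nat.zero_le _) (Finset.mem_univ e)).trans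
      (Nat.lt_pow_self hp.out.one_lt).le
  -- The image of the equalizer under the `M`-th coordinate is all of `S`: it contains the base and
  -- the roots of the generators, reached as `p^M`-th powers in the tilt. The kernel of that
  -- coordinate is generated by `x_e^{p^M}`, on which both maps vanish.
  have htop := hU.eq_top ((AlgHom.equalizer f g).map (tilt.coeff M))
    (fun b => ⟨tilt.map φ.hom (tilt.ofPerfect B b) ^ p ^ M, ?_, ?_⟩)
    (fun e n => ⟨tilt.coeff n (tilt.ofPerfect (p := p) (tilt p S) (x e)) ^ p ^ M, ?_, ?_⟩)
  · refine AlgHom.ext fun a => ?_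
    obtain ⟨a', ha', h⟩ := htop.ge (Algebra.mem_top (x := tilt.coeff M a))
    have h0 : tilt.coeff M (a - a') = 0 := by
      rw [map_sub, sub_eq_zero]; exact h.symm
    obtain ⟨c, hc⟩ := hU.exists_eq_sum_pow h0
    obtain rfl : a = (∑ e, c e * x e ^ p ^ M) + a' := by rw [← hc, sub_add_cancel]
    have ha'' : f a' = g a' := ha'
    rw [map_add, map_add, ha'', map_sum, map_sum]
    congr 1
    refine Finset.sum_congr rfl fun e _ => ?_
    rw [map_mul, map_mul, map_pow, map_pow, ← hxg, hM, mul_zero, mul_zero]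
  · change f _ = g _
    rw [map_pow, map_pow, h₁]
  · have := tilt.coeff_pow_pow (tilt.map φ.hom (tilt.ofPerfect (p := p) B b)) 0 M
    rw [zero_add] at this
    simpa using this
  · change f _ = g _
    rw [map_pow, map_pow, h₂']
  · have := tilt.coeff_pow_pow (x e) n M
    simpa [tilt.coeff_coeff_ofPerfect, add_comm] using this

variable {X : PointedModule.{u} p}

/-- The values of the universal map at the generators. -/
def gen (X : PointedModule.{u} p) (e : E) : X.Γ ⟶ Env X (tiltKer p S) :=
  Env.univ X (tiltKer p S) ⟨x e, hU.coeff_zero e⟩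

omit [PerfectRing B p] in
theorem univ_eq_sum (i : tiltKer p S) (c : E → tilt p S) (hc : (i : tilt p S) = ∑ e, c e * x e)
    {T : CommAlgCat.{u} (ZMod p)} (F : Env X (tiltKer p S) ⟶ T) :
    Env.univ X (tiltKer p S) i ≫ F =
      ∑ e, tilt.map (F.hom.comp (Env.incl X (tiltKer p S)))
        (tilt.ofPerfect (tilt p S) (c e)) • (hU.gen X e ≫ F) := by
  have h := (Env.isPointedLinear_univ X (tiltKer p S)).comp F
  exact h.map_sum _ c (fun e => ⟨x e, hU.coeff_zero e⟩) hc

/-- The values at the generators determine the map on the tilt through `d`, by nilpotency of `t`;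
they then determine the universal map, since the generators span the kernel. -/
theorem env_hom_ext (hX : IsNilpotent X.t) {T : CommAlgCat.{u} (ZMod p)}
    {F G : Env X (tiltKer p S) ⟶ T}
    (h₁ : ∀ b, F.hom (Env.incl X _ (tilt.map φ.hom (tilt.ofPerfect B b))) =
      G.hom (Env.incl X _ (tilt.map φ.hom (tilt.ofPerfect B b))))
    (h₂ : ∀ e, hU.gen X e ≫ F = hU.gen X e ≫ G) : F = G := by
  have hd (F : Env X (tiltKer p S) ⟶ T) (e : E) :
      tilt.map (F.hom.comp (Env.incl X (tiltKer p S))) (tilt.ofPerfect (tilt p S) (x e)) =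
        X.d T (hU.gen X e ≫ F) := by
    rw [X.d_comp, gen, (Env.isPointedLinear_univ X (tiltKer p S)).map_d, tilt.map_comp]
  have key : F.hom.comp (Env.incl X (tiltKer p S)) = G.hom.comp (Env.incl X (tiltKer p S)) := by
    refine hU.tilt_hom_ext (fun e => ?_) h₁ fun e => ?_
    · have h0 : F.hom.comp (Env.incl X (tiltKer p S)) (x e) = (hU.gen X e ≫ F).hom X.t := by
        have := congrArg (tilt.coeff 0) (hd F e)
        rw [tilt.coeff_map, tilt.coeff_zero_ofPerfect] at this
        rw [this, PointedModule.t, ← tilt.coeff_map, ← X.d_comp, Category.id_comp]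
      rw [h0]
      exact hX.map _
    · rw [hd, hd, h₂]
  refine Env.hom_ext (fun b => DFunLike.congr_fun key b) fun i => ?_
  obtain ⟨c, hc⟩ := hU.exists_eq_sum i i.2
  rw [hU.univ_eq_sum i c hc, hU.univ_eq_sum i c hc, key]
  simp only [h₂]

section Existence

omit [PerfectRing B p] in
-- By regularity the last coefficient is `c_j = ∑ c'_e x_e`, and the quasi-ideal identity rewrites
-- `c'_e d(y_e) y_j` as `c'_e d(y_j) y_e`. This moves the last term into the others, and induction
-- applies to the coefficients `c_e + c'_e x_j`.
theorem sum_smul_eq_zero (hX : X.IsQuasiIdeal) {T : CommAlgCat.{u} (ZMod p)}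
    (ψ : tilt p S →ₐ[ZMod p] T) (y : E → (X.Γ ⟶ T))
    (hy : ∀ e, X.d T (y e) = tilt.map ψ (tilt.ofPerfect (tilt p S) (x e))) (J : Finset E)
    (c : E → tilt p S) (hc : ∑ e ∈ J, c e * x e = 0) :
    ∑ e ∈ J, tilt.map ψ (tilt.ofPerfect (tilt p S) (c e)) • y e = 0 := by
  induction J using Finset.cons_induction generalizing c with
  | empty => rfl
  | cons j J hj ih =>
    rw [Finset.sum_cons] at hc
    obtain ⟨c', hc'⟩ := hU.regular hj (a := c j) (c := fun e => - c e) ((eq_neg_of_add_eq_zero_left hc).trans (by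
        rw [← Finset.sum_neg_distrib]
        exact Finset.sum_congr rfl fun e _ => by ring))
    have h := ih (fun e => c e + c' e * x j) (by
      have : ∑ e ∈ J, c' e * x j * x e = c j * x j := by
        rw [hc', Finset.sum_mul]
        exact Finset.sum_congr rfl fun e _ => by ring
      simp only [add_mul, Finset.sum_add_distrib]
      rw [this, add_comm, hc])
    rw [Finset.sum_cons, ← h]
    simp only [map_add, map_mul, add_smul, Finset.sum_add_distrib]
    rw [add_comm]
    congr 1
    rw [hc', map_sum, map_sum, Finset.sum_smul]
    refine Finset.sum_congr rfl fun e _ => ?_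
    rw [map_mul, map_mul, mul_smul, mul_smul, ← hy, ← hy, hX]

/-- Together with `env_hom_ext` this says that the enveloping algebra is `B ⊗ Γ(X)^{⊗ E}`. -/
theorem exists_env_hom (hX : X.IsNilpotentQuasiIdeal) {T : CommAlgCat.{u} (ZMod p)} (f : B ⟶ T)
    (y : E → (X.Γ ⟶ T)) : ∃ F : Env X (tiltKer p S) ⟶ T,
      (∀ b, F.hom (Env.incl X _ (tilt.map φ.hom (tilt.ofPerfect B b))) = f.hom b) ∧
      ∀ e, hU.gen X e ≫ F = y e := by
  obtain ⟨M, hM⟩ : ∃ M, X.t ^ p ^ M = 0 := by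
    obtain ⟨N, hN⟩ := hX.2
    exact ⟨N, pow_eq_zero_of_le (Nat.lt_pow_self hp.out.one_lt).le hN⟩
  have ht (e : E) : tilt.coeff 0 (X.d T (y e)) = (y e).hom X.t := by
    rw [PointedModule.t, ← tilt.coeff_map, ← X.d_comp, Category.id_comp]
  -- The element `d(y_e)` need not vanish in `T`, but its `p^M`-th power does, so `S` maps to `T`
  -- after a twist by the `M`-th power of the Frobenius. Composing with the `M`-th coordinate of the
  -- tilt undoes the twist.
  obtain ⟨h, hh, hh'⟩ := hU.exists_lift ((frob p T ^ M).comp f.hom)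
    (fun e => X.d T (y e) ^ p ^ M) fun e => by rw [map_pow, ht, ← map_pow, hM, map_zero]
  have hfrob (k : ℕ) (z : T) : (frob p T ^ k) z = z ^ p ^ k := by
    induction k with
    | zero => simp
    | succ k ih => rw [pow_succ', AlgHom.mul_apply, ih, frob_apply, pow_succ, pow_mul]
  let ψ : tilt p S →ₐ[ZMod p] T := h.comp (tilt.coeff M)
  have hψ (b : B) : ψ (tilt.map φ.hom (tilt.ofPerfect B b)) = f.hom b := by
    obtain ⟨c, rfl⟩ := exists_eq_pow_pow (p := p) b M
    have := tilt.coeff_pow_pow (tilt.ofPerfect (p := p) B c) 0 M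
    rw [zero_add, tilt.coeff_zero_ofPerfect, ← map_pow, ← map_pow] at this
    change h (φ.hom (tilt.coeff M (tilt.ofPerfect B _))) = _
    rw [this]
    refine (DFunLike.congr_fun hh c).trans ?_
    rw [AlgHom.comp_apply, hfrob, map_pow]
  have hy (e : E) : X.d T (y e) = tilt.map ψ (tilt.ofPerfect (tilt p S) (x e)) := by
    ext n
    have := congrArg (tilt.coeff (M + n)) (hh' e)
    rw [tilt.coeff_map] at this
    change _ = h (tilt.coeff M (tilt.coeff n (tilt.ofPerfect (p := p) (tilt p S) (x e))))
    rw [tilt.coeff_coeff_ofPerfect, this, map_pow, add_comm, tilt.coeff_pow_pow]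
  -- The value `∑ c_e y_e` on `∑ c_e x_e` does not depend on the coefficients, by
  -- `sum_smul_eq_zero`.
  have hΦ (i : tiltKer p S) : ∃ z : X.Γ ⟶ T, ∀ c : E → tilt p S, (i : tilt p S) = ∑ e, c e * x e →
      z = ∑ e, tilt.map ψ (tilt.ofPerfect (tilt p S) (c e)) • y e := by
    obtain ⟨c, hc⟩ := hU.exists_eq_sum i i.2
    refine ⟨∑ e, tilt.map ψ (tilt.ofPerfect (tilt p S) (c e)) • y e, fun c' hc' => ?_⟩
    · have := hU.sum_smul_eq_zero hX.1 ψ y hy Finset.univ (fun e => c e - c' e) (by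
        simp only [sub_mul, Finset.sum_sub_distrib]
        rw [← hc, ← hc', sub_self])
      simpa only [map_sub, sub_smul, Finset.sum_sub_distrib, sub_eq_zero] using this
  choose Φ hΦ using hΦ
  have hlin : IsPointedLinear X (tiltKer p S) ψ Φ :=
    { map_add := fun i j => by
        obtain ⟨c, hc⟩ := hU.exists_eq_sum i i.2
        obtain ⟨c', hc'⟩ := hU.exists_eq_sum j j.2
        rw [hΦ i c hc, hΦ j c' hc', hΦ (i + j) (fun e => c e + c' e) ?_]
        · simp only [map_add, add_smul, Finset.sum_add_distrib]
        · simp only [add_mul, Finset.sum_add_distrib, ← hc, ← hc']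
          rfl
      map_smul := fun b i => by
        obtain ⟨c, hc⟩ := hU.exists_eq_sum i i.2
        rw [hΦ i c hc, hΦ _ (fun e => b * c e) ?_]
        · simp only [map_mul, mul_smul, Finset.smul_sum]
        · simp only [mul_assoc, ← Finset.mul_sum, ← hc]
          rfl
      map_d := fun i => by
        obtain ⟨c, hc⟩ := hU.exists_eq_sum i i.2
        rw [hΦ i c hc, hc]
        simp only [map_sum, map_smul, map_mul, hy, smul_eq_mul] }
  refine ⟨Env.lift ψ Φ hlin, fun b => (Env.lift_incl ψ Φ hlin _).trans (hψ b), fun e => ?_⟩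
  classical
  rw [gen, Env.univ_lift, hΦ _ (Pi.single e 1) ?_, Finset.sum_eq_single e]
  · rw [Pi.single_eq_same, map_one, map_one, one_smul]
  · intro e' _ he'
    rw [Pi.single_eq_of_ne he', map_zero, map_zero, zero_smul]
  · simp
  · rw [Finset.sum_eq_single e]
    · simp
    · intro e' _ he'
      rw [Pi.single_eq_of_ne he', zero_mul]
    · simp

end Existence

end IsUniv

end

end Unwinding

/-! ### The tensor conditions for unwindings -/

namespace Unwinding

noncomputable section

variable {p : ℕ} [hp : Fact p.Prime]

/-- The map of enveloping algebras induced by an algebra map. -/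
def envMap (X : PointedModule.{u} p) {S S' : CommAlgCat.{u} (ZMod p)} (f : S ⟶ S') :
    Env X (tiltKer p S) ⟶ Env X (tiltKer p S') :=
  Env.map (𝟙 X) (tilt.map f.hom) (map_mem_tiltKer f)

section

variable (X : PointedModule.{u} p) {S S' S'' : CommAlgCat.{u} (ZMod p)}

theorem envMap_incl (f : S ⟶ S') (a : tilt p S) :
    (envMap X f).hom (Env.incl X _ a) = Env.incl X _ (tilt.map f.hom a) :=
  Env.map_incl ..

theorem univ_envMap (f : S ⟶ S') (i : tiltKer p S) :
    Env.univ X _ i ≫ envMap X f = Env.univ X _ ⟨tilt.map f.hom i, map_mem_tiltKer f i⟩ :=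
  (Env.univ_map ..).trans (Category.id_comp _)

theorem envMap_comp (f : S ⟶ S') (g : S' ⟶ S'') : envMap X f ≫ envMap X g = envMap X (f ≫ g) :=
  Env.hom_ext (fun b => by
    rw [CommAlgCat.hom_comp, AlgHom.comp_apply, envMap_incl, envMap_incl, envMap_incl]; rfl)
    fun i => by rw [← Category.assoc, univ_envMap, univ_envMap, univ_envMap]; rfl

end

theorem IsUniv.reindex {B S E E' : Type u} [CommRing B] [Algebra (ZMod p) B] [CommRing S]
    [Algebra (ZMod p) S] {φ : B →ₐ[ZMod p] S} {x : E → tilt p S} (hU : IsUniv φ x) (ε : E' ≃ E) :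
    IsUniv φ (fun e => x (ε e)) where
  coeff_zero e := hU.coeff_zero _
  exists_lift f a ha := by
    obtain ⟨g, hg, hg'⟩ := hU.exists_lift f (fun e => a (ε.symm e)) fun e => ha _
    exact ⟨g, hg, fun e => by rw [hg', ε.symm_apply_apply]⟩
  hom_ext h₁ h₂ := hU.hom_ext h₁ fun e => by simpa using h₂ (ε.symm e)

/-- Both sides classify a map from the base together with one point of `X` for each generator. The
hypotheses say that the generators of `S''` are those of `S` and of `S'`. -/
theorem isPushout_envMap {X : PointedModule.{u} p} (hX : X.IsNilpotentQuasiIdeal)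
    {B B' S S' S'' : CommAlgCat.{u} (ZMod p)} {E E' : Type u} [Fintype E] [Fintype E']
    [PerfectRing B p] [PerfectRing B' p] {φ : B ⟶ S} {x : E → tilt p S} (hU : IsUniv φ.hom x)
    {φ' : B' ⟶ S'} {x' : E' → tilt p S'} (hU' : IsUniv φ'.hom x') {φ'' : B' ⟶ S''}
    {x'' : E ⊕ E' → tilt p S''} (hU'' : IsUniv φ''.hom x'') {g : B ⟶ B'} {b : B ⟶ S'}
    {i : S ⟶ S''} {j : S' ⟶ S''} (hb : b = g ≫ φ') (hj : φ' ≫ j = φ'') (w : φ ≫ i = b ≫ j)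
    (hxi : ∀ e, x'' (Sum.inl e) = tilt.map i.hom (x e))
    (hxj : ∀ e, x'' (Sum.inr e) = tilt.map j.hom (x' e)) :
    IsPushout (envMap X φ) (envMap X b) (envMap X i) (envMap X j) := by
  have hgi (e : E) : hU.gen X e ≫ envMap X i = hU''.gen X (Sum.inl e) := by
    rw [IsUniv.gen, univ_envMap, IsUniv.gen]
    simp only [hxi]
  have hgj (e : E') : hU'.gen X e ≫ envMap X j = hU''.gen X (Sum.inr e) := by
    rw [IsUniv.gen, univ_envMap, IsUniv.gen]
    simp only [hxj]
  have hij (c : B) : tilt.map i.hom (tilt.map φ.hom (tilt.ofPerfect B c)) =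
      tilt.map φ''.hom (tilt.ofPerfect B' (g.hom c)) := by
    have : i.hom.comp φ.hom = φ''.hom.comp g.hom := by
      rw [← CommAlgCat.hom_comp, w, hb, Category.assoc, hj, CommAlgCat.hom_comp]
    rw [← tilt.map_comp, this, tilt.map_comp, tilt.map_ofPerfect]
  have hb' (c : B) : tilt.map b.hom (tilt.ofPerfect B c) =
      tilt.map φ'.hom (tilt.ofPerfect B' (g.hom c)) := by
    rw [hb, CommAlgCat.hom_comp, tilt.map_comp, tilt.map_ofPerfect]
  have hjj (c : B') : tilt.map j.hom (tilt.map φ'.hom (tilt.ofPerfect B' c)) =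
      tilt.map φ''.hom (tilt.ofPerfect B' c) := by
    rw [← tilt.map_comp, ← CommAlgCat.hom_comp, hj]
  have hw : envMap X φ ≫ envMap X i = envMap X b ≫ envMap X j := by
    rw [envMap_comp, envMap_comp, w]
  refine ⟨⟨hw⟩, ⟨Limits.PushoutCocone.IsColimit.mk hw (fun s => ?_) (fun s => ?_) (fun s => ?_)
    (fun s m hm hm' => ?_)⟩⟩
  · exact (hU''.exists_env_hom hX
      (CommAlgCat.ofHom ((s.inr.hom.comp (Env.incl X _)).comp
        ((tilt.map φ'.hom).comp (tilt.ofPerfect B').toAlgHom)))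
      (Sum.elim (fun e => hU.gen X e ≫ s.inl) (fun e => hU'.gen X e ≫ s.inr))).choose
  all_goals
    obtain ⟨h₁, h₂⟩ := (hU''.exists_env_hom hX
      (CommAlgCat.ofHom ((s.inr.hom.comp (Env.incl X _)).comp
        ((tilt.map φ'.hom).comp (tilt.ofPerfect B').toAlgHom)))
      (Sum.elim (fun e => hU.gen X e ≫ s.inl) (fun e => hU'.gen X e ≫ s.inr))).choose_spec
  · refine hU.env_hom_ext hX.2 (fun c => ?_) fun e => ?_
    · rw [CommAlgCat.hom_comp, AlgHom.comp_apply, envMap_incl, hij, h₁]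
      have := congrArg (fun f => f.hom (Env.incl X _ (tilt.ofPerfect B c))) s.condition
      simp only [CommAlgCat.hom_comp, AlgHom.comp_apply] at this
      rw [envMap_incl, envMap_incl, hb'] at this
      exact this.symm
    · rw [← Category.assoc, hgi, h₂]
      rfl
  · refine hU'.env_hom_ext hX.2 (fun c => ?_) fun e => ?_
    · rw [CommAlgCat.hom_comp, AlgHom.comp_apply, envMap_incl, hjj, h₁]
      rfl
    · rw [← Category.assoc, hgj, h₂]
      rfl
  · refine hU''.env_hom_ext hX.2 (fun c => ?_) fun e => ?_
    · rw [h₁, ← hjj, ← envMap_incl, ← AlgHom.comp_apply, ← CommAlgCat.hom_comp, hm']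
      rfl
    · rw [h₂]
      obtain e | e := e
      · rw [← hgi, Category.assoc, hm]
        rfl
      · rw [← hgj, Category.assoc, hm']
        rfl

/-- A perfect ring is the case with no generators. -/
theorem isIso_incl_of_perfect {X : PointedModule.{u} p} (hX : X.IsNilpotentQuasiIdeal)
    (B : CommAlgCat.{u} (ZMod p)) [PerfectRing B p] :
    IsIso (CommAlgCat.ofHom (Env.incl X (tiltKer p B))) := by
  have hU : IsUniv (CommAlgCat.Hom.hom (𝟙 B)) (PEmpty.elim : PEmpty.{u + 1} → tilt p B) :=
    IsUniv.of_id B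
  obtain ⟨F, hF, -⟩ := hU.exists_env_hom hX
    (CommAlgCat.ofHom (tilt.ofPerfect B).toAlgHom : B ⟶ CommAlgCat.of (ZMod p) (tilt p B))
    fun e => e.elim
  have hF (a : tilt p B) : F.hom (Env.incl X _ a) = a := by
    obtain ⟨b, rfl⟩ := (tilt.ofPerfect B).surjective a
    exact hF b
  refine ⟨F, CommAlgCat.hom_ext (AlgHom.ext hF), hU.env_hom_ext hX.2 (fun b => ?_) fun e => e.elim⟩
  exact congrArg (Env.incl X _) (hF _)

section Models

variable (B : CommAlgCat.{u} (ZMod p))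

theorem isUniv_trunc : IsUniv (Trunc.unit B).hom (fun _ : PUnit.{u + 1} => Trunc.x (p := p) B) :=
  IsUniv.of_trunc B

theorem isUniv_trunc₂ : IsUniv (Trunc.unit B ≫ Trunc.inl B).hom
    (Sum.elim (fun _ : PUnit.{u + 1} => tilt.map (Trunc.inl B).hom (Trunc.x (p := p) B))
      (fun _ : PUnit.{u + 1} => tilt.map (Trunc.inr B).hom (Trunc.x (p := p) B))) :=
  (IsUniv.of_trunc B).tensor (IsUniv.of_trunc B)

theorem isUniv_trunc₃ : IsUniv (Trunc.unit B ≫ Trunc.inl B ≫ Trunc.inl₃ B).hom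
    (Sum.elim (fun e => tilt.map (Trunc.inl₃ B).hom
      (Sum.elim (fun _ : PUnit.{u + 1} => tilt.map (Trunc.inl B).hom (Trunc.x (p := p) B))
        (fun _ : PUnit.{u + 1} => tilt.map (Trunc.inr B).hom (Trunc.x (p := p) B)) e))
      (fun _ : PUnit.{u + 1} => tilt.map (Trunc.inr₃ B).hom (Trunc.x (p := p) B))) :=
  ((IsUniv.of_trunc B).tensor (IsUniv.of_trunc B)).tensor (IsUniv.of_trunc B)

end Models

theorem Trunc.unit_inr (B : CommAlgCat.{u} (ZMod p)) :
    Trunc.unit B ≫ Trunc.inr B = Trunc.unit B ≫ Trunc.inl B :=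
  CommAlgCat.hom_ext (AlgHom.ext fun b =>
    (Algebra.TensorProduct.includeRight : Trunc p B →ₐ[B] Trunc p B ⊗[B] Trunc p B).commutes b)

theorem Trunc.unit_inr₃ (B : CommAlgCat.{u} (ZMod p)) :
    Trunc.unit B ≫ Trunc.inr₃ B = Trunc.unit B ≫ Trunc.inl B ≫ Trunc.inl₃ B :=
  CommAlgCat.hom_ext (AlgHom.ext fun b => (Algebra.TensorProduct.includeRight :
    Trunc p B →ₐ[B] (Trunc p B ⊗[B] Trunc p B) ⊗[B] Trunc p B).commutes b)

theorem Trunc.unit_map {B C : CommAlgCat.{u} (ZMod p)} (f : B ⟶ C) :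
    Trunc.unit B ≫ Trunc.map f = f ≫ Trunc.unit C :=
  CommAlgCat.hom_ext (AlgHom.ext fun b => Trunc.lift_incl _ _ (Trunc.coeff_zero_x C) b)

theorem Trunc.map_x {B C : CommAlgCat.{u} (ZMod p)} (f : B ⟶ C) :
    tilt.map (Trunc.map f).hom (Trunc.x B) = Trunc.x (p := p) C :=
  Trunc.lift_x _ _ (Trunc.coeff_zero_x C)

theorem isTensor_unwinding (hQ : ModelsQRSP.{u} p) (X : (NilpotentQuasiIdeal.{u} p)ᵒᵖ) :
    IsTensor hQ ((unwindingNilpotent p).obj X) where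
  perfect B _ := isIso_incl_of_perfect X.unop.property B
  tensor B _ := isPushout_envMap X.unop.property (isUniv_trunc B) (isUniv_trunc B)
    (isUniv_trunc₂ B) (Category.id_comp _).symm (Trunc.unit_inr B) (Trunc.unit_inr B).symm
    (fun _ => rfl) (fun _ => rfl)
  -- Here `B` is regarded as an algebra over itself with no generators, so the generators of `S_B`
  -- are reindexed by a sum with an empty type.
  baseChange B _ := isPushout_envMap X.unop.property (isUniv_trunc (baseField p))
    (φ' := 𝟙 B) (IsUniv.of_id B) ((isUniv_trunc B).reindex (Equiv.sumEmpty _ PEmpty.{u + 1}))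
    (Category.comp_id _).symm (Category.id_comp _) (Trunc.unit_map _)
    (fun _ => (Trunc.map_x _).symm) (fun e => e.elim)

theorem isThreefoldTensor_unwinding (hQ : ModelsQRSP.{u} p) (X : (NilpotentQuasiIdeal.{u} p)ᵒᵖ) :
    IsThreefoldTensor hQ ((unwindingNilpotent p).obj X) := fun B _ =>
  isPushout_envMap X.unop.property (isUniv_trunc₂ B) (isUniv_trunc B)
    (isUniv_trunc₃ B) (Category.id_comp _).symm (Trunc.unit_inr₃ B)
    ((Category.assoc _ _ _).trans (Trunc.unit_inr₃ B).symm) (fun _ => rfl) (fun _ => rfl)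

end

end Unwinding

/-! ### Points of tensor functors -/

namespace Unwinding

noncomputable section

variable {p : ℕ} [hp : Fact p.Prime]

instance (R : CommAlgCat.{u} (ZMod p)) : Subsingleton (baseField p ⟶ R) :=
  ⟨fun f g => by
    ext c
    obtain ⟨c, rfl⟩ := (ULift.algEquiv : ULift.{u} (ZMod p) ≃ₐ[ZMod p] ZMod p).symm.surjective c
    exact DFunLike.congr_fun (Subsingleton.elim
      (f.hom.comp (ULift.algEquiv : ULift.{u} (ZMod p) ≃ₐ[ZMod p] ZMod p).symm.toAlgHom)
      (g.hom.comp (ULift.algEquiv : ULift.{u} (ZMod p) ≃ₐ[ZMod p] ZMod p).symm.toAlgHom)) c⟩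

/-- Multiplication on the kernel of the map from the tilt. -/
def tiltKer.mul {S : CommAlgCat.{u} (ZMod p)} (a : tilt p S) (i : tiltKer p S) : tiltKer p S :=
  ⟨a * i, Ideal.mul_mem_left _ a i.2⟩

/-- Functoriality of the kernel of the map from the tilt. -/
def tiltKer.map {S S' : CommAlgCat.{u} (ZMod p)} (f : S ⟶ S') (i : tiltKer p S) : tiltKer p S' :=
  ⟨tilt.map f.hom i, map_mem_tiltKer f i⟩

namespace Trunc

/-- The element `x` of the kernel. -/
def gen (B : CommAlgCat.{u} (ZMod p)) : tiltKer p (obj B) := ⟨x B, coeff_zero_x B⟩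

/-- The homomorphism classified by an element of the kernel of the map from the tilt. -/
def classify {S : CommAlgCat.{u} (ZMod p)} (i : tiltKer p S) : obj (baseField p) ⟶ S :=
  CommAlgCat.ofHom (lift (fromBase p S).hom i i.2)

variable {S S' : CommAlgCat.{u} (ZMod p)}

theorem map_classify (i : tiltKer p S) : tiltKer.map (classify i) (gen (baseField p)) = i :=
  Subtype.ext (lift_x _ _ i.2)

/-- Over the prime field the base map carries no information, so `𝔽_p[x^{1/p^∞}]/x` corepresents `S
↦ Ker(S^♭ → S)`. -/
theorem base_hom_ext {f g : obj (baseField p) ⟶ S}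
    (h : tiltKer.map f (gen (baseField p)) = tiltKer.map g (gen (baseField p))) : f = g :=
  CommAlgCat.hom_ext ((isUniv_trunc (baseField p)).hom_ext
    (congrArg CommAlgCat.Hom.hom (Subsingleton.elim (unit _ ≫ f) (unit _ ≫ g)))
    fun _ => congrArg Subtype.val h)

theorem eq_classify (f : obj (baseField p) ⟶ S) :
    f = classify (tiltKer.map f (gen (baseField p))) :=
  base_hom_ext (map_classify _).symm

theorem classify_comp (i : tiltKer p S) (f : S ⟶ S') :
    classify i ≫ f = classify (tiltKer.map f i) := by
  rw [eq_classify (classify i ≫ f)]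
  congr 1
  exact congrArg (tiltKer.map f) (map_classify i)

end Trunc

open Unwinding.Trunc

namespace TensorPoints

section

variable (F : Under (tiltFunctor.{u} p)) {S S' S'' : QRSP.{u} p} {R R' : CommAlgCat.{u} (ZMod p)}

theorem app_comp (f : S.obj ⟶ S'.obj) (g : S'.obj ⟶ S''.obj) :
    app F f ≫ app F g = app F (f ≫ g) :=
  (F.right.map_comp _ _).symm

theorem str_app (f : S.obj ⟶ S'.obj) :
    str F S ≫ app F f = CommAlgCat.ofHom (tilt.map f.hom) ≫ str F S' :=
  (F.hom.naturality (ObjectProperty.homMk f)).symm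

variable {F}

/-- The scalars acting on the points defined over `F(S)`. -/
def act (χ : F.right.obj S ⟶ R) : tilt p S.obj →ₐ[ZMod p] tilt p R :=
  (tilt.map (str F S ≫ χ).hom).comp (tilt.ofPerfect (tilt p S.obj)).toAlgHom

theorem coeff_zero_act (χ : F.right.obj S ⟶ R) (a : tilt p S.obj) :
    tilt.coeff 0 (act χ a) = (str F S ≫ χ).hom a :=
  congrArg (str F S ≫ χ).hom (tilt.coeff_zero_ofPerfect _ a)

theorem act_app (f : S.obj ⟶ S'.obj) (χ : F.right.obj S' ⟶ R) (a : tilt p S.obj) :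
    act (app F f ≫ χ) a = act χ (tilt.map f.hom a) := by
  change tilt.map _ (tilt.ofPerfect _ a) = tilt.map _ (tilt.ofPerfect _ _)
  rw [← Category.assoc, str_app, ← tilt.map_ofPerfect]
  rfl

theorem act_comp (χ : F.right.obj S ⟶ R) (f : R ⟶ R') (a : tilt p S.obj) :
    act (χ ≫ f) a = tilt.map f.hom (act χ a) := rfl

variable (hQ : ModelsQRSP.{u} p)

/-- The point of `Spec F(𝔽_p[x^{1/p^∞}]/x)` attached to an element of the kernel. -/
def pt (i : tiltKer p S.obj) : F.right.obj (hQ.S (baseField p)) ⟶ F.right.obj S :=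
  app F (S := hQ.S (baseField p)) (classify i)

theorem pt_app (i : tiltKer p S.obj) (f : S.obj ⟶ S'.obj) :
    pt hQ i ≫ app F f = pt hQ (tiltKer.map f i) :=
  (app_comp F (S := hQ.S (baseField p)) _ _).trans (congrArg _ (classify_comp _ _))

theorem app_eq_pt (f : obj (baseField p) ⟶ S.obj) :
    app F (S := hQ.S (baseField p)) f = pt hQ (tiltKer.map f (gen (baseField p))) :=
  congrArg (app F (S := hQ.S (baseField p))) (eq_classify f)

theorem pt_gen : pt (F := F) hQ (S := hQ.S (baseField p)) (gen (baseField p)) = 𝟙 _ := by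
  rw [← F.right.map_id]
  refine ((app_eq_pt hQ (F := F) (S := hQ.S (baseField p)) (𝟙 _)).trans ?_).symm
  rfl

end

section

variable {hQ : ModelsQRSP.{u} p} {F : Under (tiltFunctor.{u} p)} (hF : IsTensor hQ F)
  {R R' : CommAlgCat.{u} (ZMod p)}

include hF

theorem perfect_hom_ext (B : CommAlgCat.{u} (ZMod p)) [PerfectRing B p]
    {g h : F.right.obj (hQ.P B) ⟶ R}
    (H : ∀ b, (str F (hQ.P B) ≫ g).hom (tilt.ofPerfect B b) =
      (str F (hQ.P B) ≫ h).hom (tilt.ofPerfect B b)) : g = h := by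
  have := hF.perfect B
  rw [← cancel_epi (str F (hQ.P B))]
  refine CommAlgCat.hom_ext (AlgHom.ext fun a => ?_)
  obtain ⟨b, rfl⟩ := (tilt.ofPerfect B).surjective a
  exact H b

theorem exists_perfect_hom (B : CommAlgCat.{u} (ZMod p)) [PerfectRing B p] (f : B ⟶ R) :
    ∃ g : F.right.obj (hQ.P B) ⟶ R,
      ∀ b, (str F (hQ.P B) ≫ g).hom (tilt.ofPerfect B b) = f.hom b := by
  have := hF.perfect B
  refine ⟨inv (str F (hQ.P B)) ≫ CommAlgCat.ofHom (f.hom.comp (tilt.coeff 0)), fun b => ?_⟩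
  rw [IsIso.hom_inv_id_assoc]
  exact congrArg f.hom (tilt.coeff_zero_ofPerfect _ b)

/-- By the first tensor condition `F(𝔽_p)` is the initial algebra, so compatibility over it is
automatic. -/
theorem base_ext (g h : F.right.obj (hQ.P (baseField p)) ⟶ R) : g = h := by
  refine perfect_hom_ext hF _ fun b => ?_
  have := Subsingleton.elim
    (CommAlgCat.ofHom ((str F (hQ.P (baseField p)) ≫ g).hom.comp
      (tilt.ofPerfect (baseField p)).toAlgHom))
    (CommAlgCat.ofHom ((str F (hQ.P (baseField p)) ≫ h).hom.comp
      (tilt.ofPerfect (baseField p)).toAlgHom))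
  exact congrArg (fun f => f.hom b) this

omit hF in
theorem app_map_fromBase (B : CommAlgCat.{u} (ZMod p)) [PerfectRing B p] :
    app F (S := hQ.S (baseField p)) (S' := hQ.S B) (Trunc.map (fromBase p B)) =
      pt hQ (S := hQ.S B) (gen B) := by
  rw [app_eq_pt hQ (S := hQ.S B)]
  congr 1
  exact Subtype.ext (Trunc.map_x _)

theorem trunc_hom_ext (B : CommAlgCat.{u} (ZMod p)) [PerfectRing B p]
    {χ χ' : F.right.obj (hQ.S B) ⟶ R}
    (h₁ : app F (S := hQ.P B) (S' := hQ.S B) (Trunc.unit B) ≫ χ =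
      app F (S := hQ.P B) (S' := hQ.S B) (Trunc.unit B) ≫ χ')
    (h₂ : pt hQ (S := hQ.S B) (gen B) ≫ χ = pt hQ (S := hQ.S B) (gen B) ≫ χ') : χ = χ' := by
  refine (hF.baseChange B).hom_ext ?_ h₁
  rw [app_map_fromBase, h₂]

/-- The base change condition: a map out of `F(S_B)` is a point together with a map out of `F(B)`.
-/
theorem exists_trunc_hom (B : CommAlgCat.{u} (ZMod p)) [PerfectRing B p]
    (g : F.right.obj (hQ.P B) ⟶ R) (y : F.right.obj (hQ.S (baseField p)) ⟶ R) :
    ∃ χ : F.right.obj (hQ.S B) ⟶ R, pt hQ (S := hQ.S B) (gen B) ≫ χ = y ∧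
      app F (S := hQ.P B) (S' := hQ.S B) (Trunc.unit B) ≫ χ = g := by
  refine ⟨(hF.baseChange B).desc y g (base_ext hF _ _), ?_, (hF.baseChange B).inr_desc _ _ _⟩
  rw [← app_map_fromBase, (hF.baseChange B).inl_desc]

omit hF in
theorem act_of_unit {B : CommAlgCat.{u} (ZMod p)} [PerfectRing B p] {S : QRSP.{u} p}
    (φ : B ⟶ S.obj) (f : B ⟶ R) (χ : F.right.obj S ⟶ R)
    (h : ∀ b, (str F (hQ.P B) ≫ app F (S := hQ.P B) φ ≫ χ).hom (tilt.ofPerfect B b) = f.hom b)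
    (b : B) : act χ (tilt.map φ.hom (tilt.ofPerfect B b)) = tilt.map f.hom (tilt.ofPerfect B b) := by
  rw [← act_app (S := hQ.P B)]
  change tilt.map _ (tilt.ofPerfect _ ((tilt.ofPerfect B).toAlgHom b)) = _
  rw [← tilt.map_ofPerfect, ← tilt.map_comp]
  exact congrArg (fun f => tilt.map f (tilt.ofPerfect B b)) (AlgHom.ext h)

/-- Any three points are defined over a common algebra on which all scalars are realized. -/
theorem exists_realization (h₃ : IsThreefoldTensor hQ F)
    (y₁ y₂ y₃ : F.right.obj (hQ.S (baseField p)) ⟶ R) :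
    ∃ (S : QRSP.{u} p) (χ : F.right.obj S ⟶ R) (i₁ i₂ i₃ : tiltKer p S.obj),
      pt hQ i₁ ≫ χ = y₁ ∧ pt hQ i₂ ≫ χ = y₂ ∧ pt hQ i₃ ≫ χ = y₃ ∧
      Function.Surjective (act χ) := by
  -- With `R^♭` itself as perfect base, evaluated to `R` by the zeroth coordinate, every scalar is
  -- the image of an element of the base.
  let B : CommAlgCat.{u} (ZMod p) := CommAlgCat.of (ZMod p) (tilt p R)
  have : PerfectRing B p := tilt.perfectRing
  obtain ⟨g, hg⟩ := exists_perfect_hom hF B (CommAlgCat.ofHom (tilt.coeff 0) : B ⟶ R)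
  obtain ⟨χ₁, h₁, h₁'⟩ := exists_trunc_hom hF B g y₁
  obtain ⟨χ₂, h₂, h₂'⟩ := exists_trunc_hom hF B g y₂
  obtain ⟨χ₃, h₃', h₃''⟩ := exists_trunc_hom hF B g y₃
  let χ₁₂ := (hF.tensor B).desc χ₁ χ₂ (h₁'.trans h₂'.symm)
  have hl : app F (S := hQ.S B) (S' := hQ.S₂ B) (Trunc.inl B) ≫ χ₁₂ = χ₁ :=
    (hF.tensor B).inl_desc _ _ _
  have hr : app F (S := hQ.S B) (S' := hQ.S₂ B) (Trunc.inr B) ≫ χ₁₂ = χ₂ :=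
    (hF.tensor B).inr_desc _ _ _
  have hu : app F (S := hQ.P B) (S' := hQ.S₂ B) (Trunc.unit B ≫ Trunc.inl B) ≫ χ₁₂ = g := by
    rw [← app_comp F (S := hQ.P B) (S' := hQ.S B) (S'' := hQ.S₂ B), Category.assoc, hl, h₁']
  -- The threefold tensor condition glues the third point to the first two.
  let χ := (h₃ B).desc χ₁₂ χ₃ (hu.trans h₃''.symm)
  have hl₃ : app F (S := hQ.S₂ B) (S' := hQ.S₃ B) (Trunc.inl₃ B) ≫ χ = χ₁₂ :=
    (h₃ B).inl_desc _ _ _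
  have hr₃ : app F (S := hQ.S B) (S' := hQ.S₃ B) (Trunc.inr₃ B) ≫ χ = χ₃ :=
    (h₃ B).inr_desc _ _ _
  refine ⟨hQ.S₃ B, χ, tiltKer.map (Trunc.inl₃ B) (tiltKer.map (Trunc.inl B) (gen B)),
    tiltKer.map (Trunc.inl₃ B) (tiltKer.map (Trunc.inr B) (gen B)),
    tiltKer.map (Trunc.inr₃ B) (gen B), ?_, ?_, ?_, fun b => ?_⟩
  · rw [← pt_app hQ (S := hQ.S₂ B) (S' := hQ.S₃ B), ← pt_app hQ (S := hQ.S B) (S' := hQ.S₂ B),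
      Category.assoc, Category.assoc, hl₃, hl, h₁]
  · rw [← pt_app hQ (S := hQ.S₂ B) (S' := hQ.S₃ B), ← pt_app hQ (S := hQ.S B) (S' := hQ.S₂ B),
      Category.assoc, Category.assoc, hl₃, hr, h₂]
  · rw [← pt_app hQ (S := hQ.S B) (S' := hQ.S₃ B), Category.assoc, hr₃, h₃']
  · refine ⟨tilt.map ((Trunc.unit B ≫ Trunc.inr₃ B).hom) (tilt.ofPerfect B b), ?_⟩
    refine (act_of_unit (hQ := hQ) (S := hQ.S₃ B) _ (CommAlgCat.ofHom (tilt.coeff 0) : B ⟶ R) χ ?_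
      b).trans ?_
    · intro b
      rw [← app_comp F (S := hQ.P B) (S' := hQ.S B) (S'' := hQ.S₃ B), Category.assoc, hr₃, h₃'', hg]
    · ext n
      exact tilt.coeff_coeff_ofPerfect (R := R) b 0 n |>.trans (by rw [zero_add])

end

end TensorPoints

end

end Unwinding

/-! ### The quasi-ideal of a tensor functor -/

namespace Unwinding

noncomputable section

variable {p : ℕ} [hp : Fact p.Prime]

theorem Trunc.comul_x (B : CommAlgCat.{u} (ZMod p)) :
    tilt.map (Trunc.comul B).hom (Trunc.x B) =
      tilt.map (Trunc.inl B).hom (Trunc.x B) + tilt.map (Trunc.inr B).hom (Trunc.x (p := p) B) :=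
  Trunc.lift_x _ _ (by
    rw [map_add, tilt.coeff_map, tilt.coeff_map, coeff_zero_x, map_zero, map_zero, add_zero])

namespace TensorPoints

section

variable {hQ : ModelsQRSP.{u} p} {F : Under (tiltFunctor.{u} p)} (hF : IsTensor hQ F)
  {R R' : CommAlgCat.{u} (ZMod p)} {S : QRSP.{u} p}

/-- The sum of two points. -/
def add (y₁ y₂ : F.right.obj (hQ.S (baseField p)) ⟶ R) :
    F.right.obj (hQ.S (baseField p)) ⟶ R :=
  app F (S := hQ.S (baseField p)) (S' := hQ.S₂ (baseField p)) (Trunc.comul (baseField p)) ≫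
    (hF.tensor (baseField p)).desc y₁ y₂ (base_ext hF _ _)

/-- The zero point. -/
def zero (R : CommAlgCat.{u} (ZMod p)) : F.right.obj (hQ.S (baseField p)) ⟶ R :=
  pt hQ (S := hQ.P (baseField p)) 0 ≫ (exists_perfect_hom hF (baseField p) (fromBase p R)).choose

/-- The negative of a point. -/
def neg (y : F.right.obj (hQ.S (baseField p)) ⟶ R) : F.right.obj (hQ.S (baseField p)) ⟶ R :=
  pt hQ (S := hQ.S (baseField p)) (-Trunc.gen (baseField p)) ≫ y

/-- The evaluation map. -/
def evalHom (R : CommAlgCat.{u} (ZMod p)) : F.right.obj (hQ.P (.of (ZMod p) (tilt p R))) ⟶ R :=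
  (exists_perfect_hom hF (.of (ZMod p) (tilt p R))
    (CommAlgCat.ofHom (tilt.coeff 0) : .of (ZMod p) (tilt p R) ⟶ R)).choose

theorem evalHom_spec (b : tilt p R) :
    (str F (hQ.P (.of (ZMod p) (tilt p R))) ≫ evalHom hF R).hom (tilt.ofPerfect (tilt p R) b) =
      tilt.coeff 0 b :=
  (exists_perfect_hom hF (.of (ZMod p) (tilt p R))
    (CommAlgCat.ofHom (tilt.coeff 0) : .of (ZMod p) (tilt p R) ⟶ R)).choose_spec b

/-- The extension of scalars of a point. -/
def extend (y : F.right.obj (hQ.S (baseField p)) ⟶ R) :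
    F.right.obj (hQ.S (.of (ZMod p) (tilt p R))) ⟶ R :=
  (exists_trunc_hom hF (.of (ZMod p) (tilt p R)) (evalHom hF R) y).choose

theorem extend_spec (y : F.right.obj (hQ.S (baseField p)) ⟶ R) :
    pt hQ (S := hQ.S (.of (ZMod p) (tilt p R))) (Trunc.gen (.of (ZMod p) (tilt p R))) ≫
      extend hF y = y ∧
    app F (S := hQ.P (.of (ZMod p) (tilt p R))) (S' := hQ.S (.of (ZMod p) (tilt p R)))
      (Trunc.unit (.of (ZMod p) (tilt p R))) ≫ extend hF y = evalHom hF R :=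
  (exists_trunc_hom hF (.of (ZMod p) (tilt p R)) (evalHom hF R) y).choose_spec

/-- The product of a scalar and a point. -/
def smul (a : tilt p R) (y : F.right.obj (hQ.S (baseField p)) ⟶ R) :
    F.right.obj (hQ.S (baseField p)) ⟶ R :=
  pt hQ (S := hQ.S (.of (ZMod p) (tilt p R)))
    (tiltKer.mul (tilt.map (Trunc.unit (.of (ZMod p) (tilt p R))).hom (tilt.ofPerfect _ a))
      (Trunc.gen (.of (ZMod p) (tilt p R)))) ≫ extend hF y

/-- The pair `(i, j)` is classified by a map from the twofold tensor product to `S`. By the tensor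
condition, the map gluing the two points is the value of `F` on it, and comultiplication sends `x`
to the sum. -/
theorem add_pt (χ : F.right.obj S ⟶ R) (i j : tiltKer p S.obj) :
    add hF (pt hQ i ≫ χ) (pt hQ j ≫ χ) = pt hQ (i + j) ≫ χ := by
  let m : Trunc.obj₂ (baseField p) ⟶ S.obj := CommAlgCat.ofHom
    ((isUniv_trunc₂ (baseField p)).exists_lift (fromBase p S.obj).hom
      (Sum.elim (fun _ => i) (fun _ => j)) (by rintro (_ | _); exacts [i.2, j.2])).choose
  have hm (e) := (((isUniv_trunc₂ (baseField p)).exists_lift (fromBase p S.obj).hom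
      (Sum.elim (fun _ => i) (fun _ => j)) (by rintro (_ | _); exacts [i.2, j.2])).choose_spec).2 e
  have hl : tilt.map m.hom (tilt.map (Trunc.inl (baseField p)).hom (Trunc.x _)) = i :=
    hm (Sum.inl ⟨⟩)
  have hr : tilt.map m.hom (tilt.map (Trunc.inr (baseField p)).hom (Trunc.x _)) = j :=
    hm (Sum.inr ⟨⟩)
  have hd : (hF.tensor (baseField p)).desc (pt hQ i ≫ χ) (pt hQ j ≫ χ) (base_ext hF _ _) =
      app F (S := hQ.S₂ (baseField p)) m ≫ χ := by
    refine (hF.tensor (baseField p)).hom_ext ?_ ?_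
    · rw [(hF.tensor (baseField p)).inl_desc, ← Category.assoc, app_comp F (S := hQ.S _)
        (S' := hQ.S₂ _), app_eq_pt hQ]
      congr 2
      exact Subtype.ext hl.symm
    · rw [(hF.tensor (baseField p)).inr_desc, ← Category.assoc, app_comp F (S := hQ.S _)
        (S' := hQ.S₂ _), app_eq_pt hQ]
      congr 2
      exact Subtype.ext hr.symm
  rw [add, hd, ← Category.assoc, app_comp F (S := hQ.S _) (S' := hQ.S₂ _), app_eq_pt hQ]
  congr 2
  refine Subtype.ext ?_
  change tilt.map m.hom (tilt.map (Trunc.comul (baseField p)).hom (Trunc.x _)) = (i + j : tilt p S.obj)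
  rw [← hl, ← hr, ← map_add]
  exact congrArg _ (Trunc.comul_x _)

theorem zero_pt (χ : F.right.obj S ⟶ R) : zero hF R = pt hQ (0 : tiltKer p S.obj) ≫ χ := by
  have : pt (F := F) hQ (0 : tiltKer p S.obj) = pt hQ (S := hQ.P (baseField p)) 0 ≫
      app F (S := hQ.P (baseField p)) (fromBase p S.obj) := by
    rw [pt_app hQ (S := hQ.P (baseField p))]
    congr 1
    exact Subtype.ext (map_zero (tilt.map (fromBase p S.obj).hom)).symm
  rw [this, Category.assoc, zero, base_ext hF (app F (S := hQ.P (baseField p)) _ ≫ χ)]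

omit hF in
theorem neg_pt (χ : F.right.obj S ⟶ R) (i : tiltKer p S.obj) :
    neg (hQ := hQ) (pt hQ i ≫ χ) = pt hQ (-i) ≫ χ := by
  rw [neg, ← Category.assoc]
  refine congrArg (· ≫ χ) ((pt_app hQ (S := hQ.S (baseField p)) _ (Trunc.classify i)).trans ?_)
  congr 1
  refine Subtype.ext ((map_neg (tilt.map (Trunc.classify i).hom) (Trunc.x (baseField p))).trans ?_)
  exact congrArg Neg.neg (congrArg Subtype.val (Trunc.map_classify i))

/-- The product is defined over the universal base `R^♭`. It is compared with the base `S^♭`,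
mapping to `R^♭` by `act χ` and to `S` by the zeroth coordinate. -/
theorem smul_pt (χ : F.right.obj S ⟶ R) (a : tilt p S.obj) (i : tiltKer p S.obj) :
    smul hF (act χ a) (pt hQ i ≫ χ) = pt hQ (tiltKer.mul a i) ≫ χ := by
  rw [smul]
  obtain ⟨hχ', hχ''⟩ := extend_spec hF (pt hQ i ≫ χ)
  have hg := evalHom_spec hF (R := R)
  set g := evalHom hF R
  set χ' := extend hF (pt hQ i ≫ χ)
  let B' : CommAlgCat.{u} (ZMod p) := .of (ZMod p) (tilt p R)
  let B : CommAlgCat.{u} (ZMod p) := .of (ZMod p) (tilt p S.obj)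
  have : PerfectRing B p := tilt.perfectRing
  have : PerfectRing B' p := tilt.perfectRing
  let θ : B ⟶ B' := CommAlgCat.ofHom (act χ)
  let l : Trunc.obj B ⟶ S.obj := CommAlgCat.ofHom (Trunc.lift (tilt.coeff 0) i i.2)
  have hlx : tilt.map l.hom (Trunc.x B) = i := Trunc.lift_x _ _ i.2
  have hlu : Trunc.unit B ≫ l = CommAlgCat.ofHom (tilt.coeff 0) :=
    CommAlgCat.hom_ext (AlgHom.ext fun b => Trunc.lift_incl _ _ i.2 b)
  have hθx : tiltKer.map (Trunc.map θ) (Trunc.gen B) = Trunc.gen B' :=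
    Subtype.ext (Trunc.map_x θ)
  have hli : tiltKer.map l (Trunc.gen B) = i := Subtype.ext hlx
  have hc (b : tilt p S.obj) : tilt.map (tilt.coeff 0) (tilt.ofPerfect (tilt p S.obj) b) = b := by
    ext n
    exact (tilt.coeff_coeff_ofPerfect b 0 n).trans (by rw [zero_add])
  -- Both composites out of `F(S_B)` restrict to the same map on `F(B)` and to the same point, hence
  -- agree.
  have key : app F (S := hQ.S B) (S' := hQ.S B') (Trunc.map θ) ≫ χ' =
      app F (S := hQ.S B) l ≫ χ := by
    refine trunc_hom_ext hF B ?_ ?_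
    · rw [← Category.assoc, ← Category.assoc, app_comp F (S := hQ.P B) (S' := hQ.S B)
        (S'' := hQ.S B'), app_comp F (S := hQ.P B) (S' := hQ.S B), Trunc.unit_map, hlu,
        ← app_comp F (S := hQ.P B) (S' := hQ.P B') (S'' := hQ.S B'), Category.assoc, hχ'']
      refine perfect_hom_ext hF B fun b => ?_
      rw [← Category.assoc, ← Category.assoc, str_app F (S := hQ.P B) (S' := hQ.P B'),
        str_app F (S := hQ.P B), Category.assoc, Category.assoc]
      refine (congrArg (str F (hQ.P B') ≫ g).hom (tilt.map_ofPerfect θ.hom b)).trans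
        ((hg _).trans ((coeff_zero_act χ b).trans ?_))
      exact congrArg (str F S ≫ χ).hom (hc b).symm
    · rw [← Category.assoc, ← Category.assoc, pt_app hQ (S := hQ.S B) (S' := hQ.S B'),
        pt_app hQ (S := hQ.S B), hli, hθx, hχ']
  have := congrArg (fun f => pt hQ (S := hQ.S B)
    (tiltKer.mul (tilt.map (Trunc.unit B).hom (tilt.ofPerfect B a)) (Trunc.gen B)) ≫ f) key
  simp only [← Category.assoc] at this
  rw [pt_app hQ (S := hQ.S B) (S' := hQ.S B'), pt_app hQ (S := hQ.S B)] at this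
  refine Eq.trans ?_ (this.trans ?_)
  · congr 2
    refine Subtype.ext (.symm ((map_mul (tilt.map (Trunc.map θ).hom) _ _).trans ?_))
    refine congrArg₂ _ ?_ (Trunc.map_x θ)
    rw [← tilt.map_comp, ← CommAlgCat.hom_comp, Trunc.unit_map, CommAlgCat.hom_comp, tilt.map_comp,
      tilt.map_ofPerfect]
    rfl
  · congr 2
    refine Subtype.ext ((map_mul (tilt.map l.hom) _ _).trans ?_)
    refine congrArg₂ _ ?_ hlx
    rw [← tilt.map_comp, ← CommAlgCat.hom_comp, hlu]
    exact hc a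

end

end TensorPoints

end

end Unwinding

/-! ### The restriction of a tensor functor -/

namespace Unwinding

noncomputable section

variable {p : ℕ} [hp : Fact p.Prime]

theorem Trunc.mulBy_x (B : CommAlgCat.{u} (ZMod p)) [PerfectRing B p] (b : B) :
    tilt.map (Trunc.mulBy B b).hom (Trunc.x B) =
      tilt.map (Trunc.unit B).hom (tilt.ofPerfect B b) * Trunc.x (p := p) B :=
  Trunc.lift_x _ _ (by rw [map_mul, coeff_zero_x, mul_zero])

namespace TensorPoints

section

variable {hQ : ModelsQRSP.{u} p} {F : Under (tiltFunctor.{u} p)} (hF : IsTensor hQ F)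
  (h₃ : IsThreefoldTensor hQ F)

/-- The additive group structure on points. -/
abbrev addCommGroup (R : CommAlgCat.{u} (ZMod p)) :
    AddCommGroup (F.right.obj (hQ.S (baseField p)) ⟶ R) where
  add := add hF
  zero := zero hF R
  neg := neg
  nsmul := @nsmulRec _ ⟨zero hF R⟩ ⟨add hF⟩
  zsmul := @zsmulRec _ ⟨zero hF R⟩ ⟨add hF⟩ ⟨neg⟩ (@nsmulRec _ ⟨zero hF R⟩ ⟨add hF⟩)
  add_assoc y₁ y₂ y₃ := by
    change add hF (add hF y₁ y₂) y₃ = add hF y₁ (add hF y₂ y₃)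
    -- Once the three points come from one kernel, associativity is that of addition in the ideal.
    obtain ⟨S, χ, i, j, k, rfl, rfl, rfl, -⟩ := exists_realization hF h₃ y₁ y₂ y₃
    rw [add_pt, add_pt, add_pt, add_pt, add_assoc]
  add_comm y₁ y₂ := by
    change add hF y₁ y₂ = add hF y₂ y₁
    obtain ⟨S, χ, i, j, k, rfl, rfl, -⟩ := exists_realization hF h₃ y₁ y₂ y₁
    rw [add_pt, add_pt, add_comm]
  zero_add y := by
    change add hF (zero hF R) y = y
    obtain ⟨S, χ, i, -, -, rfl, -⟩ := exists_realization hF h₃ y y y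
    rw [zero_pt hF χ, add_pt, zero_add]
  add_zero y := by
    change add hF y (zero hF R) = y
    obtain ⟨S, χ, i, -, -, rfl, -⟩ := exists_realization hF h₃ y y y
    rw [zero_pt hF χ, add_pt, add_zero]
  neg_add_cancel y := by
    change add hF (neg y) y = zero hF R
    obtain ⟨S, χ, i, -, -, rfl, -⟩ := exists_realization hF h₃ y y y
    rw [zero_pt hF χ, neg_pt, add_pt]
    congr 2
    exact neg_add_cancel i

/-- The module structure on points. -/
abbrev module (R : CommAlgCat.{u} (ZMod p)) :
    letI := addCommGroup hF h₃ R
    Module (tilt p R) (F.right.obj (hQ.S (baseField p)) ⟶ R) :=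
  letI := addCommGroup hF h₃ R
  { smul := smul hF
    one_smul := fun y => by
      change smul hF 1 y = y
      obtain ⟨S, χ, i, -, -, rfl, -⟩ := exists_realization hF h₃ y y y
      rw [← map_one (act χ), smul_pt]
      congr 2
      exact Subtype.ext (one_mul _)
    mul_smul := fun a b y => by
      change smul hF (a * b) y = smul hF a (smul hF b y)
      obtain ⟨S, χ, i, -, -, rfl, -, -, hs⟩ := exists_realization hF h₃ y y y
      obtain ⟨a, rfl⟩ := hs a
      obtain ⟨b, rfl⟩ := hs b
      rw [← map_mul, smul_pt, smul_pt, smul_pt]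
      congr 2
      exact Subtype.ext (mul_assoc _ _ _)
    smul_zero := fun a => by
      change smul hF a (zero hF R) = zero hF R
      obtain ⟨S, χ, i, -, -, -, -, -, hs⟩ :=
        exists_realization hF h₃ (zero hF R) (zero hF R) (zero hF R)
      obtain ⟨a, rfl⟩ := hs a
      rw [zero_pt hF χ, smul_pt]
      congr 2
      exact Subtype.ext (mul_zero _)
    smul_add := fun a y₁ y₂ => by
      change smul hF a (add hF y₁ y₂) = add hF (smul hF a y₁) (smul hF a y₂)
      obtain ⟨S, χ, i, j, -, rfl, rfl, -, hs⟩ := exists_realization hF h₃ y₁ y₂ y₂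
      obtain ⟨a, rfl⟩ := hs a
      rw [add_pt, smul_pt, smul_pt, smul_pt, add_pt]
      congr 2
      exact Subtype.ext (mul_add _ _ _)
    add_smul := fun a b y => by
      change smul hF (a + b) y = add hF (smul hF a y) (smul hF b y)
      obtain ⟨S, χ, i, -, -, rfl, -, -, hs⟩ := exists_realization hF h₃ y y y
      obtain ⟨a, rfl⟩ := hs a
      obtain ⟨b, rfl⟩ := hs b
      rw [← map_add, smul_pt, smul_pt, smul_pt, add_pt]
      congr 2
      exact Subtype.ext (add_mul _ _ _)
    zero_smul := fun y => by
      change smul hF 0 y = zero hF R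
      obtain ⟨S, χ, i, -, -, rfl, -⟩ := exists_realization hF h₃ y y y
      rw [← map_zero (act χ), smul_pt, zero_pt hF χ]
      congr 2
      exact Subtype.ext (zero_mul _) }

theorem act_pt {R : CommAlgCat.{u} (ZMod p)} {S : QRSP.{u} p} (χ : F.right.obj S ⟶ R)
    (i : tiltKer p S.obj) :
    act (S := hQ.S (baseField p)) (pt hQ i ≫ χ) (Trunc.x (baseField p)) = act χ i := by
  rw [pt, act_app (S := hQ.S (baseField p))]
  exact congrArg (act χ) (congrArg Subtype.val (Trunc.map_classify i))

/-- The pointed module `Spec F(𝔽_p[x^{1/p^∞}]/x)`. -/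
def toPointedModule : PointedModule.{u} p where
  Γ := F.right.obj (hQ.S (baseField p))
  addCommGroup := addCommGroup hF h₃
  module := module hF h₃
  add_comp y₁ y₂ f := by
    change add hF y₁ y₂ ≫ f = add hF (y₁ ≫ f) (y₂ ≫ f)
    obtain ⟨S, χ, i, j, k, rfl, rfl, -⟩ := exists_realization hF h₃ y₁ y₂ y₁
    rw [add_pt, Category.assoc, Category.assoc, Category.assoc, add_pt]
  smul_comp a y f := by
    change smul hF a y ≫ f = smul hF (tilt.map f.hom a) (y ≫ f)
    obtain ⟨S, χ, i, -, -, rfl, -, -, hs⟩ := exists_realization hF h₃ y y y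
    obtain ⟨a, rfl⟩ := hs a
    rw [smul_pt, ← act_comp, Category.assoc, Category.assoc, smul_pt]
  d R :=
    letI := addCommGroup hF h₃ R
    letI := module hF h₃ R
    { toFun := fun y => act (S := hQ.S (baseField p)) y (Trunc.x (baseField p))
      map_add' := fun y₁ y₂ => by
        change act (S := hQ.S (baseField p)) (add hF y₁ y₂) _ = _
        obtain ⟨S, χ, i, j, k, rfl, rfl, -⟩ := exists_realization hF h₃ y₁ y₂ y₁
        rw [add_pt, act_pt, act_pt, act_pt]
        exact map_add (act χ) _ _
      map_smul' := fun a y => by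
        change act (S := hQ.S (baseField p)) (smul hF a y) _ = a * act (S := hQ.S (baseField p)) y _
        obtain ⟨S, χ, i, -, -, rfl, -, -, hs⟩ := exists_realization hF h₃ y y y
        obtain ⟨a, rfl⟩ := hs a
        rw [smul_pt, act_pt, act_pt]
        exact map_mul (act χ) _ _ }
  d_comp y f := act_comp (S := hQ.S (baseField p)) y f _

/-- For points given by elements `i` and `j` of one kernel, both sides are given by the product of
`i` and `j`. -/
theorem isQuasiIdeal : (toPointedModule hF h₃).IsQuasiIdeal := by
  intro R y₁ y₂
  change smul hF (act (S := hQ.S (baseField p)) y₁ (Trunc.x (baseField p))) y₂ =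
    smul hF (act (S := hQ.S (baseField p)) y₂ (Trunc.x (baseField p))) y₁
  obtain ⟨S, χ, i, j, -, rfl, rfl, -⟩ := exists_realization hF h₃ y₁ y₂ y₁
  rw [act_pt, act_pt, smul_pt, smul_pt]
  congr 2
  exact Subtype.ext (mul_comm _ _)

theorem isSpec : IsSpec hQ F (toPointedModule hF h₃) (Iso.refl _) where
  add R χ := by
    refine Eq.trans ?_ (Eq.symm (congrArg₂ (add hF) (Category.id_comp _) (Category.id_comp _)))
    rw [app_eq_pt hQ (S := hQ.S₂ (baseField p)), app_eq_pt hQ (S := hQ.S₂ (baseField p)),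
      app_eq_pt hQ (S := hQ.S₂ (baseField p)), add_pt hF (S := hQ.S₂ (baseField p))]
    refine (Category.id_comp _).trans ?_
    congr 2
    exact Subtype.ext (Trunc.comul_x _)
  smul R B _ b χ := by
    refine Eq.trans ?_ (Eq.symm (congrArg₂ (smul hF) (act_app (S := hQ.P B) (S' := hQ.S B)
      (Trunc.unit B) χ (tilt.ofPerfect B b)) (Category.id_comp _)))
    rw [app_map_fromBase, smul_pt hF (S := hQ.S B), ← Category.assoc (pt hQ _),
      pt_app hQ (S := hQ.S B) (S' := hQ.S B)]
    refine (Category.id_comp _).trans ?_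
    congr 2
    exact Subtype.ext (Trunc.mulBy_x B b)
  point R χ := by
    refine (congrArg (fun y => act (S := hQ.S (baseField p)) y (Trunc.x (baseField p)))
      (Category.id_comp χ)).trans ?_
    exact (act_app (S := hQ.P₁ (baseField p)) (S' := hQ.S (baseField p))
      (Trunc.fromPerfPoly (baseField p)) χ (PerfPoly.x (baseField p))).symm

end

end TensorPoints

end

end Unwinding

/-! ### Nilpotency -/

namespace Unwinding

noncomputable section

variable {p : ℕ} [hp : Fact p.Prime]

section SeqAlg

variable (p)

/-- Eventually constant sequences in `𝔽_p`, with their limit as an additional term. -/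
def seqSubalgebra : Subalgebra (ZMod p) (Option ℕ → ULift.{u} (ZMod p)) where
  carrier := {f | ∃ N, ∀ n, N ≤ n → f (some n) = f none}
  mul_mem' := by
    rintro f g ⟨N, hN⟩ ⟨N', hN'⟩
    exact ⟨max N N', fun n hn => congrArg₂ (· * ·) (hN n (le_of_max_le_left hn))
      (hN' n (le_of_max_le_right hn))⟩
  add_mem' := by
    rintro f g ⟨N, hN⟩ ⟨N', hN'⟩
    exact ⟨max N N', fun n hn => congrArg₂ (· + ·) (hN n (le_of_max_le_left hn))
      (hN' n (le_of_max_le_right hn))⟩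
  algebraMap_mem' c := ⟨0, fun _ _ => rfl⟩

/-- The algebra of eventually constant sequences in `𝔽_p`. -/
abbrev seqAlg : CommAlgCat.{u} (ZMod p) := CommAlgCat.of (ZMod p) (seqSubalgebra.{u} p)

instance : PerfectRing (seqAlg.{u} p) p where
  bijective_frobenius := by
    have : (fun f : seqSubalgebra.{u} p => f ^ p) = id := by
      ext f o
      change ((f.1 o) ^ p).down = _
      exact ZMod.pow_card (f.1 o).down
    change Function.Bijective fun f : seqSubalgebra.{u} p => f ^ p
    rw [this]
    exact Function.bijective_id

/-- Evaluation of sequences. -/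
def seqEval (o : Option ℕ) : seqAlg.{u} p ⟶ baseField p :=
  CommAlgCat.ofHom ((Pi.evalAlgHom (ZMod p) (fun _ : Option ℕ => ULift.{u} (ZMod p)) o).comp
    (seqSubalgebra p).val)

/-- The sequence with one nonzero term. -/
def seqSingle (n : ℕ) : seqAlg.{u} p :=
  (⟨Pi.single (some n) 1, n + 1, fun m hm => by
    rw [Pi.single_eq_of_ne, Pi.single_eq_of_ne]
    · simp
    · simpa using (Nat.lt_of_succ_le hm).ne'⟩ : seqSubalgebra.{u} p)

theorem seqEval_single (n : ℕ) (o : Option ℕ) :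
    (seqEval.{u} p o).hom (seqSingle p n) = if o = some n then 1 else 0 := by
  change (Pi.single (some n) 1 : Option ℕ → ULift.{u} (ZMod p)) o = _
  rw [Pi.single_apply]

theorem seqSingle_pow (n : ℕ) : seqSingle p n ^ p = seqSingle.{u} p n := by
  refine Subtype.ext (funext fun o => ULift.ext _ _ ?_)
  exact ZMod.pow_card _

theorem Trunc.coeff_x_pow_eq_zero (B : CommAlgCat.{u} (ZMod p)) {m n : ℕ} (h : p ^ m ≤ n) :
    tilt.coeff m (Trunc.x (p := p) B) ^ n = 0 := by
  refine pow_eq_zero_of_le h ?_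
  have := tilt.coeff_pow_pow (Trunc.x (p := p) B) 0 m
  rwa [zero_add, Trunc.coeff_zero_x] at this

/-- The element `∑ b_n x^n`, where the `b_n` are the sequences with one nonzero term. -/
def seqElt : tilt p (Trunc p (seqAlg.{u} p)) :=
  tilt.mk (fun m => ∑ n ∈ Finset.range (p ^ m),
    Trunc.incl (seqAlg.{u} p) (seqSingle p n) * tilt.coeff m (Trunc.x (seqAlg.{u} p)) ^ n)
    fun m => by
      -- The indicators equal their own `p`-th powers, so compatibility is termwise; the terms with
      -- `n ≥ p^m` present at level `m + 1` become zero because `x = 0`.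
      rw [← frob_apply, map_sum, ← Finset.sum_subset (Finset.range_mono
        (Nat.pow_le_pow_right hp.out.pos (Nat.le_succ m)))]
      · refine Finset.sum_congr rfl fun n _ => ?_
        rw [frob_apply, mul_pow, ← map_pow, seqSingle_pow, ← pow_mul, mul_comm n, pow_mul,
          tilt.coeff_succ_pow]
      · intro n _ hn
        rw [frob_apply, mul_pow, ← pow_mul, mul_comm n, pow_mul, tilt.coeff_succ_pow,
          Trunc.coeff_x_pow_eq_zero _ _ (by simpa using hn), mul_zero]

theorem map_seqElt (o : Option ℕ) (m : ℕ) :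
    tilt.coeff m (tilt.map (Trunc.map (seqEval p o)).hom (seqElt.{u} p)) =
      ∑ n ∈ Finset.range (p ^ m), (if o = some n then
        tilt.coeff m (Trunc.x (baseField.{u} p)) ^ n else 0) := by
  rw [tilt.coeff_map, seqElt, tilt.coeff_mk, map_sum]
  refine Finset.sum_congr rfl fun n _ => ?_
  have h₁ : (Trunc.map (seqEval.{u} p o)).hom (Trunc.incl _ (seqSingle p n)) =
      Trunc.incl _ ((seqEval p o).hom (seqSingle p n)) :=
    congrArg (fun f => f.hom (seqSingle p n)) (Trunc.unit_map (seqEval.{u} p o))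
  have h₂ := congrArg (tilt.coeff m) (Trunc.map_x (seqEval.{u} p o))
  rw [tilt.coeff_map] at h₂
  rw [map_mul, map_pow, h₁, h₂, seqEval_single]
  split_ifs
  · rw [map_one, one_mul]
  · rw [map_zero, zero_mul]

theorem map_some_seqElt (k : ℕ) : tilt.map (Trunc.map (seqEval p (some k))).hom (seqElt.{u} p) =
    Trunc.x (baseField.{u} p) ^ k := by
  ext m
  rw [map_seqElt, map_pow]
  simp only [Option.some.injEq, Finset.sum_ite_eq, Finset.mem_range]
  split_ifs with h
  · rfl
  · exact (Trunc.coeff_x_pow_eq_zero p _ (not_lt.mp h)).symm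

/-- Every indicator vanishes at infinity. Although the terms specialize to all powers of `x`, the
whole series specializes to `0` here. -/
theorem map_none_seqElt : tilt.map (Trunc.map (seqEval p none)).hom (seqElt.{u} p) = 0 := by
  ext m
  rw [map_seqElt, map_zero]
  simp

end SeqAlg

/-- A subalgebra containing the images of both maps of a pushout square is everything. -/
theorem subalgebra_eq_top_of_isPushout {A B C D : CommAlgCat.{u} (ZMod p)} {f : A ⟶ B} {g : A ⟶ C}
    {i : B ⟶ D} {j : C ⟶ D} (h : IsPushout f g i j) (E : Subalgebra (ZMod p) D)
    (h₁ : ∀ b, i.hom b ∈ E) (h₂ : ∀ c, j.hom c ∈ E) : E = ⊤ := by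
  let v : CommAlgCat.of (ZMod p) E ⟶ D := CommAlgCat.ofHom E.val
  let i' : B ⟶ CommAlgCat.of (ZMod p) E := CommAlgCat.ofHom (i.hom.codRestrict E h₁)
  let j' : C ⟶ CommAlgCat.of (ZMod p) E := CommAlgCat.ofHom (j.hom.codRestrict E h₂)
  have w : f ≫ i' = g ≫ j' := by
    refine CommAlgCat.hom_ext (AlgHom.ext fun a => Subtype.ext ?_)
    exact congrArg (fun f => f.hom a) h.w
  have hv : h.desc i' j' w ≫ v = 𝟙 D := by
    refine h.hom_ext ?_ ?_
    · rw [h.inl_desc_assoc, Category.comp_id]; rfl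
    · rw [h.inr_desc_assoc, Category.comp_id]; rfl
  refine eq_top_iff.mpr fun d _ => ?_
  have := congrArg (fun f => f.hom d) hv
  change ((h.desc i' j' w).hom d).1 = d at this
  rw [← this]
  exact ((h.desc i' j' w).hom d).2

namespace TensorPoints

variable {hQ : ModelsQRSP.{u} p} {F : Under (tiltFunctor.{u} p)} (hF : IsTensor hQ F)

include hF

/-- Elements of `F(S_{𝔽_p}) ⊗ B` are finite sums, so their specializations at `n` eventually equal
the one at infinity. Applied to the image of `seqElt`, this reads `t^n = 0` for large `n`. -/
theorem isNilpotent_str : IsNilpotent ((str F (hQ.S (baseField p))).hom (Trunc.x (baseField p))) := by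
  let B := seqAlg.{u} p
  let ev (o : Option ℕ) : F.right.obj (hQ.S B) ⟶ F.right.obj (hQ.S (baseField p)) :=
    app F (S := hQ.S B) (S' := hQ.S (baseField p)) (Trunc.map (seqEval p o))
  have hev (o : Option ℕ) (a : tilt p (Trunc p B)) : (ev o).hom ((str F (hQ.S B)).hom a) =
      (str F (hQ.S (baseField p))).hom (tilt.map (Trunc.map (seqEval p o)).hom a) :=
    congrArg (fun f => f.hom a) (str_app F (S := hQ.S B) (S' := hQ.S (baseField p))
      (Trunc.map (seqEval p o)))
  let D : Subalgebra (ZMod p) (F.right.obj (hQ.S B)) :=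
    { carrier := {s | ∃ N, ∀ n, N ≤ n → (ev (some n)).hom s = (ev none).hom s}
      mul_mem' := by
        rintro f g ⟨N, hN⟩ ⟨N', hN'⟩
        refine ⟨max N N', fun n hn => ?_⟩
        rw [map_mul, map_mul, hN n (le_of_max_le_left hn), hN' n (le_of_max_le_right hn)]
      add_mem' := by
        rintro f g ⟨N, hN⟩ ⟨N', hN'⟩
        refine ⟨max N N', fun n hn => ?_⟩
        rw [map_add, map_add, hN n (le_of_max_le_left hn), hN' n (le_of_max_le_right hn)]
      algebraMap_mem' := fun c => ⟨0, fun n _ => by rw [AlgHom.commutes, AlgHom.commutes]⟩ }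
  -- By base change it suffices to treat two kinds of elements: those from `F(S_{𝔽_p})`, whose
  -- specializations are all equal, and those from `B`, which are eventually constant by
  -- construction.
  have hD : D = ⊤ := by
    refine subalgebra_eq_top_of_isPushout (hF.baseChange B) D (fun b => ⟨0, fun n _ => ?_⟩)
      fun c => ?_
    · have (o : Option ℕ) : app F (S := hQ.S (baseField p)) (S' := hQ.S B)
          (Trunc.map (fromBase p B)) ≫ ev o = 𝟙 _ := by
        rw [app_map_fromBase, pt_app hQ (S := hQ.S B) (S' := hQ.S (baseField p)), ← pt_gen]
        congr 1
        exact Subtype.ext (Trunc.map_x _)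
      exact (congrArg (fun f => f.hom b) (this (some n))).trans
        (congrArg (fun f => f.hom b) (this none)).symm
    · have := hF.perfect B
      obtain ⟨a, rfl⟩ : ∃ a, c = (str F (hQ.P B)).hom a :=
        ⟨(inv (str F (hQ.P B))).hom c, by
          rw [← AlgHom.comp_apply, ← CommAlgCat.hom_comp, IsIso.inv_hom_id]; rfl⟩
      obtain ⟨b, rfl⟩ := (tilt.ofPerfect B).surjective a
      obtain ⟨N, hN⟩ := b.2
      refine ⟨N, fun n hn => ?_⟩
      have key (o : Option ℕ) : (ev o).hom ((app F (S := hQ.P B) (S' := hQ.S B)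
          (Trunc.unit B)).hom ((str F (hQ.P B)).hom (tilt.ofPerfect B b))) =
          (app F (S := hQ.P (baseField p)) (S' := hQ.S (baseField p)) (Trunc.unit _)).hom
            ((str F (hQ.P (baseField p))).hom (tilt.ofPerfect _ ((seqEval p o).hom b))) := by
        rw [← tilt.map_ofPerfect]
        have h₁ := congrArg (fun f => f.hom (tilt.ofPerfect B b)) (str_app F (S := hQ.P B)
          (S' := hQ.P (baseField p)) (seqEval p o))
        have h₂ : app F (S := hQ.P B) (S' := hQ.S B) (Trunc.unit B) ≫ ev o =
            app F (S := hQ.P B) (S' := hQ.P (baseField p)) (seqEval p o) ≫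
            app F (S := hQ.P (baseField p)) (S' := hQ.S (baseField p)) (Trunc.unit _) := by
          rw [app_comp F (S := hQ.P B) (S' := hQ.S B) (S'' := hQ.S (baseField p)), Trunc.unit_map,
            ← app_comp F (S := hQ.P B) (S' := hQ.P (baseField p)) (S'' := hQ.S (baseField p))]
        refine (congrArg (fun f => f.hom ((str F (hQ.P B)).hom (tilt.ofPerfect B b))) h₂).trans ?_
        exact congrArg (app F (S := hQ.P (baseField p)) (S' := hQ.S (baseField p))
          (Trunc.unit _)).hom h₁
      rw [key, key]
      congr 3
      exact hN n hn
  obtain ⟨N, hN⟩ := hD.ge (Algebra.mem_top (x := (str F (hQ.S B)).hom (seqElt p)))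
  refine ⟨N, ?_⟩
  have := hN N le_rfl
  rw [hev, hev, map_some_seqElt, map_none_seqElt, map_zero] at this
  exact (map_pow (str F (hQ.S (baseField p))).hom _ _).symm.trans this

end TensorPoints

end

end Unwinding

/-! ### The adjunction -/

namespace Unwinding

noncomputable section

variable {p : ℕ} [hp : Fact p.Prime]

namespace TensorPoints

section

variable {hQ : ModelsQRSP.{u} p} {F F' : Under (tiltFunctor.{u} p)} (τ : F ⟶ F')
  {R : CommAlgCat.{u} (ZMod p)} {S : QRSP.{u} p}

theorem str_comp_right : str F S ≫ τ.right.app S = str F' S :=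
  congrArg (fun η => NatTrans.app η S) (Under.w τ)

theorem app_comp_right {S' : QRSP.{u} p} (f : S.obj ⟶ S'.obj) :
    app F f ≫ τ.right.app S' = τ.right.app S ≫ app F' f :=
  τ.right.naturality _

theorem act_comp_right (χ : F'.right.obj S ⟶ R) (a : tilt p S.obj) :
    act (τ.right.app S ≫ χ) a = act χ a := by
  change tilt.map _ _ = tilt.map _ _
  rw [← Category.assoc, str_comp_right]

/-- Points attached to kernel elements are natural in the tensor functor, so additivity and
linearity of the pullback can be checked on realizations. -/
theorem pt_comp_right (i : tiltKer p S.obj) :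
    τ.right.app (hQ.S (baseField p)) ≫ pt (F := F') hQ i = pt hQ i ≫ τ.right.app S :=
  (app_comp_right τ (S := hQ.S (baseField p)) _).symm

/-- Functoriality of the restriction of tensor functors. -/
def restrictMap (hF : IsTensor hQ F) (h₃ : IsThreefoldTensor hQ F) (hF' : IsTensor hQ F')
    (h₃' : IsThreefoldTensor hQ F') : toPointedModule hF' h₃' ⟶ toPointedModule hF h₃ where
  pullback := τ.right.app (hQ.S (baseField p))
  map_add y₁ y₂ := by
    obtain ⟨S, χ, i, j, -, rfl, rfl, -⟩ := exists_realization hF' h₃' y₁ y₂ y₁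
    refine (congrArg (τ.right.app (hQ.S (baseField p)) ≫ ·) (add_pt hF' χ i j)).trans ?_
    refine Eq.trans ?_ (congrArg₂ (add hF) ((Category.assoc _ _ _).symm.trans
      ((congrArg (· ≫ χ) (pt_comp_right τ i)).trans (Category.assoc _ _ _))).symm
      ((Category.assoc _ _ _).symm.trans
      ((congrArg (· ≫ χ) (pt_comp_right τ j)).trans (Category.assoc _ _ _))).symm)
    rw [add_pt, ← Category.assoc, pt_comp_right, Category.assoc]
  map_smul a y := by
    obtain ⟨S, χ, i, -, -, rfl, -, -, hs⟩ := exists_realization hF' h₃' y y y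
    obtain ⟨a, rfl⟩ := hs a
    refine (congrArg (τ.right.app (hQ.S (baseField p)) ≫ ·) (smul_pt hF' χ a i)).trans ?_
    refine Eq.trans ?_ (congrArg₂ (smul hF) (act_comp_right τ χ a) ((Category.assoc _ _ _).symm.trans
      ((congrArg (· ≫ χ) (pt_comp_right τ i)).trans (Category.assoc _ _ _))).symm)
    rw [smul_pt, ← Category.assoc, pt_comp_right, Category.assoc]
  map_d y := act_comp_right τ (S := hQ.S (baseField p)) y _

end

section

variable {hQ : ModelsQRSP.{u} p}

/-- The nilpotent quasi-ideal of a tensor functor. -/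
def toNilpotentQuasiIdeal (F : TensorFunctor₃ hQ) : NilpotentQuasiIdeal.{u} p where
  obj := toPointedModule F.property.1 F.property.2
  property := ⟨isQuasiIdeal _ _, by
    have := isNilpotent_str F.property.1
    rw [← Category.comp_id (str _ _)] at this
    refine (congrArg IsNilpotent ?_).mpr this
    exact coeff_zero_act (S := hQ.S (baseField p)) (𝟙 _) _⟩

variable (hQ) in
/-- The functor from tensor functors to nilpotent quasi-ideals. -/
def restriction : TensorFunctor₃ hQ ⥤ (NilpotentQuasiIdeal.{u} p)ᵒᵖ where
  obj F := .op (toNilpotentQuasiIdeal F)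
  map {F F'} τ := Quiver.Hom.op (ObjectProperty.homMk
    (restrictMap τ.hom F.property.1 F.property.2 F'.property.1 F'.property.2))
  map_id _ := rfl
  map_comp _ _ := rfl

variable (hQ) in
theorem isRestriction_restriction : IsRestriction hQ (restriction hQ) :=
  ⟨fun _ => Iso.refl _, fun F => isSpec F.property.1 F.property.2, fun _ _ _ =>
    (Category.comp_id _).trans (Category.id_comp _).symm⟩

end

section

variable {hQ : ModelsQRSP.{u} p} {F : Under (tiltFunctor.{u} p)} (hF : IsTensor hQ F)
  (h₃ : IsThreefoldTensor hQ F) {X : PointedModule.{u} p} {R : CommAlgCat.{u} (ZMod p)}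
  {S : QRSP.{u} p}

section

variable (u : toPointedModule hF h₃ ⟶ X)

/-- The pullback of functions along a map of pointed modules. -/
def pullback : X.Γ ⟶ F.right.obj (hQ.S (baseField p)) := u.pullback

theorem pullback_pt_add (χ : F.right.obj S ⟶ R) (i j : tiltKer p S.obj) :
    pullback hF h₃ u ≫ pt hQ (i + j) ≫ χ =
      pullback hF h₃ u ≫ pt hQ i ≫ χ + pullback hF h₃ u ≫ pt hQ j ≫ χ :=
  (congrArg (u.pullback ≫ ·) (add_pt hF χ i j)).symm.trans (u.map_add _ _)

theorem pullback_pt_mul (χ : F.right.obj S ⟶ R) (a : tilt p S.obj) (i : tiltKer p S.obj) :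
    pullback hF h₃ u ≫ pt hQ (tiltKer.mul a i) ≫ χ = act χ a • (pullback hF h₃ u ≫ pt hQ i ≫ χ) :=
  (congrArg (u.pullback ≫ ·) (smul_pt hF χ a i)).symm.trans (u.map_smul _ _)

theorem d_pullback_pt (χ : F.right.obj S ⟶ R) (i : tiltKer p S.obj) :
    X.d R (pullback hF h₃ u ≫ pt hQ i ≫ χ) = act χ i :=
  (u.map_d _).trans (act_pt χ i)

/-- Sending a kernel element to its point, followed by `u`, is linear. This is the datum that the
enveloping algebra classifies. -/
theorem isPointedLinear_pt : IsPointedLinear X (tiltKer p S.obj) (str F S).hom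
    (fun i => pullback hF h₃ u ≫ pt hQ i) where
  map_add i j := by
    have := pullback_pt_add hF h₃ u (𝟙 (F.right.obj S)) i j
    simpa only [Category.comp_id] using this
  map_smul b i := by
    have := pullback_pt_mul hF h₃ u (𝟙 (F.right.obj S)) b i
    rw [act, Category.comp_id, Category.comp_id, Category.comp_id] at this
    exact this
  map_d i := by
    have := d_pullback_pt hF h₃ u (𝟙 (F.right.obj S)) i
    rw [act, Category.comp_id, Category.comp_id] at this
    exact this

/-- The components of the map out of the unwinding attached to a map of pointed modules. -/
def ofPointedHomApp (S : QRSP.{u} p) : Env X (tiltKer p S.obj) ⟶ F.right.obj S :=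
  Env.lift (str F S).hom _ (isPointedLinear_pt hF h₃ u)

theorem ofPointedHomApp_incl (b : tilt p S.obj) :
    (ofPointedHomApp hF h₃ u S).hom (Env.incl X _ b) = (str F S).hom b :=
  Env.lift_incl ..

theorem univ_ofPointedHomApp (i : tiltKer p S.obj) :
    Env.univ X _ i ≫ ofPointedHomApp hF h₃ u S = pullback hF h₃ u ≫ pt hQ i :=
  Env.univ_lift ..

theorem envMap_ofPointedHomApp {S' : QRSP.{u} p} (f : S.obj ⟶ S'.obj) :
    envMap X f ≫ ofPointedHomApp hF h₃ u S' = ofPointedHomApp hF h₃ u S ≫ app F f := by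
  refine Env.hom_ext (fun b => ?_) fun i => ?_
  · rw [CommAlgCat.hom_comp, AlgHom.comp_apply, envMap_incl, ofPointedHomApp_incl,
      CommAlgCat.hom_comp, AlgHom.comp_apply, ofPointedHomApp_incl]
    exact (congrArg (fun f => f.hom b) (str_app F f)).symm
  · rw [← Category.assoc, univ_envMap, univ_ofPointedHomApp, ← Category.assoc,
      univ_ofPointedHomApp, Category.assoc, pt_app]
    rfl

/-- The map out of the unwinding attached to a map of pointed modules. -/
def ofPointedHom : (unwinding p).obj (.op X) ⟶ F :=
  Under.homMk
    { app := ofPointedHomApp hF h₃ u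
      naturality := fun _ _ f => envMap_ofPointedHomApp hF h₃ u f.hom }
    (NatTrans.ext (funext fun _ => CommAlgCat.hom_ext (AlgHom.ext
      (ofPointedHomApp_incl hF h₃ u))))

end

section

variable (η : (unwinding p).obj (.op X) ⟶ F)

/-- The components of a map out of the unwinding. -/
def component (S : QRSP.{u} p) : Env X (tiltKer p S.obj) ⟶ F.right.obj S := η.right.app S

theorem component_incl (b : tilt p S.obj) :
    (component η S).hom (Env.incl X _ b) = (str F S).hom b :=
  congrArg (fun f => f.hom b) (str_comp_right η (S := S))

theorem envMap_component {S' : QRSP.{u} p} (f : S.obj ⟶ S'.obj) :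
    envMap X f ≫ component η S' = component η S ≫ app F f :=
  app_comp_right η f

variable (hQ) in
/-- The pullback of functions along the map of pointed modules attached to `η`. -/
def toPointedHomPullback : X.Γ ⟶ F.right.obj (hQ.S (baseField p)) :=
  Env.univ X _ (Trunc.gen (baseField p)) ≫ component η (hQ.S (baseField p))

/-- A Yoneda argument: the value on any kernel element is determined by naturality along its
classifying map from the value at `x`. -/
theorem toPointedHomPullback_pt (i : tiltKer p S.obj) :
    toPointedHomPullback hQ η ≫ pt hQ i = Env.univ X _ i ≫ component η S := by
  rw [toPointedHomPullback, Category.assoc, pt, ← envMap_component η (S := hQ.S (baseField p)),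
    ← Category.assoc, univ_envMap]
  exact congrArg (Env.univ X _ · ≫ component η S) (Trunc.map_classify i)

theorem toPointedHomPullback_pt_assoc (i : tiltKer p S.obj) (χ : F.right.obj S ⟶ R) :
    toPointedHomPullback hQ η ≫ pt hQ i ≫ χ = Env.univ X _ i ≫ component η S ≫ χ := by
  rw [← Category.assoc, toPointedHomPullback_pt, Category.assoc]

theorem isPointedLinear_component (χ : F.right.obj S ⟶ R) :
    IsPointedLinear X (tiltKer p S.obj) (str F S ≫ χ).hom
      (fun i => toPointedHomPullback hQ η ≫ pt hQ i ≫ χ) := by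
  have := (Env.isPointedLinear_univ X (tiltKer p S.obj)).comp (component η S ≫ χ)
  have h : (component η S ≫ χ).hom.comp (Env.incl X (tiltKer p S.obj)) = (str F S ≫ χ).hom :=
    AlgHom.ext fun b => congrArg χ.hom (component_incl η b)
  rw [h] at this
  simpa only [toPointedHomPullback_pt_assoc] using this

/-- The map of pointed modules attached to a map out of the unwinding. -/
def toPointedHom : toPointedModule hF h₃ ⟶ X where
  pullback := toPointedHomPullback hQ η
  map_add y₁ y₂ := by
    obtain ⟨S, χ, i, j, -, rfl, rfl, -⟩ := exists_realization hF h₃ y₁ y₂ y₁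
    exact (congrArg (toPointedHomPullback hQ η ≫ ·) (add_pt hF χ i j)).trans
      ((isPointedLinear_component η χ).map_add i j)
  map_smul a y := by
    obtain ⟨S, χ, i, -, -, rfl, -, -, hs⟩ := exists_realization hF h₃ y y y
    obtain ⟨a, rfl⟩ := hs a
    exact (congrArg (toPointedHomPullback hQ η ≫ ·) (smul_pt hF χ a i)).trans
      ((isPointedLinear_component η χ).map_smul a i)
  map_d y := by
    obtain ⟨S, χ, i, -, -, rfl, -⟩ := exists_realization hF h₃ y y y
    exact ((isPointedLinear_component η χ).map_d i).trans (act_pt χ i).symm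

theorem ofPointedHom_toPointedHom : ofPointedHom hF h₃ (toPointedHom hF h₃ η) = η := by
  refine Under.UnderMorphism.ext (NatTrans.ext (funext fun S => ?_))
  change ofPointedHomApp hF h₃ (toPointedHom hF h₃ η) S = component η S
  refine Env.hom_ext (fun b => ?_) fun i => ?_
  · rw [ofPointedHomApp_incl, component_incl]
  · rw [univ_ofPointedHomApp]
    exact toPointedHomPullback_pt η i

end

theorem toPointedHom_ofPointedHom (u : toPointedModule hF h₃ ⟶ X) :
    toPointedHom hF h₃ (ofPointedHom hF h₃ u) = u := by
  refine PointedModule.Hom.ext ?_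
  refine (univ_ofPointedHomApp hF h₃ u (S := hQ.S (baseField p)) _).trans ?_
  rw [pt_gen, Category.comp_id]
  rfl

end

end TensorPoints

end

end Unwinding

/-! ### The unit of the adjunction -/

namespace Unwinding

noncomputable section

variable {p : ℕ} [hp : Fact p.Prime]

/-- The case of one generator over `𝔽_p`, where the enveloping algebra is `Γ(X)`; the inverse is
classified by the identity point. -/
theorem isIso_gen {X : PointedModule.{u} p} (hX : X.IsNilpotentQuasiIdeal) :
    IsIso (Env.univ X (tiltKer p (Trunc.obj (baseField p))) (Trunc.gen (baseField p))) := by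
  have hU := isUniv_trunc (baseField.{u} p)
  obtain ⟨F, -, hF⟩ := hU.exists_env_hom hX (fromBase p X.Γ) fun _ => 𝟙 X.Γ
  have h : Env.univ X (tiltKer p (Trunc.obj (baseField p))) (Trunc.gen (baseField p)) ≫ F = 𝟙 _ :=
    hF ⟨⟩
  refine ⟨F, h, hU.env_hom_ext hX.2 (fun b => ?_) fun _ => ?_⟩
  · let g : baseField p ⟶ Env X (tiltKer p (Trunc.obj (baseField.{u} p))) :=
      CommAlgCat.ofHom ((Env.incl X _).comp
        ((tilt.map (Trunc.unit (baseField p)).hom).comp (tilt.ofPerfect (baseField p)).toAlgHom))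
    exact congrArg (fun f => f.hom b) (Subsingleton.elim (g ≫ F ≫ Env.univ X _ (Trunc.gen _))
      (g ≫ 𝟙 _))
  · exact (Category.assoc _ _ _).symm.trans ((congrArg (· ≫ _) h).trans
      ((Category.id_comp _).trans (Category.comp_id _).symm))

theorem PointedModule.isIso_of_isIso_pullback {X Y : PointedModule.{u} p} (f : X ⟶ Y)
    [IsIso f.pullback] : IsIso f := by
  refine ⟨⟨inv f.pullback, fun x y => ?_, fun a x => ?_, fun x => ?_⟩, ?_, ?_⟩
  · rw [← cancel_epi f.pullback, f.map_add]
    simp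
  · rw [← cancel_epi f.pullback, f.map_smul]
    simp
  · rw [← f.map_d, IsIso.hom_inv_id_assoc]
  · exact PointedModule.Hom.ext (IsIso.inv_hom_id f.pullback)
  · exact PointedModule.Hom.ext (IsIso.hom_inv_id f.pullback)

namespace TensorPoints

theorem ofPointedHomApp_comp {hQ : ModelsQRSP.{u} p} {F : Under (tiltFunctor.{u} p)}
    (hF : IsTensor hQ F) (h₃ : IsThreefoldTensor hQ F) {X Y : PointedModule.{u} p}
    (v : toPointedModule hF h₃ ⟶ X) (w : X ⟶ Y) (S : QRSP.{u} p) :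
    ofPointedHomApp hF h₃ (v ≫ w) S =
      Env.map w (AlgHom.id (ZMod p) (tilt p S.obj)) (fun i => i.2) ≫ ofPointedHomApp hF h₃ v S := by
  have key (m : Env Y (tiltKer p S.obj) ⟶ Env X (tiltKer p S.obj))
      (h₁ : ∀ b, m.hom (Env.incl Y _ b) = Env.incl X _ b)
      (h₂ : ∀ i, Env.univ Y _ i ≫ m = w.pullback ≫ Env.univ X _ i) :
      ofPointedHomApp hF h₃ (v ≫ w) S = m ≫ ofPointedHomApp hF h₃ v S := by
    refine Env.hom_ext (fun b => ?_) fun i => ?_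
    · rw [ofPointedHomApp_incl, CommAlgCat.hom_comp, AlgHom.comp_apply, h₁, ofPointedHomApp_incl]
    · rw [univ_ofPointedHomApp, ← Category.assoc, h₂, Category.assoc, univ_ofPointedHomApp]
      exact Category.assoc _ _ _
  exact key _ (fun b => Env.map_incl ..) fun i => Env.univ_map ..

variable {hQ : ModelsQRSP.{u} p}
  (hUn : ∀ X : (NilpotentQuasiIdeal.{u} p)ᵒᵖ, IsTensor hQ ((unwindingNilpotent p).obj X) ∧
    IsThreefoldTensor hQ ((unwindingNilpotent p).obj X))

/-- The adjunction between unwinding and restriction. -/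
def adjunction : ObjectProperty.lift _ (unwindingNilpotent p) hUn ⊣ restriction hQ :=
  Adjunction.mkOfHomEquiv
    { homEquiv := fun X F =>
        { toFun := fun η => Quiver.Hom.op (ObjectProperty.homMk
            (toPointedHom F.property.1 F.property.2 (X := X.unop.obj) η.hom))
          invFun := fun u => ObjectProperty.homMk
            (ofPointedHom F.property.1 F.property.2 (X := X.unop.obj) u.unop.hom)
          left_inv := fun η => by
            ext1
            exact ofPointedHom_toPointedHom F.property.1 F.property.2 η.hom
          right_inv := fun u => by
            apply Quiver.Hom.unop_inj
            ext1
            exact toPointedHom_ofPointedHom F.property.1 F.property.2 (X := X.unop.obj) u.unop.hom }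
      homEquiv_naturality_left_symm := fun {X' X F} f g => by
        ext1
        refine Under.UnderMorphism.ext (NatTrans.ext (funext fun S => ?_))
        exact ofPointedHomApp_comp F.property.1 F.property.2 (X := X.unop.obj)
          g.unop.hom f.unop.hom S
      homEquiv_naturality_right := fun {X F F'} f g => by
        apply Quiver.Hom.unop_inj
        ext1
        refine PointedModule.Hom.ext ?_
        exact (Category.assoc _ _ _).symm }

/-- On functions, the unit is the universal point at `x`. -/
theorem isIso_adjunction_unit : IsIso (adjunction hUn).unit := by
  have (X : (NilpotentQuasiIdeal.{u} p)ᵒᵖ) : IsIso ((adjunction hUn).unit.app X) := by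
    have h₁ : IsIso ((adjunction hUn).unit.app X).unop.hom.pullback := by
      have h₂ := isIso_gen X.unop.property
      have h₃ : ((adjunction hUn).unit.app X).unop.hom.pullback =
          Env.univ X.unop.obj (tiltKer p (Trunc.obj (baseField p))) (Trunc.gen (baseField p)) :=
        Category.comp_id _
      rw [h₃]
      exact h₂
    have h₂ : IsIso ((adjunction hUn).unit.app X).unop.hom :=
      PointedModule.isIso_of_isIso_pullback _
    have h₃ : IsIso ((adjunction hUn).unit.app X).unop :=
      (ObjectProperty.isIso_hom_iff _).mp h₂
    exact (isIso_unop_iff _).mp h₃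
  exact NatIso.isIso_of_isIso_app _

include hUn

theorem full_unwindingNilpotent : (unwindingNilpotent.{u} p).Full := by
  have := isIso_adjunction_unit hUn
  have := (adjunction hUn).fullyFaithfulLOfIsIsoUnit.full
  exact .of_iso (ObjectProperty.liftCompιIso (fun F => IsTensor hQ F ∧ IsThreefoldTensor hQ F)
    (unwindingNilpotent p) hUn)

theorem faithful_unwindingNilpotent : (unwindingNilpotent.{u} p).Faithful := by
  have := isIso_adjunction_unit hUn
  have := (adjunction hUn).fullyFaithfulLOfIsIsoUnit.faithful
  exact .of_iso (ObjectProperty.liftCompιIso (fun F => IsTensor hQ F ∧ IsThreefoldTensor hQ F)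
    (unwindingNilpotent p) hUn)

end TensorPoints

end

end Unwinding

/-! ### The main theorem. -/

theorem mainTheorem3 (p : ℕ) [Fact p.Prime] :
    ∃ (hQ : Unwinding.ModelsQRSP.{u} p)
      (hUn : ∀ X : (Unwinding.NilpotentQuasiIdeal.{u} p)ᵒᵖ,
        Unwinding.IsTensor hQ ((Unwinding.unwindingNilpotent p).obj X) ∧
        Unwinding.IsThreefoldTensor hQ ((Unwinding.unwindingNilpotent p).obj X)),
      (ObjectProperty.lift (Unwinding.IsTensor hQ) (Unwinding.unwindingNilpotent p)
        (fun X => (hUn X).1)).Full ∧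
      (ObjectProperty.lift (Unwinding.IsTensor hQ) (Unwinding.unwindingNilpotent p)
        (fun X => (hUn X).1)).Faithful ∧
      ∃ r : Unwinding.TensorFunctor₃ hQ ⥤ (Unwinding.NilpotentQuasiIdeal.{u} p)ᵒᵖ,
        Unwinding.IsRestriction hQ r ∧
        ∃ adj : ObjectProperty.lift _ (Unwinding.unwindingNilpotent p) hUn ⊣ r,
          IsIso adj.unit := by
  have hUn (X : (Unwinding.NilpotentQuasiIdeal.{u} p)ᵒᵖ) :=
    And.intro (Unwinding.isTensor_unwinding (Unwinding.modelsQRSP p) X)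
      (Unwinding.isThreefoldTensor_unwinding (Unwinding.modelsQRSP p) X)
  have := Unwinding.TensorPoints.full_unwindingNilpotent hUn
  have := Unwinding.TensorPoints.faithful_unwindingNilpotent hUn
  -- Corestricting a full or faithful functor to a full subcategory keeps the property.
  exact ⟨Unwinding.modelsQRSP p, hUn, inferInstance, inferInstance,
    Unwinding.TensorPoints.restriction _, Unwinding.TensorPoints.isRestriction_restriction _,
    Unwinding.TensorPoints.adjunction hUn, Unwinding.TensorPoints.isIso_adjunction_unit hUn⟩
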